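/- Let $n\ge 1$, let $dd^c=\frac{i}{\pi}\partial\bar\partial$, and let $\omega=\omega_{FS}$ be the Fubini–Study form on $\mathbb P^n$, with local potential $\frac12\log(1+\|z\|^2)$ in each affine chart. For a bounded $\omega$-plurisubharmonic function $\varphi$ write $\omega_\varphi=\omega+dd^c\varphi$, and let $\omega_\varphi^n$ be its Bedford–Taylor Monge–Ampère measure. (1) Let $\alpha\in(0,1)$. There are constants $0<D<B$ with $B\,2^{2\alpha}<\log 2+D$. For all such constants there is a continuous, radial plurisubharmonic function $\rho$ on $\mathbb C^n$, smooth away from the origin, with $\rho(z)=B\|z\|^{2\alpha}$ for $\|z\|\le\frac34$ and $\rho(z)=\log\|z\|+D$ for $\|z\|\ge 2$, such that the following holds. For every $h\in\mathbb C^n$ the function $$\bar\rho_h([1:z])=\rho(z+h)-\tfrac12\log(1+\|z\|^2)$$ extends continuously to $\mathbb P^n$, and the extension, again denoted $\bar\rho_h$, is bounded and $\omega$-plurisubharmonic; write $\bar\rho=\bar\rho_0$. Moreover: * $\bar\rho_h\to\bar\rho$ uniformly on $\mathbb P^n$ as $h\to0$, and $\|\bar\rho_h-\bar\rho\|_\infty\ge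 B\|h\|^{2\alpha}$ whenever $\|h\|\le\frac34$. * $\omega_{\bar\rho_h}^n=f_h\,\omega^n$ for a measurable function $f_h\ge0$ which in the chart $z\mapsto[1:z]$ is smooth on $\mathbb C^n\setminus\{-h\}$. For every $p$ with $1<p<\frac1{1-\alpha}$ one has $f_h\in L^p(\omega^n)$ for all $h$, and the $L^p$ norms are bounded uniformly for $\|h\|\le1$. * If $\alpha<\frac1{2n}$, then there are $C$ and $\delta>0$ such that for $\|h\|\le\delta$ $$\int_{\mathbb P^n}|\omega_{\bar\rho}^n-\omega_{\bar\rho_h}^n|=\int_{\mathbb P^n}|f_0-f_h|\,\omega^n\le C\|h\|^{2n\alpha}.$$ (2) Consequently the exponent $\frac1{n+\epsilon}$ in the $L^1$ stability estimate is optimal: for every $p$ with $1<p<\frac{2n}{2n-1}$ there is $c_0>0$ such that for every real $m$ with $0<m<n$ there is no constant $C$ for which $$\|\varphi-\psi\|_\infty\le C\,\|f-g\|_{L^1(\omega^n)}^{1/m}$$ holds for all bounded $\omega$-plurisubharmonic $\varphi,\psi$ on $\mathbb P^n$ with $\omega_\varphi^n=f\omega^n$, $\omega_\psi^n=g\omega^n$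 and $\sup(\varphi-\psi)=\sup(\psi-\varphi)$, where $f,g\ge0$ satisfy $\|f\|_{L^p(\omega^n)},\|g\|_{L^p(\omega^n)}\le c_0$ and $\int f\omega^n=\int g\omega^n=\int\omega^n$. -/

import Mathlib

open MeasureTheory Filter Topology
open scoped ContDiff

noncomputable section

/-! ### Calculus on `ℂⁿ` -/

/-- The Euclidean (Hermitian) norm on `ℂⁿ`. -/
def hermNorm {n : ℕ} (z : Fin n → ℂ) : ℝ := Real.sqrt (∑ j, ‖z j‖ ^ 2)

/-- The Levi matrix `(∂²u / ∂z_j ∂z̄_l)_{j,l}` of a real function `u` on `ℂⁿ`, written through the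
second real derivative, with `∂/∂z_j = (∂/∂x_j - i ∂/∂y_j)/2` and
`∂/∂z̄_l = (∂/∂x_l + i ∂/∂y_l)/2`. -/
def leviMatrix {n : ℕ} (u : (Fin n → ℂ) → ℝ) (z : Fin n → ℂ) : Matrix (Fin n) (Fin n) ℂ :=
  fun j l =>
    let d : (Fin n → ℂ) → (Fin n → ℂ) → ℝ := fun v w => fderiv ℝ (fderiv ℝ u) z v w
    let ex : Fin n → Fin n → ℂ := fun k => Pi.single k 1
    let ey : Fin n → Fin n → ℂ := fun k => Pi.single k Complex.I
    (((d (ex j) (ex l) + d (ey j) (ey l) : ℝ) : ℂ)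
      + Complex.I * ((d (ex j) (ey l) - d (ey j) (ex l) : ℝ) : ℂ)) / 4

/-- Plurisubharmonic functions on `ℂⁿ` with finite values: upper semicontinuous, with the
sub-mean value inequality on every circle of every complex line. -/
structure IsPSH {n : ℕ} (u : (Fin n → ℂ) → ℝ) : Prop where
  usc : UpperSemicontinuous u
  circleIntegrable : ∀ a b : Fin n → ℂ, CircleIntegrable (fun ζ : ℂ => u (a + ζ • b)) 0 1
  le_circleAverage : ∀ a b : Fin n → ℂ,
    u a ≤ Real.circleAverage (fun ζ : ℂ => u (a + ζ • b)) 0 1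

/-! ### The Bedford–Taylor Monge–Ampère measure

`dd^c = (i/π) ∂∂̄`. A current `T` of bidegree `(n-m, n-m)` is given by its coefficients
`T ∧ (i/π)dz_{j₁} ∧ dz̄_{l₁} ∧ ⋯ ∧ (i/π)dz_{j_m} ∧ dz̄_{l_m}`, which are indexed by
`I = ((j₁,l₁), …, (j_m,l_m))`. -/

/-- The constant `c` for which
`(i/π)dz_{j₁} ∧ dz̄_{l₁} ∧ ⋯ ∧ (i/π)dz_{j_n} ∧ dz̄_{l_n} = c · (Lebesgue measure)` on `ℂⁿ`, that
is `(2/π)ⁿ` times the signs of the index maps `j` and `l` (zero unless both are permutations). -/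
def wedgeConst {n : ℕ} (I : Fin n → Fin n × Fin n) : ℂ :=
  ((2 / Real.pi : ℝ) : ℂ) ^ n
    * ((1 : Matrix (Fin n) (Fin n) ℂ).submatrix (fun a => (I a).1) id).det
    * ((1 : Matrix (Fin n) (Fin n) ℂ).submatrix (fun a => (I a).2) id).det

/-- Test functions on `ℂⁿ`. -/
def IsTestFunction {n : ℕ} (χ : (Fin n → ℂ) → ℝ) : Prop :=
  ContDiff ℝ ∞ χ ∧ HasCompactSupport χ

/-- `(dd^c u)ⁿ = μ` on `ℂⁿ` in the sense of Bedford and Taylor, for a locally bounded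
plurisubharmonic function `u`: with `T_k = (dd^c u)^k` one has `T_0 = 1` and
`T_{k+1} = dd^c (u T_k)` in the sense of currents, that is
`∫ χ T_{k+1} ∧ β = ∫ u dd^c χ ∧ T_k ∧ β` for all test functions `χ` and constant forms `β`; every
`T_k` has locally finite complex measures as coefficients, and `T_n = μ`.
The coefficient of `T_{n-m}` at `I` is the complex measure `θ m I · ν`. -/
def IsBedfordTaylor {n : ℕ} (u : (Fin n → ℂ) → ℝ) (μ : Measure (Fin n → ℂ)) : Prop :=
  IsFiniteMeasureOnCompacts μ ∧
  ∃ (ν : Measure (Fin n → ℂ))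
    (θ : (m : ℕ) → (Fin m → Fin n × Fin n) → (Fin n → ℂ) → ℂ),
    (∀ m ≤ n, ∀ I, LocallyIntegrable (θ m I) ν) ∧
    (∀ I χ, IsTestFunction χ →
      ∫ z, (χ z : ℂ) * θ n I z ∂ν = wedgeConst I * ((∫ z, χ z : ℝ) : ℂ)) ∧
    (∀ m < n, ∀ I χ, IsTestFunction χ →
      ∫ z, (χ z : ℂ) * θ m I z ∂ν =
        ∑ j, ∑ l, ∫ z, (u z : ℂ) * leviMatrix χ z j l * θ (m + 1) (Fin.cons (j, l) I) z ∂ν) ∧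
    (∀ I χ, IsTestFunction χ →
      ∫ z, (χ z : ℂ) * θ 0 I z ∂ν = ((∫ z, χ z ∂μ : ℝ) : ℂ))

/-! ### Projective space with the Fubini–Study form -/

open scoped LinearAlgebra.Projectivization in
/-- Complex projective space `ℙⁿ`. -/
abbrev CP (n : ℕ) : Type := ℙ ℂ (Fin (n + 1) → ℂ)

/-- The quotient topology of `ℂⁿ⁺¹ ∖ {0}`. -/
instance cpTopology (n : ℕ) : TopologicalSpace (CP n) :=
  TopologicalSpace.coinduced (Projectivization.mk' ℂ) inferInstance

instance cpMeasurable (n : ℕ) : MeasurableSpace (CP n) := borel (CP n)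

instance cpBorel (n : ℕ) : BorelSpace (CP n) := ⟨rfl⟩

/-- The affine chart `z ↦ [z_1 : ⋯ : 1 : ⋯ : z_n]` of `ℙⁿ`, with the `1` in place `i`;
for `i = 0` this is the standard inclusion `z ↦ [1 : z]`. -/
def affineChart {n : ℕ} (i : Fin (n + 1)) (z : Fin n → ℂ) : CP n :=
  Projectivization.mk ℂ (i.insertNth (α := fun _ => ℂ) 1 z) (fun h => by
    have h1 := congrFun h i
    simp at h1)

/-- The local potential `½ log(1 + ‖z‖²)` of the Fubini–Study form `ω` in each affine chart. -/
def fsPotential {n : ℕ} (z : Fin n → ℂ) : ℝ := Real.log (1 + hermNorm z ^ 2) / 2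

/-- The density of `ωⁿ = (dd^c ½ log(1 + ‖z‖²))ⁿ` with respect to Lebesgue measure in each affine
chart. -/
def fsDensity {n : ℕ} (z : Fin n → ℂ) : ℝ :=
  (n.factorial : ℝ) * (2 / Real.pi) ^ n * (leviMatrix fsPotential z).det.re

/-- The volume form `ωⁿ` as a measure on `ℙⁿ` (the hyperplane at infinity is a null set). -/
def fsVolume (n : ℕ) : Measure (CP n) :=
  Measure.map (affineChart 0)
    ((volume : Measure (Fin n → ℂ)).withDensity (fun z => ENNReal.ofReal (fsDensity z)))

/-- `φ ∈ PSH(ℙⁿ, ω) ∩ L^∞(ℙⁿ)`: in every affine chart, `φ` plus the local potential of `ω` is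
plurisubharmonic. -/
structure IsBoundedOmegaPSH {n : ℕ} (φ : CP n → ℝ) : Prop where
  bounded : ∃ M : ℝ, ∀ x, |φ x| ≤ M
  psh : ∀ i, IsPSH (fun z => φ (affineChart i z) + fsPotential z)

/-- `ω_φⁿ = f ωⁿ` on `ℙⁿ`, where `ω_φ = ω + dd^c φ`, for a bounded `ω`-plurisubharmonic
function `φ`. -/
def SolvesMongeAmpere {n : ℕ} (φ f : CP n → ℝ) : Prop :=
  ∀ i, IsBedfordTaylor (fun z => φ (affineChart i z) + fsPotential z)
    ((volume : Measure (Fin n → ℂ)).withDensity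
      (fun z => ENNReal.ofReal (f (affineChart i z) * fsDensity z)))

/-- `f` is an admissible right hand side: a non-negative `L^p(ωⁿ)` function of norm at most `c₀`
with the proper total integral `∫ f ωⁿ = ∫ ωⁿ`. -/
structure IsAdmissibleDensity {n : ℕ} (p c₀ : ℝ) (f : CP n → ℝ) : Prop where
  measurable : Measurable f
  nonneg : ∀ x, 0 ≤ f x
  memLp : MemLp f (ENNReal.ofReal p) (fsVolume n)
  norm_le : eLpNorm f (ENNReal.ofReal p) (fsVolume n) ≤ ENNReal.ofReal c₀
  integral_eq : ∫ x, f x ∂(fsVolume n) = (fsVolume n).real Set.univ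

/-- The stability estimate `‖φ - ψ‖_∞ ≤ C ‖f - g‖_1^{1/m}` on `(ℙⁿ, ω)`, for all bounded
`ω`-plurisubharmonic solutions of `ω_φⁿ = f ωⁿ`, `ω_ψⁿ = g ωⁿ` normalized by
`sup (φ - ψ) = sup (ψ - φ)`, where the `L^p` norms of `f` and `g` are at most `c₀`. -/
def StabilityEstimate (n : ℕ) (p c₀ m C : ℝ) : Prop :=
  ∀ φ ψ f g : CP n → ℝ,
    IsBoundedOmegaPSH φ → IsBoundedOmegaPSH ψ →
    IsAdmissibleDensity p c₀ f → IsAdmissibleDensity p c₀ g →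
    SolvesMongeAmpere φ f → SolvesMongeAmpere ψ g →
    (⨆ x, (φ x - ψ x)) = (⨆ x, (ψ x - φ x)) →
    (⨆ x, |φ x - ψ x|) ≤ C * (∫ x, |f x - g x| ∂(fsVolume n)) ^ (1 / m)

/-- The constants allowed in the construction: `0 < D < B` and `B 2^{2α} < log 2 + D`. -/
def AdmissibleConstants (α B D : ℝ) : Prop :=
  0 < D ∧ D < B ∧ B * (2 : ℝ) ^ (2 * α) < Real.log 2 + D

/-- `ρ` is a smoothing of the function `ρ̂` that equals `B‖z‖^{2α}` for `‖z‖ ≤ 1`,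
`max {B‖z‖^{2α}, log ‖z‖ + D}` for `1 ≤ ‖z‖ ≤ 2`, and `log ‖z‖ + D` for `2 ≤ ‖z‖`: it is
plurisubharmonic, continuous, radial, smooth away from the origin, and still equal to `ρ̂` for
`‖z‖ ≤ 3/4` and for `‖z‖ ≥ 2`. -/
structure IsModelPotential {n : ℕ} (α B D : ℝ) (ρ : (Fin n → ℂ) → ℝ) : Prop where
  continuous : Continuous ρ
  psh : IsPSH ρ
  radial : ∀ z w, hermNorm z = hermNorm w → ρ z = ρ w
  smooth : ContDiffOn ℝ ∞ ρ {0}ᶜ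
  eq_inner : ∀ z, hermNorm z ≤ 3 / 4 → ρ z = B * hermNorm z ^ (2 * α)
  eq_outer : ∀ z, 2 ≤ hermNorm z → ρ z = Real.log (hermNorm z) + D

end

/-!
The model potential is `ρ(z) = χ(log ‖z‖)`, where `χ` is a smooth maximum of `B e^{2αs}` and
`s + D` (`exists_isProfile`). Since `χ` is convex with slopes in `(0, 1]`, the log-homogeneous
function `Φ(a, b) = χ(½ log (a/b)) + ½ log b` (`homPot`) is a supremum of functions
`k₁ log a + k₂ log b + c` with `k₁, k₂ ≥ 0` (`IsProfile.exists_log_le_homPot`). With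
`a = ‖w' + w₀ h‖²` and `b = |w₀|²` it is therefore plurisubharmonic in the homogeneous coordinates
`w = (w₀, w')`, including the points at infinity `w₀ = 0`, and it is the local potential of
`ω + dd^c ρ̄_h` in every affine chart (`cpPotential_affineChart`).

The Monge–Ampère measure is found by regularization. For smooth `u` the recursion of Bedford and
Taylor is integration by parts with the closed coefficients of `(dd^c u)^k`
(`integral_leviMatrix_powCoeff`). It passes to the limit as soon as the Levi matrices converge
almost everywhere with a majorant `G` such that `G, …, Gⁿ` are locally integrable
(`isBedfordTaylor_of_tendsto`). For `Φ(a + ε b, b)` a multiple of `a^(α-1)` is such a majorant: the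
potential is singular only at the zero of `a`, where it is `B (a/b + ε)^α` up to a smooth term and
the squared gradient of `a/b` is bounded by `a/b` (`IsProfile.exists_bound_chartPot_near`); as `a`
vanishes there to order two, `a^((α-1)n)` is locally integrable. The density comes from the Levi
determinant of a radial function in the chart `0`, and Levi determinants transform under the
change of charts by the same factor for `Φ` and for the Fubini–Study potential
(`IsProfile.det_leviMatrix_homPot`).

In the chart `0` the measure `ω_{ρ̄_h}ⁿ` is the translate by `-h` of a radial measure with compact
support, whose density is a multiple of `‖z‖^(-2n(1-α))` near the origin. This gives the `L^p` bound
for `p (1 - α) < 1` and, by comparing the density with its translate inside and outside the ball of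
radius `2‖h‖`, the `L¹` bound `C ‖h‖^{2nα}` (`IsProfile.exists_integral_radialDet_sub_le`). The total
mass is computed in polar coordinates (`exists_integral_radialDet`). On the other hand
`ρ̄_h - ρ̄` takes the value `B ‖h‖^{2α}` at `0` and the opposite value at `-h`, so that, even after
the normalization by constants, a stability estimate with the exponent `1/m` would give
`B ‖h‖^{2α} ≤ C ‖h‖^{2nα/m}` for all small `h`, which is impossible for `m < n`
(`IsProfile.not_stabilityEstimate`).
-/

/-! ### Wirtinger derivatives -/

/-- The first-order operator `(∂/∂x_j + c ∂/∂y_j) / 2` on complex-valued functions on `ℂⁿ`: this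
is `∂/∂z_j` for `c = -i` and `∂/∂z̄_j` for `c = i`. Keeping `c` as a parameter lets each rule be
proved once for both operators. -/
noncomputable def wirtinger {n : ℕ} (c : ℂ) (j : Fin n) (f : (Fin n → ℂ) → ℂ)
    (z : Fin n → ℂ) : ℂ :=
  (fderiv ℝ f z (Pi.single j 1) + c * fderiv ℝ f z (Pi.single j Complex.I)) / 2

namespace wirtinger

variable {n : ℕ} {c c' : ℂ} {j l : Fin n} {f g : (Fin n → ℂ) → ℂ} {z : Fin n → ℂ}

lemma contDiff (hf : ContDiff ℝ ∞ f) : ContDiff ℝ ∞ (wirtinger c j f) := by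
  have h : ContDiff ℝ ∞ (fderiv ℝ f) := hf.fderiv_right (by simp)
  unfold wirtinger
  fun_prop

lemma mul_apply (hf : DifferentiableAt ℝ f z) (hg : DifferentiableAt ℝ g z) :
    wirtinger c j (fun z => f z * g z) z = wirtinger c j f z * g z + f z * wirtinger c j g z := by
  simp only [wirtinger, fderiv_fun_mul hf hg]
  simp
  ring

lemma sum_apply {ι : Type*} {s : Finset ι} {F : ι → (Fin n → ℂ) → ℂ}
    (hF : ∀ i ∈ s, DifferentiableAt ℝ (F i) z) :
    wirtinger c j (fun z => ∑ i ∈ s, F i z) z = ∑ i ∈ s, wirtinger c j (F i) z := by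
  simp only [wirtinger, fderiv_fun_sum hF]
  simp [Finset.sum_add_distrib, Finset.mul_sum, Finset.sum_div, add_div]

lemma const_apply (a : ℂ) : wirtinger c j (fun _ => a) z = 0 := by
  simp [wirtinger]

/-- The value of an iterated Wirtinger derivative in terms of the second real derivative. -/
lemma wirtinger_apply (hf : ContDiff ℝ ∞ f) :
    wirtinger c j (wirtinger c' l f) z =
      (fderiv ℝ (fderiv ℝ f) z (Pi.single j 1) (Pi.single l 1)
        + c' * fderiv ℝ (fderiv ℝ f) z (Pi.single j 1) (Pi.single l Complex.I)
        + c * fderiv ℝ (fderiv ℝ f) z (Pi.single j Complex.I) (Pi.single l 1)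
        + c * c' * fderiv ℝ (fderiv ℝ f) z (Pi.single j Complex.I) (Pi.single l Complex.I)) / 4 := by
  have h : ContDiff ℝ ∞ (fderiv ℝ f) := hf.fderiv_right (by simp)
  have hd : DifferentiableAt ℝ (fderiv ℝ f) z := h.differentiable (by simp) z
  have hv : ∀ v w, fderiv ℝ (fun z => fderiv ℝ f z v) z w = fderiv ℝ (fderiv ℝ f) z w v := by
    intro v w
    rw [fderiv_clm_apply hd (differentiableAt_const v)]
    simp
  have hdv : ∀ v, DifferentiableAt ℝ (fun z => fderiv ℝ f z v) z := fun v => by fun_prop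
  have key : ∀ w, fderiv ℝ (wirtinger c' l f) z w =
      (fderiv ℝ (fderiv ℝ f) z w (Pi.single l 1)
        + c' * fderiv ℝ (fderiv ℝ f) z w (Pi.single l Complex.I)) / 2 := by
    intro w
    have : wirtinger c' l f = fun z => (fderiv ℝ f z (Pi.single l 1)
        + c' * fderiv ℝ f z (Pi.single l Complex.I)) * (1 / 2 : ℂ) := by
      ext z; simp [wirtinger, div_eq_mul_inv]
    rw [this, fderiv_mul_const ((hdv _).fun_add ((hdv _).const_mul _)),
      fderiv_fun_add (hdv _) ((hdv _).const_mul _), fderiv_const_mul (hdv _)]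
    simp [hv]
    ring
  rw [wirtinger, key, key]
  ring

lemma comm (hf : ContDiff ℝ ∞ f) :
    wirtinger c j (wirtinger c' l f) = wirtinger c' l (wirtinger c j f) := by
  ext z
  have hs : IsSymmSndFDerivAt ℝ f z := hf.contDiffAt.isSymmSndFDerivAt (by
    rw [minSmoothness_of_isRCLikeNormedField]; exact WithTop.coe_le_coe.2 le_top)
  rw [wirtinger_apply hf, wirtinger_apply hf, hs (Pi.single j 1) (Pi.single l 1),
    hs (Pi.single j 1) (Pi.single l Complex.I), hs (Pi.single j Complex.I) (Pi.single l 1),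
    hs (Pi.single j Complex.I) (Pi.single l Complex.I)]
  ring

/-- Integration by parts. -/
lemma integral_mul (hf : ContDiff ℝ ∞ f) (hg : ContDiff ℝ ∞ g)
    (hc : HasCompactSupport g) :
    ∫ z, f z * wirtinger c j g z = -∫ z, wirtinger c j f z * g z := by
  have hf1 : ContDiff ℝ ∞ (fderiv ℝ f) := hf.fderiv_right (by simp)
  have hg1 : ContDiff ℝ ∞ (fderiv ℝ g) := hg.fderiv_right (by simp)
  have hfc := hf.continuous
  have hgc := hg.continuous
  have hf1c := hf1.continuous
  have hg1c := hg1.continuous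
  have hc' : ∀ v, HasCompactSupport (fun z => fderiv ℝ g z v) := fun v => hc.fderiv_apply ℝ v
  have i1 : ∀ v, Integrable (fun z => fderiv ℝ f z v * g z) := fun v =>
    (by fun_prop : Continuous _).integrable_of_hasCompactSupport hc.mul_left
  have i2 : ∀ v, Integrable (fun z => f z * fderiv ℝ g z v) := fun v =>
    (by fun_prop : Continuous _).integrable_of_hasCompactSupport (hc' v).mul_left
  have i3 : Integrable (fun z => f z * g z) :=
    (by fun_prop : Continuous _).integrable_of_hasCompactSupport hc.mul_left
  have ibp : ∀ v, ∫ z, f z * fderiv ℝ g z v = -∫ z, fderiv ℝ f z v * g z := fun v =>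
    integral_mul_fderiv_eq_neg_fderiv_mul_of_integrable (i1 v) (i2 v) i3
      (fun x _ => hf.differentiable (by simp) x) (fun x _ => hg.differentiable (by simp) x)
  have e1 : ∀ z, f z * wirtinger c j g z = (1 / 2) * (f z * fderiv ℝ g z (Pi.single j 1))
      + (c / 2) * (f z * fderiv ℝ g z (Pi.single j Complex.I)) := by
    intro z; simp only [wirtinger]; ring
  have e2 : ∀ z, wirtinger c j f z * g z = (1 / 2) * (fderiv ℝ f z (Pi.single j 1) * g z)
      + (c / 2) * (fderiv ℝ f z (Pi.single j Complex.I) * g z) := by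
    intro z; simp only [wirtinger]; ring
  simp only [e1, e2]
  rw [integral_add ((i2 _).const_mul _) ((i2 _).const_mul _),
    integral_add ((i1 _).const_mul _) ((i1 _).const_mul _)]
  simp only [integral_const_mul, ibp]
  ring

lemma hasCompactSupport (hg : HasCompactSupport g) : HasCompactSupport (wirtinger c j g) := by
  have h1 := hg.fderiv_apply ℝ (Pi.single j 1)
  have h2 := hg.fderiv_apply ℝ (Pi.single j Complex.I)
  refine HasCompactSupport.intro (K := tsupport g) hg fun z hz => ?_
  have : fderiv ℝ g z = 0 := by
    have := (support_fderiv_subset ℝ (f := g))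
    by_contra h
    exact hz (this h)
  simp [wirtinger, this]

end wirtinger

/-- The Levi matrix of a smooth function is the matrix of the mixed Wirtinger derivatives. -/
lemma leviMatrix_eq_wirtinger {n : ℕ} {u : (Fin n → ℂ) → ℝ} (hu : ContDiff ℝ ∞ u)
    (z : Fin n → ℂ) (j l : Fin n) :
    leviMatrix u z j l =
      wirtinger (-Complex.I) j (wirtinger Complex.I l (fun z => (u z : ℂ))) z := by
  have hC : ContDiff ℝ ∞ (fun z => (u z : ℂ)) := Complex.ofRealCLM.contDiff.comp hu
  have h1 : ∀ z, fderiv ℝ (fun z => (u z : ℂ)) z = Complex.ofRealCLM ∘L fderiv ℝ u z := fun z =>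
    (Complex.ofRealCLM.hasFDerivAt.comp z (hu.differentiable (by simp) z).hasFDerivAt).fderiv
  have hd : Differentiable ℝ (fderiv ℝ u) := (hu.fderiv_right (m := ∞) (by simp)).differentiable (by simp)
  have h2 : ∀ v w, fderiv ℝ (fderiv ℝ (fun z => (u z : ℂ))) z v w
      = ((fderiv ℝ (fderiv ℝ u) z v w : ℝ) : ℂ) := by
    intro v w
    have : fderiv ℝ (fun z => (u z : ℂ)) =
        fun z => ContinuousLinearMap.compL ℝ _ _ _ Complex.ofRealCLM (fderiv ℝ u z) := by
      ext1 z; rw [h1]; rfl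
    rw [this]
    have h3 := ((ContinuousLinearMap.compL ℝ (Fin n → ℂ) ℝ ℂ Complex.ofRealCLM).hasFDerivAt.comp z
      (hd z).hasFDerivAt).fderiv
    simp only [Function.comp_def] at h3
    rw [h3]
    simp
  have hI := Complex.I_mul_I
  rw [wirtinger.wirtinger_apply hC]
  simp only [h2, leviMatrix]
  push_cast
  ring_nf
  simp only [Complex.I_sq]
  ring

/-! ### Coefficients of exterior powers of a `(1,1)`-form -/

/-- `wedgeConst` for an index of arbitrary length `m`, set to zero unless `m = n`. -/
noncomputable def topCoeff {n : ℕ} (m : ℕ) (I : Fin m → Fin n × Fin n) : ℂ :=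
  if h : m = n then wedgeConst (fun a => I (Fin.cast h.symm a)) else 0

/-- For the `(1,1)`-form `η = (i/π) ∑ H_{jl} dz_j ∧ dz̄_l` with constant coefficients, the
coefficient of `ηᵏ` at the index `I` of length `m` (meaningful for `k + m = n`). -/
noncomputable def powCoeff {n : ℕ} (H : Matrix (Fin n) (Fin n) ℂ) :
    (k m : ℕ) → (Fin m → Fin n × Fin n) → ℂ
  | 0, m, I => topCoeff m I
  | k + 1, m, I => ∑ j, ∑ l, H j l * powCoeff H k (m + 1) (Fin.cons (j, l) I)

section algebra

variable {n m : ℕ}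

/-- Exchanges the first components of an index at the places `a` and `b`. -/
def swapFst (a b : Fin m) (I : Fin m → Fin n × Fin n) : Fin m → Fin n × Fin n :=
  fun c => ((I (Equiv.swap a b c)).1, (I c).2)

lemma swapFst_cons (a b : Fin m) (x : Fin n × Fin n) (I : Fin m → Fin n × Fin n) :
    (Fin.cons x (swapFst a b I) : Fin (m + 1) → Fin n × Fin n)
      = swapFst a.succ b.succ (Fin.cons x I) := by
  funext c
  refine Fin.cases ?_ (fun c => ?_) c
  · simp [swapFst, Equiv.swap_apply_of_ne_of_ne (Fin.succ_ne_zero a).symm (Fin.succ_ne_zero b).symm]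
  · have : Equiv.swap a.succ b.succ c.succ = (Equiv.swap a b c).succ := by
      simp only [Equiv.swap_apply_def, Fin.succ_inj]
      split_ifs <;> rfl
    simp [swapFst, this]

lemma topCoeff_swapFst {a b : Fin m} (hab : a ≠ b) (I : Fin m → Fin n × Fin n) :
    topCoeff m (swapFst a b I) = -topCoeff m I := by
  by_cases h : m = n
  · subst h
    have := Matrix.det_permute (Equiv.swap a b)
      ((1 : Matrix (Fin m) (Fin m) ℂ).submatrix (fun a => (I a).1) id)
    rw [Equiv.Perm.sign_swap hab, Matrix.submatrix_submatrix] at this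
    simp only [topCoeff, dif_pos, wedgeConst, swapFst, Fin.cast_eq_self]
    have h2 : ((1 : Matrix (Fin m) (Fin m) ℂ).submatrix (fun c => (I (Equiv.swap a b c)).1) id).det
        = -((1 : Matrix (Fin m) (Fin m) ℂ).submatrix (fun a => (I a).1) id).det := by
      simpa [Function.comp_def] using this
    rw [h2]
    ring
  · simp [topCoeff, h]

/-- The coefficients of a power are alternating in the holomorphic indices. -/
lemma powCoeff_swapFst (H : Matrix (Fin n) (Fin n) ℂ) (k : ℕ) {m : ℕ} {a b : Fin m}
    (hab : a ≠ b) (I : Fin m → Fin n × Fin n) :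
    powCoeff H k m (swapFst a b I) = -powCoeff H k m I := by
  induction k generalizing m with
  | zero => exact topCoeff_swapFst hab I
  | succ k ih =>
    simp only [powCoeff, swapFst_cons]
    simp_rw [ih (fun h => hab (Fin.succ_injective _ h))]
    simp

/-- Exchanging the roles of the holomorphic and the antiholomorphic indices transposes the
matrix of the form. -/
lemma powCoeff_transpose (H : Matrix (Fin n) (Fin n) ℂ) (k m : ℕ)
    (I : Fin m → Fin n × Fin n) :
    powCoeff H.transpose k m (fun a => (I a).swap) = powCoeff H k m I := by
  induction k generalizing m with
  | zero =>
    simp only [powCoeff, topCoeff, wedgeConst, Prod.fst_swap, Prod.snd_swap]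
    split_ifs <;> ring
  | succ k ih =>
    simp only [powCoeff, Matrix.transpose_apply]
    rw [Finset.sum_comm]
    refine Finset.sum_congr rfl fun j _ => Finset.sum_congr rfl fun l _ => ?_
    rw [← ih (m + 1) (Fin.cons (j, l) I)]
    congr 2
    funext c
    refine Fin.cases ?_ (fun c => ?_) c <;> simp

lemma continuous_powCoeff (k m : ℕ) (I : Fin m → Fin n × Fin n) :
    Continuous (fun H : Matrix (Fin n) (Fin n) ℂ => powCoeff H k m I) := by
  induction k generalizing m with
  | zero => exact continuous_const
  | succ k ih =>
    simp only [powCoeff]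
    refine continuous_finsetSum _ fun j _ => continuous_finsetSum _ fun l _ => ?_
    exact (continuous_id.matrix_elem j l).mul (ih _ _)

/-- Bound for the coefficients of `ηᵏ` by the `k`-th power of a bound for those of `η`. -/
lemma exists_norm_powCoeff_le (n k m : ℕ) : ∃ C : ℝ, 0 ≤ C ∧
    ∀ (H : Matrix (Fin n) (Fin n) ℂ) (G : ℝ), (∀ j l, ‖H j l‖ ≤ G) →
      ∀ I : Fin m → Fin n × Fin n, ‖powCoeff H k m I‖ ≤ C * G ^ k := by
  induction k generalizing m with
  | zero =>
    refine ⟨∑ I : Fin m → Fin n × Fin n, ‖topCoeff m I‖,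
      Finset.sum_nonneg fun _ _ => norm_nonneg _, fun H G _ I => ?_⟩
    simpa [powCoeff] using Finset.single_le_sum
      (f := fun I : Fin m → Fin n × Fin n => ‖topCoeff m I‖)
      (fun _ _ => norm_nonneg _) (Finset.mem_univ I)
  | succ k ih =>
    obtain ⟨C, hC0, hC⟩ := ih (m + 1)
    refine ⟨n * (n * C), by positivity, fun H G hG I => ?_⟩
    simp only [powCoeff]
    calc ‖∑ j, ∑ l, H j l * powCoeff H k (m + 1) (Fin.cons (j, l) I)‖
        ≤ ∑ j : Fin n, ∑ l : Fin n, G * (C * G ^ k) := by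
          refine norm_sum_le_of_le _ fun j _ => norm_sum_le_of_le _ fun l _ => ?_
          rw [norm_mul]
          exact mul_le_mul (hG j l) (hC H G hG _) (norm_nonneg _)
            ((norm_nonneg _).trans (hG j l))
      _ = n * (n * C) * G ^ (k + 1) := by simp; ring

/-- The Leibniz expansion of the coefficients: the first `k` of the `n` factors are entries of `H`,
the others are prescribed by the index `I`. -/
lemma powCoeff_eq_sum_perm (H : Matrix (Fin n) (Fin n) ℂ) (k : ℕ) {m : ℕ} (hkm : k + m = n)
    (I : Fin m → Fin n × Fin n) :
    powCoeff H k m I = ((2 / Real.pi : ℝ) : ℂ) ^ n *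
      ∑ σ : Equiv.Perm (Fin n), ∑ τ : Equiv.Perm (Fin n),
        ((σ.sign : ℤ) : ℂ) * ((τ.sign : ℤ) : ℂ) *
        ∏ p : Fin n, if hp : k ≤ p.1 then
          (if I ⟨p.1 - k, by omega⟩ = (σ p, τ p) then 1 else 0) else H (σ p) (τ p) := by
  induction k generalizing m with
  | zero =>
    obtain rfl : m = n := by omega
    have hdet : ∀ J : Fin m → Fin m, ((1 : Matrix (Fin m) (Fin m) ℂ).submatrix J id).det
        = ∑ σ : Equiv.Perm (Fin m), ((σ.sign : ℤ) : ℂ) * ∏ p, if J p = σ p then 1 else 0 := by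
      intro J
      rw [← Matrix.det_transpose, Matrix.det_apply']
      rfl
    simp only [powCoeff, topCoeff, dif_pos, wedgeConst, hdet, Fin.cast_eq_self]
    rw [mul_assoc, Finset.sum_mul_sum]
    congr 1
    refine Finset.sum_congr rfl fun σ _ => Finset.sum_congr rfl fun τ _ => ?_
    rw [mul_mul_mul_comm, ← Finset.prod_mul_distrib]
    congr 1
    refine Finset.prod_congr rfl fun p _ => ?_
    simp only [Prod.ext_iff]
    split_ifs <;> simp_all
  | succ k ih =>
    simp only [powCoeff]
    have hk : k < n := by omega
    simp_rw [ih (m := m + 1) (by omega)]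
    simp_rw [Finset.mul_sum]
    have hswap : ∀ A : Fin n → Fin n → Equiv.Perm (Fin n) → Equiv.Perm (Fin n) → ℂ,
        ∑ j, ∑ l, ∑ σ, ∑ τ, A j l σ τ = ∑ σ, ∑ τ, ∑ j, ∑ l, A j l σ τ := by
      intro A
      calc _ = ∑ j, ∑ σ, ∑ l, ∑ τ, A j l σ τ :=
            Finset.sum_congr rfl fun j _ => Finset.sum_comm
        _ = ∑ σ, ∑ j, ∑ l, ∑ τ, A j l σ τ := Finset.sum_comm
        _ = ∑ σ, ∑ j, ∑ τ, ∑ l, A j l σ τ := Finset.sum_congr rfl fun σ _ =>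
            Finset.sum_congr rfl fun j _ => Finset.sum_comm
        _ = _ := Finset.sum_congr rfl fun σ _ => Finset.sum_comm
    rw [hswap]
    refine Finset.sum_congr rfl fun σ _ => Finset.sum_congr rfl fun τ _ => ?_
    -- the factor at `p₀` turns from an entry of the index into an entry of `H`
    let p₀ : Fin n := ⟨k, hk⟩
    have hprod : ∀ j l : Fin n, (∏ p : Fin n, if hp : k ≤ p.1 then
        (if (Fin.cons (j, l) I : Fin (m + 1) → Fin n × Fin n) ⟨p.1 - k, by omega⟩ = (σ p, τ p)
          then 1 else 0) else H (σ p) (τ p))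
        = (if (j, l) = (σ p₀, τ p₀) then 1 else 0) *
          ∏ p ∈ Finset.univ.erase p₀, if hp : k + 1 ≤ p.1 then
          (if I ⟨p.1 - (k + 1), by omega⟩ = (σ p, τ p) then (1 : ℂ) else 0)
          else H (σ p) (τ p) := by
      intro j l
      rw [← Finset.mul_prod_erase _ _ (Finset.mem_univ p₀)]
      congr 1
      · simp [p₀]
      · refine Finset.prod_congr rfl fun p hp => ?_
        have hne : p.1 ≠ k := fun h => (Finset.ne_of_mem_erase hp) (Fin.ext h)
        by_cases h1 : k + 1 ≤ p.1
        · rw [dif_pos (by omega), dif_pos h1]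
          have : (⟨p.1 - k, by omega⟩ : Fin (m + 1)) = Fin.succ ⟨p.1 - (k + 1), by omega⟩ :=
            Fin.ext (by simp; omega)
          rw [this, Fin.cons_succ]
        · rw [dif_neg (by omega), dif_neg h1]
    simp_rw [hprod]
    rw [← Finset.mul_prod_erase Finset.univ _ (Finset.mem_univ p₀)]
    rw [Finset.sum_eq_single (σ p₀), Finset.sum_eq_single (τ p₀)]
    · simp [p₀]
      ring
    · intro l _ hl; simp [hl]
    · simp
    · intro j _ hj
      refine Finset.sum_eq_zero fun l _ => ?_
      simp [hj]
    · simp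

/-- The top power of `(i/π) ∑ H_{jl} dz_j ∧ dz̄_l` has the density `n! (2/π)ⁿ det H`. -/
lemma powCoeff_zero_eq_det (H : Matrix (Fin n) (Fin n) ℂ) (I : Fin 0 → Fin n × Fin n) :
    powCoeff H n 0 I = (n.factorial : ℂ) * ((2 / Real.pi : ℝ) : ℂ) ^ n * H.det := by
  rw [powCoeff_eq_sum_perm H n (by omega)]
  have h1 : ∀ σ τ : Equiv.Perm (Fin n), (∏ p : Fin n, if hp : n ≤ p.1 then
          (if I ⟨p.1 - n, by omega⟩ = (σ p, τ p) then (1 : ℂ) else 0) else H (σ p) (τ p))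
        = ∏ p, H (σ p) (τ p) := fun σ τ =>
    Finset.prod_congr rfl fun p _ => dif_neg (by omega)
  simp_rw [h1]
  have h2 : ∀ τ : Equiv.Perm (Fin n), ∑ σ : Equiv.Perm (Fin n),
      ((σ.sign : ℤ) : ℂ) * ((τ.sign : ℤ) : ℂ) * ∏ p, H (σ p) (τ p) = H.det := by
    intro τ
    have h3 : ((τ.sign : ℤ) : ℂ) * ((τ.sign : ℤ) : ℂ) = 1 := by
      rcases Int.units_eq_one_or τ.sign with h | h <;> simp [h]
    have := Matrix.det_permute' τ H
    have h4 : H.det = ((τ.sign : ℤ) : ℂ) * (H.submatrix id τ).det := by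
      rw [this, ← mul_assoc, h3, one_mul]
    rw [h4, Matrix.det_apply', Finset.mul_sum]
    refine Finset.sum_congr rfl fun σ _ => ?_
    simp
    ring
  rw [Finset.sum_comm]
  simp_rw [h2]
  simp [Fintype.card_perm]
  ring

end algebra

/-! ### Closedness of the powers and integration by parts -/

section closed

variable {n : ℕ}

lemma contDiff_powCoeff {M : (Fin n → ℂ) → Matrix (Fin n) (Fin n) ℂ}
    (hM : ∀ j l, ContDiff ℝ ∞ (fun z => M z j l)) (k m : ℕ) (I : Fin m → Fin n × Fin n) :
    ContDiff ℝ ∞ (fun z => powCoeff (M z) k m I) := by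
  induction k generalizing m with
  | zero => exact contDiff_const
  | succ k ih =>
    simp only [powCoeff]
    exact ContDiff.sum fun j _ => ContDiff.sum fun l _ => (hM j l).mul (ih _ _)

/-- If `∂_p M_{jl}` is symmetric in `p` and `j`, then the powers of `M` are closed: the divergence
of their coefficients in any one holomorphic index vanishes. -/
lemma sum_wirtinger_powCoeff_eq_zero {M : (Fin n → ℂ) → Matrix (Fin n) (Fin n) ℂ} {c : ℂ}
    (hM : ∀ j l, ContDiff ℝ ∞ (fun z => M z j l))
    (hsymm : ∀ p j l z,
      wirtinger c p (fun z => M z j l) z = wirtinger c j (fun z => M z p l) z)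
    (k : ℕ) {m : ℕ} (I : Fin m → Fin n × Fin n) (a : Fin m) (q : Fin n) (z : Fin n → ℂ) :
    ∑ p, wirtinger c p (fun z => powCoeff (M z) k m (Function.update I a (p, q))) z = 0 := by
  induction k generalizing m with
  | zero => simp [powCoeff, wirtinger.const_apply]
  | succ k ih =>
    have hP : ∀ J : Fin (m + 1) → Fin n × Fin n,
        Differentiable ℝ (fun z => powCoeff (M z) k (m + 1) J) := fun J =>
      (contDiff_powCoeff hM k (m + 1) J).differentiable (by simp)
    have hMd : ∀ j l, Differentiable ℝ (fun z => M z j l) := fun j l =>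
      (hM j l).differentiable (by simp)
    simp only [powCoeff]
    have e1 : ∀ p, wirtinger c p (fun z => ∑ j, ∑ l, M z j l *
        powCoeff (M z) k (m + 1) (Fin.cons (j, l) (Function.update I a (p, q)))) z
        = ∑ j, ∑ l, (wirtinger c p (fun z => M z j l) z *
            powCoeff (M z) k (m + 1) (Fin.cons (j, l) (Function.update I a (p, q)))
          + M z j l * wirtinger c p (fun z =>
            powCoeff (M z) k (m + 1) (Fin.cons (j, l) (Function.update I a (p, q)))) z) := by
      intro p
      refine (wirtinger.sum_apply fun j _ => DifferentiableAt.fun_sum fun l _ =>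
        ((hMd j l) z).fun_mul (hP _ z)).trans ?_
      refine Finset.sum_congr rfl fun j _ => ?_
      refine (wirtinger.sum_apply fun l _ => ((hMd j l) z).fun_mul (hP _ z)).trans ?_
      exact Finset.sum_congr rfl fun l _ => wirtinger.mul_apply (hMd j l z) (hP _ z)
    simp_rw [e1, Finset.sum_add_distrib]
    have z2 : ∑ p, ∑ j, ∑ l, M z j l * wirtinger c p (fun z =>
        powCoeff (M z) k (m + 1) (Fin.cons (j, l) (Function.update I a (p, q)))) z = 0 := by
      rw [Finset.sum_comm]
      refine Finset.sum_eq_zero fun j _ => ?_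
      rw [Finset.sum_comm]
      refine Finset.sum_eq_zero fun l _ => ?_
      rw [← Finset.mul_sum]
      simp_rw [Fin.cons_update]
      rw [ih, mul_zero]
    -- the derivatives of `M` are symmetric in `p` and `j`, the coefficients antisymmetric
    have z1 : ∑ p, ∑ j, ∑ l, wirtinger c p (fun z => M z j l) z *
        powCoeff (M z) k (m + 1) (Fin.cons (j, l) (Function.update I a (p, q))) = 0 := by
      have hanti : ∀ p j l,
          powCoeff (M z) k (m + 1) (Fin.cons (j, l) (Function.update I a (p, q)))
          = -powCoeff (M z) k (m + 1) (Fin.cons (p, l) (Function.update I a (j, q))) := by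
        intro p j l
        rw [← powCoeff_swapFst (M z) k (Fin.succ_ne_zero a).symm]
        congr 1
        funext b
        refine Fin.cases ?_ (fun b => ?_) b
        · simp [swapFst]
        · by_cases hb : b = a
          · subst hb; simp [swapFst]
          · have : Equiv.swap 0 a.succ b.succ = b.succ :=
              Equiv.swap_apply_of_ne_of_ne (Fin.succ_ne_zero b)
                (fun h => hb (Fin.succ_injective _ h))
            simp [swapFst, this, Function.update_of_ne hb]
      have hS : ∀ S : ℂ, S = -S → S = 0 := fun S hS => by linear_combination hS / 2
      apply hS
      conv_lhs => rw [Finset.sum_comm]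
      rw [← Finset.sum_neg_distrib]
      refine Finset.sum_congr rfl fun p _ => ?_
      rw [← Finset.sum_neg_distrib]
      refine Finset.sum_congr rfl fun j _ => ?_
      rw [← Finset.sum_neg_distrib]
      refine Finset.sum_congr rfl fun l _ => ?_
      rw [hsymm j p l, hanti j p l]
      ring
    rw [z1, z2, add_zero]

lemma contDiff_leviMatrix {u : (Fin n → ℂ) → ℝ} (hu : ContDiff ℝ ∞ u) (j l : Fin n) :
    ContDiff ℝ ∞ (fun z => leviMatrix u z j l) := by
  simp_rw [leviMatrix_eq_wirtinger hu]
  have hC : ContDiff ℝ ∞ (fun z => (u z : ℂ)) := Complex.ofRealCLM.contDiff.comp hu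
  exact wirtinger.contDiff (wirtinger.contDiff hC)

lemma sum_wirtinger_leviMatrix_fst {u : (Fin n → ℂ) → ℝ} (hu : ContDiff ℝ ∞ u) (k : ℕ) {m : ℕ}
    (I : Fin m → Fin n × Fin n) (l : Fin n) (z : Fin n → ℂ) :
    ∑ p, wirtinger (-Complex.I) p
      (fun z => powCoeff (leviMatrix u z) k (m + 1) (Fin.cons (p, l) I)) z = 0 := by
  have hC : ContDiff ℝ ∞ (fun z => (u z : ℂ)) := Complex.ofRealCLM.contDiff.comp hu
  have := sum_wirtinger_powCoeff_eq_zero (c := -Complex.I) (M := leviMatrix u)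
    (contDiff_leviMatrix hu) (fun p j l z => by
      simp_rw [leviMatrix_eq_wirtinger hu]
      exact congrFun (wirtinger.comm (wirtinger.contDiff hC)) z) k (Fin.cons (l, l) I) 0 l z
  simpa only [Fin.update_cons_zero] using this

lemma sum_wirtinger_leviMatrix_snd {u : (Fin n → ℂ) → ℝ} (hu : ContDiff ℝ ∞ u) (k : ℕ) {m : ℕ}
    (I : Fin m → Fin n × Fin n) (j : Fin n) (z : Fin n → ℂ) :
    ∑ p, wirtinger Complex.I p
      (fun z => powCoeff (leviMatrix u z) k (m + 1) (Fin.cons (j, p) I)) z = 0 := by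
  have hC : ContDiff ℝ ∞ (fun z => (u z : ℂ)) := Complex.ofRealCLM.contDiff.comp hu
  have := sum_wirtinger_powCoeff_eq_zero (c := Complex.I)
    (M := fun z => (leviMatrix u z).transpose)
    (fun j l => contDiff_leviMatrix hu l j) (fun p j l z => by
      have h : ∀ a b, (fun z => (leviMatrix u z).transpose a b) =
          wirtinger Complex.I a (wirtinger (-Complex.I) b (fun z => (u z : ℂ))) := fun a b => by
        rw [wirtinger.comm hC]
        exact funext fun z => leviMatrix_eq_wirtinger hu z b a
      rw [h, h]
      exact congrFun (wirtinger.comm (wirtinger.contDiff hC)) z) k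
    (fun a => ((Fin.cons (j, j) I : Fin (m + 1) → Fin n × Fin n) a).swap) 0 j z
  rw [← this]
  refine Finset.sum_congr rfl fun p _ => ?_
  congr 1
  funext z
  rw [← powCoeff_transpose]
  congr 1
  funext b
  refine Fin.cases ?_ (fun b => ?_) b
  · simp
  · simp

/-- `∫ u dd^cχ ∧ T ∧ β = ∫ χ dd^c u ∧ T ∧ β` for `T = (dd^c u)ᵏ`, with `u` and `χ` smooth. -/
lemma integral_leviMatrix_powCoeff {u χ : (Fin n → ℂ) → ℝ} (hu : ContDiff ℝ ∞ u)
    (hχ : IsTestFunction χ) (k : ℕ) {m : ℕ} (I : Fin m → Fin n × Fin n) :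
    ∑ j, ∑ l, ∫ z, (u z : ℂ) * leviMatrix χ z j l *
        powCoeff (leviMatrix u z) k (m + 1) (Fin.cons (j, l) I)
      = ∫ z, (χ z : ℂ) * powCoeff (leviMatrix u z) (k + 1) m I := by
  obtain ⟨hχs, hχc⟩ := hχ
  have hC : ContDiff ℝ ∞ (fun z => (u z : ℂ)) := Complex.ofRealCLM.contDiff.comp hu
  have hX : ContDiff ℝ ∞ (fun z => (χ z : ℂ)) := Complex.ofRealCLM.contDiff.comp hχs
  have hXc : HasCompactSupport (fun z => (χ z : ℂ)) := hχc.comp_left (g := fun x : ℝ => (x : ℂ)) rfl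
  set U : (Fin n → ℂ) → ℂ := fun z => (u z : ℂ) with hU
  set X : (Fin n → ℂ) → ℂ := fun z => (χ z : ℂ) with hXdef
  set P : Fin n → Fin n → (Fin n → ℂ) → ℂ := fun j l z =>
    powCoeff (leviMatrix u z) k (m + 1) (Fin.cons (j, l) I) with hPdef
  have hP : ∀ j l, ContDiff ℝ ∞ (P j l) := fun j l =>
    contDiff_powCoeff (contDiff_leviMatrix hu) k (m + 1) _
  have hd : ∀ {f : (Fin n → ℂ) → ℂ}, ContDiff ℝ ∞ f → Differentiable ℝ f := fun hf =>
    hf.differentiable (by simp)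
  have hw : ∀ {f : (Fin n → ℂ) → ℂ} {c : ℂ} {j : Fin n}, ContDiff ℝ ∞ f →
    ContDiff ℝ ∞ (wirtinger c j f) := fun hf => wirtinger.contDiff hf
  have hint : ∀ {f g : (Fin n → ℂ) → ℂ}, ContDiff ℝ ∞ f → ContDiff ℝ ∞ g →
      HasCompactSupport g → Integrable (fun z => f z * g z) := fun hf hg hgc =>
    (hf.continuous.mul hg.continuous).integrable_of_hasCompactSupport hgc.mul_left
  -- integrate by parts in `z_j` (`s1`, `s2`), then in `z̄_l` (`s3`, `s4`); the derivatives of the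
  -- coefficients `P j l` drop out after summation, because the powers are closed
  have s1 : ∀ j l, ∫ z, (u z : ℂ) * leviMatrix χ z j l * P j l z
      = -∫ z, (wirtinger (-Complex.I) j U z * P j l z
          + U z * wirtinger (-Complex.I) j (P j l) z) * wirtinger Complex.I l X z := by
    intro j l
    calc ∫ z, (u z : ℂ) * leviMatrix χ z j l * P j l z
        = ∫ z, (U z * P j l z) * wirtinger (-Complex.I) j (wirtinger Complex.I l X) z := by
          refine integral_congr_ae (Eventually.of_forall fun z => ?_)
          simp only [leviMatrix_eq_wirtinger hχs, hU, hXdef]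
          ring
      _ = -∫ z, wirtinger (-Complex.I) j (fun z => U z * P j l z) z * wirtinger Complex.I l X z :=
          wirtinger.integral_mul (hC.mul (hP j l)) (hw hX) (wirtinger.hasCompactSupport hXc)
      _ = _ := by
          congr 1
          refine integral_congr_ae (Eventually.of_forall fun z => ?_)
          simp only
          rw [wirtinger.mul_apply (hd hC z) (hd (hP j l) z)]
  have s2 : ∀ l, ∑ j, ∫ z, (u z : ℂ) * leviMatrix χ z j l * P j l z
      = -∑ j, ∫ z, wirtinger (-Complex.I) j U z * P j l z * wirtinger Complex.I l X z := by
    intro l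
    have hz : ∑ j, ∫ z, U z * wirtinger (-Complex.I) j (P j l) z * wirtinger Complex.I l X z
        = 0 := by
      rw [← integral_finsetSum _ fun j _ => hint (hC.mul (hw (hP j l))) (hw hX)
        (wirtinger.hasCompactSupport hXc)]
      simp_rw [← Finset.sum_mul, ← Finset.mul_sum]
      simp [hPdef, sum_wirtinger_leviMatrix_fst hu]
    rw [← add_zero (-∑ j, _), ← neg_zero, ← hz, ← Finset.sum_neg_distrib,
      ← Finset.sum_neg_distrib, ← Finset.sum_add_distrib]
    refine Finset.sum_congr rfl fun j _ => ?_
    simp_rw [s1, add_mul]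
    rw [integral_add (hint ((hw hC).mul (hP j l)) (hw hX) (wirtinger.hasCompactSupport hXc))
      (hint (hC.mul (hw (hP j l))) (hw hX) (wirtinger.hasCompactSupport hXc)), neg_add]
  have s3 : ∀ j l, ∫ z, wirtinger (-Complex.I) j U z * P j l z * wirtinger Complex.I l X z
      = -∫ z, (wirtinger Complex.I l (wirtinger (-Complex.I) j U) z * P j l z
          + wirtinger (-Complex.I) j U z * wirtinger Complex.I l (P j l) z) * X z := by
    intro j l
    rw [wirtinger.integral_mul ((hw hC).mul (hP j l)) hX hXc]
    congr 1
    refine integral_congr_ae (Eventually.of_forall fun z => ?_)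
    simp only
    rw [wirtinger.mul_apply (hd (hw hC) z) (hd (hP j l) z)]
  have s4 : ∀ j, ∑ l, ∫ z, wirtinger (-Complex.I) j U z * P j l z * wirtinger Complex.I l X z
      = -∑ l, ∫ z, wirtinger Complex.I l (wirtinger (-Complex.I) j U) z * P j l z * X z := by
    intro j
    have hz : ∑ l, ∫ z, wirtinger (-Complex.I) j U z * wirtinger Complex.I l (P j l) z * X z
        = 0 := by
      rw [← integral_finsetSum _ fun l _ => hint ((hw hC).mul (hw (hP j l))) hX hXc]
      simp_rw [← Finset.sum_mul, ← Finset.mul_sum]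
      simp [hPdef, sum_wirtinger_leviMatrix_snd hu]
    rw [← add_zero (-∑ l, _), ← neg_zero, ← hz, ← Finset.sum_neg_distrib,
      ← Finset.sum_neg_distrib, ← Finset.sum_add_distrib]
    refine Finset.sum_congr rfl fun l _ => ?_
    simp_rw [s3, add_mul]
    rw [integral_add (hint ((hw (hw hC)).mul (hP j l)) hX hXc)
      (hint ((hw hC).mul (hw (hP j l))) hX hXc), neg_add]
  rw [Finset.sum_comm]
  refine (Finset.sum_congr rfl fun l _ => s2 l).trans ?_
  rw [Finset.sum_neg_distrib, Finset.sum_comm]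
  simp_rw [s4]
  rw [Finset.sum_neg_distrib, neg_neg]
  have i1 : ∀ j l, Integrable (fun z =>
      wirtinger Complex.I l (wirtinger (-Complex.I) j U) z * P j l z * X z) := fun j l =>
    hint ((hw (hw hC)).mul (hP j l)) hX hXc
  simp_rw [← integral_finsetSum _ fun l _ => i1 _ l]
  rw [← integral_finsetSum _ fun j _ => integrable_finsetSum _ fun l _ => i1 j l]
  refine integral_congr_ae (Eventually.of_forall fun z => ?_)
  simp only [powCoeff, Finset.mul_sum]
  refine Finset.sum_congr rfl fun j _ => Finset.sum_congr rfl fun l _ => ?_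
  rw [wirtinger.comm hC, leviMatrix_eq_wirtinger hu]
  simp only [hXdef, hPdef, hU]
  ring

end closed

/-! ### Bedford–Taylor powers as limits of smooth powers -/

section limit

variable {n : ℕ}

/-- Passage to the limit in the coefficients of the powers, against test functions and with a
locally bounded factor. -/
lemma tendsto_integral_mul_powCoeff {w : ℕ → (Fin n → ℂ) → ℝ} {w' : (Fin n → ℂ) → ℝ}
    {v : ℕ → (Fin n → ℂ) → ℝ} {A : (Fin n → ℂ) → Matrix (Fin n) (Fin n) ℂ}
    {G : (Fin n → ℂ) → ℝ} {φ : (Fin n → ℂ) → ℂ}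
    (hw : ∀ k, Continuous (w k)) (hww : ∀ z, Tendsto (fun k => w k z) atTop (𝓝 (w' z)))
    (hwb : ∀ K, IsCompact K → ∃ M, ∀ k, ∀ z ∈ K, |w k z| ≤ M)
    (hv : ∀ k, ContDiff ℝ ∞ (v k))
    (hA : ∀ᵐ z, ∀ j l, Tendsto (fun k => leviMatrix (v k) z j l) atTop (𝓝 (A z j l)))
    (hG : ∀ K, IsCompact K → ∃ C : ℝ, ∀ k, ∀ᵐ z, z ∈ K → ∀ j l,
      ‖leviMatrix (v k) z j l‖ ≤ C * G z)
    (hφ : Continuous φ) (hφc : HasCompactSupport φ) (q m : ℕ)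
    (hGi : LocallyIntegrable (fun z => G z ^ q)) (I : Fin m → Fin n × Fin n) :
    Tendsto (fun k => ∫ z, (w k z : ℂ) * φ z * powCoeff (leviMatrix (v k) z) q m I) atTop
      (𝓝 (∫ z, (w' z : ℂ) * φ z * powCoeff (A z) q m I)) := by
  obtain ⟨M, hM⟩ := hwb _ hφc
  obtain ⟨C, hC⟩ := hG _ hφc
  obtain ⟨C', hC'0, hC'⟩ := exists_norm_powCoeff_le n q m
  have hcont : ∀ k, Continuous fun z => powCoeff (leviMatrix (v k) z) q m I := fun k =>
    (contDiff_powCoeff (contDiff_leviMatrix (hv k)) q m I).continuous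
  have hb : Integrable (fun z => ‖φ z‖ * (|M| * (C' * C ^ q) * G z ^ q)) := by
    refine LocallyIntegrable.integrable_smul_left_of_hasCompactSupport
      (f := fun z => |M| * (C' * C ^ q) * G z ^ q) ?_ hφ.norm hφc.norm
    exact hGi.smul (|M| * (C' * C ^ q))
  refine tendsto_integral_of_dominated_convergence _ (fun k => ?_) hb (fun k => ?_) ?_
  · have := (hw k)
    have := hcont k
    exact (by fun_prop : Continuous _).aestronglyMeasurable
  · filter_upwards [hC k] with z hz
    by_cases hzK : z ∈ tsupport φ
    · rw [norm_mul, norm_mul]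
      have h1 : ‖(w k z : ℂ)‖ ≤ |M| := by
        rw [Complex.norm_real]; exact (hM k z hzK).trans (le_abs_self M)
      have h2 := hC' _ _ (hz hzK) I
      calc ‖(w k z : ℂ)‖ * ‖φ z‖ * ‖powCoeff (leviMatrix (v k) z) q m I‖
          ≤ |M| * ‖φ z‖ * (C' * (C * G z) ^ q) := by gcongr
        _ = _ := by rw [mul_pow]; ring
    · simp [image_eq_zero_of_notMem_tsupport hzK]
  · filter_upwards [hA] with z hz
    have h1 : Tendsto (fun k => leviMatrix (v k) z) atTop (𝓝 (A z)) :=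
      tendsto_pi_nhds.2 fun j => tendsto_pi_nhds.2 fun l => hz j l
    have h2 := ((continuous_powCoeff q m I).tendsto (A z)).comp h1
    exact (((Complex.continuous_ofReal.tendsto _).comp (hww z)).mul tendsto_const_nhds).mul h2

/-- If smooth functions converge to `u` with local bounds, and their Levi matrices converge almost
everywhere with a common majorant whose powers up to the order `n` are locally integrable, then
the Monge–Ampère measure of `u` is the absolutely continuous one that is computed pointwise from
the limit of the Levi matrices. -/
theorem isBedfordTaylor_of_tendsto {u : (Fin n → ℂ) → ℝ} {v : ℕ → (Fin n → ℂ) → ℝ}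
    {A : (Fin n → ℂ) → Matrix (Fin n) (Fin n) ℂ} {G d : (Fin n → ℂ) → ℝ}
    (hv : ∀ k, ContDiff ℝ ∞ (v k))
    (hvu : ∀ z, Tendsto (fun k => v k z) atTop (𝓝 (u z)))
    (hvb : ∀ K, IsCompact K → ∃ M, ∀ k, ∀ z ∈ K, |v k z| ≤ M)
    (hA : ∀ᵐ z, ∀ j l, Tendsto (fun k => leviMatrix (v k) z j l) atTop (𝓝 (A z j l)))
    (hG : ∀ K, IsCompact K → ∃ C : ℝ, ∀ k, ∀ᵐ z, z ∈ K → ∀ j l,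
      ‖leviMatrix (v k) z j l‖ ≤ C * G z)
    (hGi : ∀ q ≤ n, LocallyIntegrable (fun z => G z ^ q))
    (hd : ∀ᵐ z, (n.factorial : ℂ) * ((2 / Real.pi : ℝ) : ℂ) ^ n * (A z).det = (d z : ℂ))
    (hd0 : ∀ᵐ z, 0 ≤ d z) :
    IsBedfordTaylor u (volume.withDensity fun z => ENNReal.ofReal (d z)) := by
  have hcont : ∀ k q m (I : Fin m → Fin n × Fin n),
      Continuous fun z => powCoeff (leviMatrix (v k) z) q m I := fun k q m I =>
    (contDiff_powCoeff (contDiff_leviMatrix (hv k)) q m I).continuous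
  have hlim : ∀ᵐ z, Tendsto (fun k => leviMatrix (v k) z) atTop (𝓝 (A z)) := by
    filter_upwards [hA] with z hz
    exact tendsto_pi_nhds.2 fun j => tendsto_pi_nhds.2 fun l => hz j l
  have hmeas : ∀ q m (I : Fin m → Fin n × Fin n),
      AEStronglyMeasurable (fun z => powCoeff (A z) q m I) := fun q m I =>
    aestronglyMeasurable_of_tendsto_ae atTop
      (fun k => (hcont k q m I).aestronglyMeasurable) (by
        filter_upwards [hlim] with z hz
        exact ((continuous_powCoeff q m I).tendsto (A z)).comp hz)
  have hloc : ∀ q ≤ n, ∀ m (I : Fin m → Fin n × Fin n),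
      LocallyIntegrable (fun z => powCoeff (A z) q m I) := by
    intro q hq m I
    rw [locallyIntegrable_iff]
    intro K hK
    obtain ⟨C, hC⟩ := hG K hK
    obtain ⟨C', hC'0, hC'⟩ := exists_norm_powCoeff_le n q m
    have hi : IntegrableOn (fun z => C' * C ^ q * G z ^ q) K :=
      (locallyIntegrable_iff.1 (hGi q hq) K hK).const_mul _
    refine hi.mono' (hmeas q m I).restrict ?_
    rw [ae_restrict_iff' hK.measurableSet]
    filter_upwards [hlim, ae_all_iff.2 hC] with z hz hz2 hzK
    refine le_of_tendsto (((continuous_powCoeff q m I).tendsto (A z)).comp hz).norm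
      (Eventually.of_forall fun k => ?_)
    have := hC' _ _ (hz2 k hzK) I
    simp only [Function.comp]
    rw [mul_pow, ← mul_assoc] at this
    exact this
  have hθ0 : ∀ I : Fin 0 → Fin n × Fin n, ∀ᵐ z, powCoeff (A z) n 0 I = (d z : ℂ) := by
    intro I
    filter_upwards [hd] with z hz
    rw [powCoeff_zero_eq_det, hz]
  have hdm : AEStronglyMeasurable d := by
    refine (Complex.continuous_re.comp_aestronglyMeasurable (hmeas n 0 Fin.elim0)).congr ?_
    filter_upwards [hθ0 Fin.elim0] with z hz
    simp [hz]
  have hdi : LocallyIntegrable d := by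
    rw [locallyIntegrable_iff]
    intro K hK
    refine ((locallyIntegrable_iff.1 (hloc n le_rfl 0 Fin.elim0) K hK).norm).mono'
      hdm.restrict ?_
    filter_upwards [ae_restrict_of_ae (hθ0 Fin.elim0)] with z hz
    rw [hz, Complex.norm_real]
  have hone : ∀ K : Set (Fin n → ℂ), IsCompact K → ∃ M : ℝ, ∀ _k : ℕ, ∀ z ∈ K, |(1 : ℝ)| ≤ M :=
    fun K _ => ⟨1, by simp⟩
  -- the current `T_{n-m}` has the coefficients `powCoeff (A z) (n - m) m`
  refine ⟨⟨fun K hK => ?_⟩, volume, fun m I z => powCoeff (A z) (n - m) m I,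
    fun m hm I => hloc _ (Nat.sub_le n m) m I, fun I χ _ => ?_, fun m hm I χ hχ => ?_,
    fun I χ hχ => ?_⟩
  · rw [withDensity_apply _ hK.measurableSet]
    exact (locallyIntegrable_iff.1 hdi K hK).lintegral_lt_top
  · simp only [Nat.sub_self, powCoeff, topCoeff, dif_pos]
    rw [integral_mul_const, integral_complex_ofReal, mul_comm]
    rfl
  · obtain ⟨q, hq⟩ : ∃ q, n - m = q + 1 := ⟨n - m - 1, by omega⟩
    have hq' : n - (m + 1) = q := by omega
    simp only [hq, hq']
    have hχC : Continuous fun z => (χ z : ℂ) := Complex.continuous_ofReal.comp hχ.1.continuous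
    have hχc : HasCompactSupport fun z => (χ z : ℂ) :=
      hχ.2.comp_left (g := fun x : ℝ => (x : ℂ)) rfl
    have t1 := tendsto_integral_mul_powCoeff (w := fun _ _ => 1) (w' := fun _ => 1)
      (fun _ => continuous_const) (fun _ => tendsto_const_nhds) hone hv hA hG hχC hχc (q + 1) m
      (hGi _ (by omega)) I
    simp only [Complex.ofReal_one, one_mul] at t1
    have hlc : ∀ j l, HasCompactSupport fun z => leviMatrix χ z j l := fun j l => by
      simp_rw [leviMatrix_eq_wirtinger hχ.1]
      exact wirtinger.hasCompactSupport (wirtinger.hasCompactSupport hχc)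
    have t2 := tendsto_finsetSum Finset.univ fun j _ => tendsto_finsetSum Finset.univ fun l _ =>
      tendsto_integral_mul_powCoeff (fun k => (hv k).continuous) hvu hvb hv hA hG
        (contDiff_leviMatrix hχ.1 j l).continuous (hlc j l) q (m + 1) (hGi _ (by omega))
        (Fin.cons (j, l) I)
    refine tendsto_nhds_unique (t1.congr fun k => ?_) t2
    exact (integral_leviMatrix_powCoeff (hv k) hχ q I).symm
  · simp only [Nat.sub_zero]
    have h1 : ∫ z, χ z ∂(volume.withDensity fun z => ENNReal.ofReal (d z)) = ∫ z, χ z * d z := by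
      rw [integral_withDensity_eq_integral_toReal_smul₀ hdm.aemeasurable.ennreal_ofReal
        (Eventually.of_forall fun z => ENNReal.ofReal_lt_top)]
      refine integral_congr_ae ?_
      filter_upwards [hd0] with z hz
      rw [ENNReal.toReal_ofReal hz, smul_eq_mul, mul_comm]
    rw [h1, ← integral_complex_ofReal]
    refine integral_congr_ae ?_
    filter_upwards [hθ0 I] with z hz
    rw [hz]
    push_cast
    rfl

end limit

/-! ### The radial profile -/

/-- A smooth convex regularization of `max 0 t` that differs from it only for `|t| < η`. -/
lemma exists_smooth_max {η : ℝ} (hη : 0 < η) : ∃ q : ℝ → ℝ, ContDiff ℝ ∞ q ∧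
    Monotone (deriv q) ∧ (∀ t, 0 ≤ deriv q t) ∧ (∀ t, deriv q t ≤ 1) ∧
    (∀ t ≤ -η, q t = 0) ∧ ∀ t, η ≤ t → q t = t := by
  set g : ℝ → ℝ := fun x => Real.smoothTransition ((x + η) / (2 * η)) with hg
  have hgs : ContDiff ℝ ∞ g := by
    refine Real.smoothTransition.contDiff.comp ?_
    fun_prop
  have hgc : Continuous g := hgs.continuous
  have hint : ∀ a b, IntervalIntegrable g volume a b := fun a b => hgc.intervalIntegrable a b
  have hder : ∀ t, HasDerivAt (fun t => ∫ x in (-η)..t, g x) (g t) t := fun t =>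
    intervalIntegral.integral_hasDerivAt_right (hint _ _)
      (hgc.stronglyMeasurableAtFilter _ _) hgc.continuousAt
  have hd : deriv (fun t => ∫ x in (-η)..t, g x) = g := funext fun t => (hder t).deriv
  have h0 : ∀ t ≤ -η, g t = 0 := fun t ht =>
    Real.smoothTransition.zero_of_nonpos (div_nonpos_of_nonpos_of_nonneg (by linarith) (by linarith))
  have h1 : ∀ t, η ≤ t → g t = 1 := fun t ht =>
    Real.smoothTransition.one_of_one_le ((one_le_div (by linarith)).2 (by linarith))
  -- `g (-x) = 1 - g x`, so that `g` has mean value `1 / 2` on `[-η, η]`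
  have hsymm : ∀ x, g (-x) = 1 - g x := by
    intro x
    have e1 : 1 - (x + η) / (2 * η) = (-x + η) / (2 * η) := by field_simp; ring
    have e2 : 1 - (-x + η) / (2 * η) = (x + η) / (2 * η) := by field_simp; ring
    simp only [hg, Real.smoothTransition]
    rw [e1, e2]
    have := Real.smoothTransition.pos_denom ((x + η) / (2 * η))
    rw [e1] at this
    rw [eq_sub_iff_add_eq, add_comm (expNegInvGlue ((-x + η) / (2 * η))), ← add_div, add_comm,
      div_self this.ne']
  have hmid : ∫ x in (-η)..η, g x = η := by
    have e : ∫ x in (-η)..η, g (-x) = ∫ x in (-η)..η, g x := by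
      rw [intervalIntegral.integral_comp_neg]; simp
    simp_rw [hsymm] at e
    rw [intervalIntegral.integral_sub (by simp) (hint _ _)] at e
    simp only [intervalIntegral.integral_const, smul_eq_mul, mul_one] at e
    linarith
  refine ⟨fun t => ∫ x in (-η)..t, g x, ?_, ?_, ?_, ?_, ?_, ?_⟩
  · rw [contDiff_infty_iff_deriv, hd]
    exact ⟨fun t => (hder t).differentiableAt, hgs⟩
  · rw [hd]
    intro a b hab
    exact Real.smoothTransition.monotone (by gcongr)
  · rw [hd]; exact fun t => Real.smoothTransition.nonneg _
  · rw [hd]; exact fun t => Real.smoothTransition.le_one _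
  · intro t ht
    beta_reduce
    rw [intervalIntegral.integral_symm, neg_eq_zero]
    refine intervalIntegral.integral_zero_ae (Eventually.of_forall fun x hx => ?_)
    rw [Set.uIoc_of_le ht] at hx
    exact h0 x hx.2
  · intro t ht
    beta_reduce
    rw [← intervalIntegral.integral_add_adjacent_intervals (hint (-η) η) (hint η t), hmid]
    have : ∫ x in η..t, g x = ∫ x in η..t, (1 : ℝ) := by
      refine intervalIntegral.integral_congr fun x hx => ?_
      rw [Set.uIcc_of_le ht] at hx
      exact h1 x hx.1
    rw [this]
    simp

/-- `χ` is the profile of a model potential in the logarithmic radius `s = log ‖z‖`: a smooth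
convex increasing function that equals `B e^{2αs}` for `s ≤ 0` and `s + D` for `s ≥ log 2`. -/
structure IsProfile (α B D : ℝ) (χ : ℝ → ℝ) : Prop where
  smooth : ContDiff ℝ ∞ χ
  eq_exp : ∀ s ≤ 0, χ s = B * Real.exp (2 * α * s)
  eq_line : ∀ s, Real.log 2 ≤ s → χ s = s + D
  mono : Monotone (deriv χ)
  pos : ∀ s, 0 < deriv χ s

/-- The conditions on the constants say that `B e^{2αs}` lies above `s + D` for `s ≤ 0` and below
it at `s = log 2`, so that a smooth maximum of the two interpolates. -/
lemma exists_isProfile {α B D : ℝ} (hα : 0 < α) (h : AdmissibleConstants α B D) :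
    ∃ χ, IsProfile α B D χ := by
  obtain ⟨hD, hDB, hB2⟩ := h
  have hB : 0 < B := hD.trans hDB
  -- `χ` is `(s + D) + q (h s)`, with a smooth version `q` of `max 0` and the convex difference `h`
  set h : ℝ → ℝ := fun s => B * Real.exp (2 * α * s) - (s + D) with hh
  have hhs : ContDiff ℝ ∞ h := by fun_prop
  have hl2 : 0 < Real.log 2 := Real.log_pos one_lt_two
  have hh0 : 0 < h 0 := by simp [hh]; linarith
  have hh2 : h (Real.log 2) < 0 := by
    have : Real.exp (2 * α * Real.log 2) = 2 ^ (2 * α) := by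
      rw [Real.rpow_def_of_pos two_pos, mul_comm]
    simp only [hh, this]; linarith
  have hhconv : ConvexOn ℝ Set.univ h := by
    refine ConvexOn.sub (ConvexOn.smul hB.le ?_) ?_
    · have := convexOn_exp.comp_linearMap (LinearMap.mul ℝ ℝ (2 * α))
      simpa [Function.comp_def] using this
    · exact (concaveOn_id convex_univ).add (concaveOn_const D convex_univ)
  obtain ⟨η, hη, hη0, hη2⟩ : ∃ η, 0 < η ∧ η ≤ h 0 ∧ h (Real.log 2) < -η := by
    refine ⟨min (h 0) (-h (Real.log 2)) / 2, half_pos (lt_min hh0 (by linarith)), ?_, ?_⟩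
    · have := min_le_left (h 0) (-h (Real.log 2)); linarith
    · have := min_le_right (h 0) (-h (Real.log 2)); linarith
  obtain ⟨q, hqs, hqm, hq0, hq1, hqz, hqt⟩ := exists_smooth_max hη
  have hqd : Differentiable ℝ q := hqs.differentiable (by simp)
  have hqconv : ConvexOn ℝ Set.univ q := hqm.convexOn_univ_of_deriv hqd
  have hqmono : Monotone q := monotone_of_deriv_nonneg hqd hq0
  set χ₁ : ℝ → ℝ := fun s => q (h s) + (s + D) with hχ₁
  have hχ₁s : ContDiff ℝ ∞ χ₁ := (hqs.comp hhs).add (by fun_prop)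
  have hχ₁conv : ConvexOn ℝ Set.univ χ₁ := by
    refine ConvexOn.add ?_ ((convexOn_id convex_univ).add (convexOn_const D convex_univ))
    exact (hqconv.subset (Set.subset_univ _) (by
      rw [Set.image_univ]
      exact (isPreconnected_range hhs.continuous).ordConnected.convex)).comp hhconv
        (hqmono.monotoneOn _)
  have hχ₁d : ∀ s, HasDerivAt χ₁
      (deriv q (h s) * (B * (Real.exp (2 * α * s) * (2 * α)) - 1) + 1) s := by
    intro s
    have e1 : HasDerivAt (fun s => Real.exp (2 * α * s)) (Real.exp (2 * α * s) * (2 * α)) s := by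
      simpa using ((hasDerivAt_id s).const_mul (2 * α)).exp
    have e2 : HasDerivAt (fun s : ℝ => s + D) 1 s := (hasDerivAt_id s).add_const D
    exact ((hqd (h s)).hasDerivAt.comp s ((e1.const_mul B).sub e2)).add e2
  -- for `s ≥ log 2` the exponential may overtake the line again, so the line is glued in there
  set χ : ℝ → ℝ := fun s => if s < Real.log 2 then χ₁ s else s + D with hχ
  have near2 : ∀ᶠ s in 𝓝 (Real.log 2), h s < -η :=
    hhs.continuous.continuousAt.eventually_lt continuousAt_const hη2
  have e_left : ∀ s < Real.log 2, χ =ᶠ[𝓝 s] χ₁ := fun s hs => by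
    filter_upwards [gt_mem_nhds hs] with t ht
    simp only [hχ]; rw [if_pos ht]
  have e_right : ∀ s, Real.log 2 ≤ s → χ =ᶠ[𝓝 s] fun s => s + D := fun s hs => by
    rcases hs.eq_or_lt with rfl | hs
    · filter_upwards [near2] with t ht
      simp only [hχ, hχ₁]
      split_ifs
      · rw [hqz _ ht.le, zero_add]
      · rfl
    · filter_upwards [lt_mem_nhds hs] with t ht
      simp only [hχ]; rw [if_neg (not_lt.2 (le_of_lt ht))]
  have d_left : ∀ s < Real.log 2, deriv χ s = deriv χ₁ s := fun s hs => (e_left s hs).deriv_eq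
  have d_right : ∀ s, Real.log 2 ≤ s → deriv χ s = 1 := fun s hs => by
    rw [(e_right s hs).deriv_eq]
    exact ((hasDerivAt_id s).add_const D).deriv
  have hmono₁ : Monotone (deriv χ₁) := by
    have := hχ₁conv.monotoneOn_deriv (fun s _ => (hχ₁d s).differentiableAt)
    simpa [monotoneOn_univ] using this
  refine ⟨χ, ?_, ?_, ?_, ?_, ?_⟩
  · rw [contDiff_iff_contDiffAt]
    intro s
    rcases lt_or_ge s (Real.log 2) with hs | hs
    · exact hχ₁s.contDiffAt.congr_of_eventuallyEq (e_left s hs)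
    · exact ContDiffAt.congr_of_eventuallyEq (by fun_prop) (e_right s hs)
  · intro s hs
    have h1 : η ≤ h s := by
      have := hhconv.le_max_of_mem_Icc (Set.mem_univ s) (Set.mem_univ (Real.log 2))
        (z := 0) ⟨hs, hl2.le⟩
      rcases le_max_iff.1 this with h | h <;> linarith
    simp only [hχ, hχ₁]
    rw [if_pos (by linarith), hqt _ h1]
    simp [hh]
  · intro s hs
    exact (e_right s hs).eq_of_nhds
  · intro s t hst
    rcases lt_or_ge t (Real.log 2) with ht | ht
    · rw [d_left s (hst.trans_lt ht), d_left t ht]; exact hmono₁ hst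
    · rw [d_right t ht]
      rcases lt_or_ge s (Real.log 2) with hs | hs
      · rw [d_left s hs, ← d_right (Real.log 2) le_rfl]
        refine (hmono₁ hs.le).trans_eq ?_
        have : χ₁ =ᶠ[𝓝 (Real.log 2)] χ := by
          filter_upwards [near2, e_right _ le_rfl] with t ht h2
          rw [h2]
          simp only [hχ₁]
          rw [hqz _ ht.le, zero_add]
        exact this.deriv_eq
      · rw [d_right s hs]
  · intro s
    rcases lt_or_ge s (Real.log 2) with hs | hs
    · rw [d_left s hs, (hχ₁d s).deriv]
      have := hq0 (h s)
      have h1 := hq1 (h s)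
      have h2 : 0 < B * (Real.exp (2 * α * s) * (2 * α)) := by positivity
      rcases this.eq_or_lt with h0 | h0
      · rw [← h0]; norm_num
      · nlinarith [mul_pos h0 h2]
    · rw [d_right s hs]; exact one_pos

lemma exists_admissibleConstants (α : ℝ) : ∃ B D : ℝ, AdmissibleConstants α B D := by
  have h2 : 0 < Real.log 2 := Real.log_pos one_lt_two
  have h4 : 0 < (2 : ℝ) ^ (2 * α) := by positivity
  refine ⟨Real.log 2 / (2 * 2 ^ (2 * α)), Real.log 2 / (4 * 2 ^ (2 * α)), by positivity, ?_, ?_⟩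
  · gcongr; norm_num
  · have : Real.log 2 / (2 * 2 ^ (2 * α)) * (2 : ℝ) ^ (2 * α) = Real.log 2 / 2 := by field_simp
    rw [this]
    have : 0 < Real.log 2 / (4 * 2 ^ (2 * α)) := by positivity
    linarith

namespace IsProfile

variable {α B D : ℝ} {χ : ℝ → ℝ}

lemma differentiable (h : IsProfile α B D χ) : Differentiable ℝ χ := h.smooth.differentiable (by simp)

lemma deriv_le_one (h : IsProfile α B D χ) (s : ℝ) : deriv χ s ≤ 1 := by
  have h1 : deriv χ (max s (Real.log 2) + 1) = 1 := by
    have : χ =ᶠ[𝓝 (max s (Real.log 2) + 1)] fun s => s + D := by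
      filter_upwards [lt_mem_nhds (show Real.log 2 < max s (Real.log 2) + 1 by
        have := le_max_right s (Real.log 2); linarith)] with t ht
      exact h.eq_line t (le_of_lt ht)
    rw [this.deriv_eq]
    exact ((hasDerivAt_id _).add_const D).deriv
  rw [← h1]
  exact h.mono (by have := le_max_left s (Real.log 2); linarith)

/-- The graph of `χ` lies above its tangent lines. -/
lemma tangent_le (h : IsProfile α B D χ) (s₀ s : ℝ) : χ s₀ + deriv χ s₀ * (s - s₀) ≤ χ s := by
  have hc : ConvexOn ℝ Set.univ χ := h.mono.convexOn_univ_of_deriv h.differentiable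
  rcases lt_trichotomy s s₀ with hs | rfl | hs
  · have := hc.slope_le_deriv (Set.mem_univ s) (Set.mem_univ s₀) hs (h.differentiable s₀)
    rw [slope_def_field, div_le_iff₀ (by linarith)] at this
    linarith
  · simp
  · have := hc.deriv_le_slope (Set.mem_univ s₀) (Set.mem_univ s) hs (h.differentiable s₀)
    rw [slope_def_field, le_div_iff₀ (by linarith)] at this
    linarith

lemma strictMono (h : IsProfile α B D χ) : StrictMono χ := strictMono_of_deriv_pos h.pos

lemma line_le (h : IsProfile α B D χ) (s : ℝ) : s + D ≤ χ s := by
  rcases le_total (Real.log 2) s with hs | hs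
  · rw [h.eq_line s hs]
  · have h1 := h.tangent_le (Real.log 2) s
    rw [h.eq_line _ le_rfl] at h1
    have h2 := h.deriv_le_one (Real.log 2)
    nlinarith

lemma nonneg (h : IsProfile α B D χ) (hB : 0 < B) (s : ℝ) : 0 ≤ χ s := by
  have h1 : χ (min s 0) ≤ χ s := h.strictMono.monotone (min_le_left _ _)
  rw [h.eq_exp _ (min_le_right _ _)] at h1
  exact le_trans (by positivity) h1

end IsProfile

/-! ### The model potential in homogeneous coordinates -/

/-- The profile `χ` as a function of `t = ‖z‖²`, with the value `0` for `t ≤ 0`. -/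
noncomputable def radialProfile (χ : ℝ → ℝ) (t : ℝ) : ℝ :=
  if t ≤ 0 then 0 else χ (Real.log t / 2)

/-- The log-homogeneous extension of the model potential, as a function of `a = ‖z‖²` and
`b = |z₀|²`, where `[z₀ : z]` are homogeneous coordinates. For `b ≤ 0` it continues the formula
that holds for `4 b ≤ a`, so that it is smooth for `a > 0`. -/
noncomputable def homPot (χ : ℝ → ℝ) (D a b : ℝ) : ℝ :=
  if 0 < b then radialProfile χ (a / b) + Real.log b / 2 else Real.log a / 2 + D

namespace IsProfile

variable {α B D : ℝ} {χ : ℝ → ℝ}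

lemma radialProfile_eq_inner (h : IsProfile α B D χ) (hα : 0 < α) {t : ℝ} (h0 : 0 ≤ t)
    (h1 : t ≤ 1) : radialProfile χ t = B * t ^ α := by
  rcases h0.eq_or_lt with rfl | h0
  · simp [radialProfile, Real.zero_rpow hα.ne']
  · have := Real.log_nonpos h0.le h1
    rw [radialProfile, if_neg (not_le.2 h0), h.eq_exp _ (by linarith), Real.rpow_def_of_pos h0]
    ring_nf

lemma radialProfile_eq_outer (h : IsProfile α B D χ) {t : ℝ} (h4 : 4 ≤ t) :
    radialProfile χ t = Real.log t / 2 + D := by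
  rw [radialProfile, if_neg (by linarith), h.eq_line]
  have h1 : Real.log 4 ≤ Real.log t := Real.log_le_log (by norm_num) h4
  have h2 : Real.log 4 = 2 * Real.log 2 := by
    rw [show (4 : ℝ) = 2 ^ 2 by norm_num, Real.log_pow]; norm_num
  linarith

lemma contDiffAt_radialProfile (h : IsProfile α B D χ) {t : ℝ} (ht : 0 < t) :
    ContDiffAt ℝ ∞ (radialProfile χ) t := by
  have h1 : ContDiffAt ℝ ∞ (fun t => χ (Real.log t / 2)) t :=
    h.smooth.contDiffAt.comp t ((Real.contDiffAt_log.2 ht.ne').div_const 2)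
  refine h1.congr_of_eventuallyEq ?_
  filter_upwards [lt_mem_nhds ht] with s hs
  rw [radialProfile, if_neg (not_le.2 hs)]

lemma continuous_radialProfile (h : IsProfile α B D χ) (hα : 0 < α) :
    Continuous (radialProfile χ) := by
  rw [continuous_iff_continuousAt]
  intro t
  rcases lt_or_ge 0 t with ht | ht
  · exact (h.contDiffAt_radialProfile ht).continuousAt
  · have h1 : Continuous fun t : ℝ => B * (max t 0) ^ α :=
      continuous_const.mul ((continuous_id.max continuous_const).rpow_const fun _ => Or.inr hα.le)
    refine h1.continuousAt.congr ?_
    filter_upwards [gt_mem_nhds (show t < 1 by linarith)] with s hs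
    rcases le_or_gt s 0 with h0 | h0
    · simp [radialProfile, h0, Real.zero_rpow hα.ne']
    · rw [max_eq_left h0.le, h.radialProfile_eq_inner hα h0.le hs.le]

lemma radialProfile_nonneg (h : IsProfile α B D χ) (hB : 0 < B) (t : ℝ) :
    0 ≤ radialProfile χ t := by
  unfold radialProfile
  split_ifs
  · exact le_rfl
  · exact h.nonneg hB _

lemma radialProfile_mono (h : IsProfile α B D χ) (hB : 0 < B) : Monotone (radialProfile χ) := by
  intro s t hst
  by_cases hs : s ≤ 0
  · rw [radialProfile, if_pos hs]
    exact h.radialProfile_nonneg hB t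
  · push Not at hs
    rw [radialProfile, radialProfile, if_neg (not_le.2 hs), if_neg (not_le.2 (hs.trans_le hst))]
    have := Real.log_le_log hs hst
    exact h.strictMono.monotone (by linarith)

/-- The model potential is uniformly continuous as a function of the radius. Away from the origin
this is the bound `χ' ≤ 1`, close to it the Hölder continuity of `r ^ (2α)`. -/
lemma uniformContinuous_radial (h : IsProfile α B D χ) (hα : 0 < α) (hB : 0 < B) {ε : ℝ}
    (hε : 0 < ε) : ∃ δ > 0, ∀ r s : ℝ, 0 ≤ r → 0 ≤ s → |r - s| < δ →
      |radialProfile χ (r ^ 2) - radialProfile χ (s ^ 2)| < ε := by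
  have hcont : Continuous fun r : ℝ => radialProfile χ (r ^ 2) :=
    (h.continuous_radialProfile hα).comp (continuous_pow 2)
  have h0 : radialProfile χ (0 ^ 2) = 0 := by simp [radialProfile]
  obtain ⟨τ, hτ, hτ'⟩ := Metric.continuousAt_iff.1 (hcont.continuousAt (x := 0)) ε hε
  have key : ∀ r s : ℝ, 0 ≤ s → s ≤ r → r - s < min (τ / 2) (τ / 2 * ε) →
      radialProfile χ (r ^ 2) - radialProfile χ (s ^ 2) < ε := by
    intro r s hs hsr hrs
    have hr1 := lt_of_lt_of_le hrs (min_le_left _ _)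
    have hr2 := lt_of_lt_of_le hrs (min_le_right _ _)
    rcases lt_or_ge s (τ / 2) with h1 | h1
    · have := hτ' (x := r) (by rw [dist_zero_right, Real.norm_of_nonneg (hs.trans hsr)]; linarith)
      rw [h0, dist_zero_right, Real.norm_of_nonneg (h.radialProfile_nonneg hB _)] at this
      have := h.radialProfile_nonneg hB (s ^ 2)
      linarith
    · have hs0 : 0 < s := by linarith
      have hr0 : 0 < r := by linarith
      rw [radialProfile, radialProfile, if_neg (not_le.2 (by positivity)),
        if_neg (not_le.2 (by positivity)), Real.log_pow, Real.log_pow]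
      have t1 := h.tangent_le ((2 : ℕ) * Real.log r / 2) ((2 : ℕ) * Real.log s / 2)
      have t2 := h.deriv_le_one ((2 : ℕ) * Real.log r / 2)
      have t3 : Real.log s ≤ Real.log r := Real.log_le_log hs0 hsr
      have t4 : Real.log r - Real.log s ≤ (r - s) / s := by
        rw [← Real.log_div hr0.ne' hs0.ne']
        have := Real.log_le_sub_one_of_pos (show 0 < r / s by positivity)
        rw [sub_div, div_self hs0.ne']; exact this
      have t5 : (r - s) / s < ε := by
        rw [div_lt_iff₀ hs0]
        nlinarith
      push_cast at t1 t2 ⊢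
      nlinarith
  refine ⟨min (τ / 2) (τ / 2 * ε), by positivity, fun r s hr hs hrs => ?_⟩
  rw [abs_lt] at hrs ⊢
  rcases le_total s r with hsr | hsr
  · have h1 := key r s hs hsr hrs.2
    have h2 := h.radialProfile_mono hB (pow_le_pow_left₀ hs hsr 2)
    constructor <;> linarith
  · have h1 := key s r hr hsr (by linarith [hrs.1])
    have h2 := h.radialProfile_mono hB (pow_le_pow_left₀ hr hsr 2)
    constructor <;> linarith

lemma homPot_eq_outer (h : IsProfile α B D χ) {a b : ℝ} (ha : 0 < a) (hab : 4 * b ≤ a) :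
    homPot χ D a b = Real.log a / 2 + D := by
  unfold homPot
  split_ifs with hb
  · rw [h.radialProfile_eq_outer ((le_div_iff₀ hb).2 hab), Real.log_div ha.ne' hb.ne']
    ring
  · rfl

lemma homPot_eq_inner (h : IsProfile α B D χ) (hα : 0 < α) {a b : ℝ} (ha : 0 ≤ a) (hb : 0 < b)
    (hab : a ≤ b) : homPot χ D a b = B * (a / b) ^ α + Real.log b / 2 := by
  rw [homPot, if_pos hb, h.radialProfile_eq_inner hα (by positivity) ((div_le_one hb).2 hab)]

lemma contDiffAt_homPot (h : IsProfile α B D χ) {p : ℝ × ℝ} (hp : 0 < p.1) :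
    ContDiffAt ℝ ∞ (fun p : ℝ × ℝ => homPot χ D p.1 p.2) p := by
  rcases lt_or_ge 0 p.2 with hb | hb
  · have h1 : ContDiffAt ℝ ∞ (fun p : ℝ × ℝ => radialProfile χ (p.1 / p.2) + Real.log p.2 / 2) p := by
      refine ContDiffAt.add ?_ ((contDiffAt_snd.log hb.ne').div_const 2)
      exact (h.contDiffAt_radialProfile (div_pos hp hb)).comp p
        (contDiffAt_fst.div contDiffAt_snd hb.ne')
    refine h1.congr_of_eventuallyEq ?_
    filter_upwards [continuousAt_snd.eventually_const_lt hb] with q hq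
    rw [homPot, if_pos hq]
  · have h1 : ContDiffAt ℝ ∞ (fun p : ℝ × ℝ => Real.log p.1 / 2 + D) p :=
      ((contDiffAt_fst.log hp.ne').div_const 2).add contDiffAt_const
    refine h1.congr_of_eventuallyEq ?_
    have hc : ContinuousAt (fun q : ℝ × ℝ => 4 * q.2) p := by fun_prop
    filter_upwards [continuousAt_fst.eventually_const_lt hp,
      hc.eventually_lt continuousAt_fst (by linarith)] with q hq1 hq2
    exact h.homPot_eq_outer hq1 hq2.le

lemma continuousAt_homPot (h : IsProfile α B D χ) (hα : 0 < α) {p : ℝ × ℝ}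
    (hp : 0 < p.1 ∨ 0 < p.2) : ContinuousAt (fun p : ℝ × ℝ => homPot χ D p.1 p.2) p := by
  rcases hp with hp | hp
  · exact (h.contDiffAt_homPot hp).continuousAt
  · have h1 : ContinuousAt
        (fun p : ℝ × ℝ => radialProfile χ (p.1 / p.2) + Real.log p.2 / 2) p := by
      refine ContinuousAt.add ?_ ((continuousAt_snd.log hp.ne').div_const 2)
      exact (h.continuous_radialProfile hα).continuousAt.comp
        (continuousAt_fst.div continuousAt_snd hp.ne')
    refine h1.congr ?_
    filter_upwards [continuousAt_snd.eventually_const_lt hp] with q hq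
    rw [homPot, if_pos hq]

/-- The lower bound behind plurisubharmonicity: by convexity of `χ`, the potential is a supremum
of functions `k₁ log a + k₂ log b + c` with `k₁, k₂ ≥ 0`, where a logarithm that is `-∞` at the
given point does not occur. -/
lemma exists_log_le_homPot (h : IsProfile α B D χ) (hB : 0 < B) {a₀ b₀ : ℝ}
    (ha₀ : 0 ≤ a₀) (hb₀ : 0 ≤ b₀) (hab : 0 < a₀ ∨ 0 < b₀) :
    ∃ k₁ k₂ c : ℝ, 0 ≤ k₁ ∧ 0 ≤ k₂ ∧ (a₀ = 0 → k₁ = 0) ∧ (b₀ = 0 → k₂ = 0) ∧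
      homPot χ D a₀ b₀ = k₁ * Real.log a₀ + k₂ * Real.log b₀ + c ∧
      ∀ a b, 0 ≤ a → 0 ≤ b → (0 < a₀ → 0 < a) → (0 < b₀ → 0 < b) →
        k₁ * Real.log a + k₂ * Real.log b + c ≤ homPot χ D a b := by
  rcases ha₀.eq_or_lt with rfl | ha
  · have hb : 0 < b₀ := by simpa using hab
    refine ⟨0, 1 / 2, 0, le_rfl, by norm_num, fun _ => rfl, fun h => absurd h hb.ne', ?_, ?_⟩
    · rw [homPot, if_pos hb]
      simp [radialProfile]
      ring
    · intro a b _ _ _ hb'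
      rw [homPot, if_pos (hb' hb)]
      have := h.radialProfile_nonneg hB (a / b)
      linarith
  rcases hb₀.eq_or_lt with rfl | hb
  · refine ⟨1 / 2, 0, D, by norm_num, le_rfl, fun h => absurd h ha.ne', fun _ => rfl, ?_, ?_⟩
    · simp [homPot]; ring
    · intro a b _ hb ha' _
      have ha'' := ha' ha
      rcases hb.eq_or_lt with rfl | hb
      · simp [homPot]; linarith
      · rw [homPot, if_pos hb, radialProfile, if_neg (not_le.2 (div_pos ha'' hb)),
          Real.log_div ha''.ne' hb.ne']
        have := h.line_le ((Real.log a - Real.log b) / 2)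
        linarith
  · set s₀ := Real.log (a₀ / b₀) / 2 with hs₀
    have hk0 := (h.pos s₀).le
    have hk1 := h.deriv_le_one s₀
    refine ⟨deriv χ s₀ / 2, (1 - deriv χ s₀) / 2, χ s₀ - deriv χ s₀ * s₀, by linarith, by linarith,
      fun h => absurd h ha.ne', fun h => absurd h hb.ne', ?_, ?_⟩
    · rw [homPot, if_pos hb, radialProfile, if_neg (not_le.2 (div_pos ha hb)), ← hs₀]
      rw [hs₀, Real.log_div ha.ne' hb.ne']
      ring
    · intro a b _ _ ha' hb'
      have ha' := ha' ha
      have hb' := hb' hb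
      rw [homPot, if_pos hb', radialProfile, if_neg (not_le.2 (div_pos ha' hb'))]
      have := h.tangent_le s₀ (Real.log (a / b) / 2)
      rw [Real.log_div ha'.ne' hb'.ne'] at this ⊢
      linarith

end IsProfile

lemma homPot_mul {χ : ℝ → ℝ} {D c a b : ℝ} (hc : 0 < c) (hab : 0 < a ∨ 0 < b) :
    homPot χ D (c * a) (c * b) = homPot χ D a b + Real.log c / 2 := by
  unfold homPot
  by_cases hb : 0 < b
  · rw [if_pos hb, if_pos (mul_pos hc hb), mul_div_mul_left _ _ hc.ne',
      Real.log_mul hc.ne' hb.ne']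
    ring
  · have ha : 0 < a := hab.resolve_right hb
    rw [if_neg hb, if_neg (by simpa [hc] using hb), Real.log_mul hc.ne' ha.ne']
    ring

/-! ### Plurisubharmonicity in homogeneous coordinates -/

/-- `‖w' + w₀ h‖²` for homogeneous coordinates `w = (w₀, w')`. -/
noncomputable def shiftSq {n : ℕ} (h : Fin n → ℂ) (w : Fin (n + 1) → ℂ) : ℝ :=
  ∑ j, ‖w j.succ + h j * w 0‖ ^ 2

lemma shiftSq_nonneg {n : ℕ} (h : Fin n → ℂ) (w : Fin (n + 1) → ℂ) : 0 ≤ shiftSq h w :=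
  Finset.sum_nonneg fun _ _ => by positivity

lemma shiftSq_pos_or {n : ℕ} (h : Fin n → ℂ) {w : Fin (n + 1) → ℂ} (hw : w ≠ 0) :
    0 < shiftSq h w ∨ 0 < ‖w 0‖ ^ 2 := by
  by_contra! H
  have h0 : w 0 = 0 := by simpa using le_antisymm H.2 (by positivity)
  have h1 : shiftSq h w = 0 := le_antisymm H.1 (shiftSq_nonneg h w)
  rw [shiftSq, Finset.sum_eq_zero_iff_of_nonneg fun _ _ => by positivity] at h1
  refine hw (funext fun k => Fin.cases h0 (fun j => ?_) k)
  have := h1 j (Finset.mem_univ j)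
  simpa [h0] using this

lemma continuous_shiftSq {n : ℕ} (h : Fin n → ℂ) : Continuous (shiftSq h) := by
  unfold shiftSq; fun_prop

lemma ae_circleMap_ne (a : ℂ) : ∀ᵐ θ : ℝ, circleMap 0 1 θ ≠ a := by
  have := ((Set.countable_singleton a).preimage_circleMap 0 one_ne_zero).measure_zero
    (volume : Measure ℝ)
  rw [measure_eq_zero_iff_ae_notMem] at this
  exact this

/-- Sub-mean value property of `log |x + ζ y|`, in a form that does not use the value of the
logarithm at the zero. -/
lemma exists_log_circleAverage {x : ℂ} (hx : x ≠ 0) (y : ℂ) : ∃ g : ℂ → ℝ,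
    CircleIntegrable g 0 1 ∧ (∀ᵐ θ : ℝ, x + circleMap 0 1 θ * y ≠ 0 ∧
      g (circleMap 0 1 θ) = Real.log ‖x + circleMap 0 1 θ * y‖) ∧
    Real.log ‖x‖ ≤ Real.circleAverage g 0 1 := by
  by_cases hy : y = 0
  · refine ⟨fun _ => Real.log ‖x‖, circleIntegrable_const _ _ _,
      Eventually.of_forall fun θ => by simp [hy, hx], ?_⟩
    rw [Real.circleAverage_const]
  · set a := -x / y with ha
    have hxa : ∀ ζ, x + ζ * y = y * (ζ - a) := fun ζ => by rw [ha]; field_simp; ring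
    have hi := circleIntegrable_log_norm_sub_const (a := a) (c := 0) 1
    refine ⟨(fun _ => Real.log ‖y‖) + (Real.log ‖· - a‖), (circleIntegrable_const _ _ _).add hi,
      ?_, ?_⟩
    · filter_upwards [ae_circleMap_ne a] with θ hθ
      have h1 : circleMap 0 1 θ - a ≠ 0 := sub_ne_zero.2 hθ
      rw [hxa, norm_mul, Real.log_mul (norm_ne_zero_iff.2 hy) (norm_ne_zero_iff.2 h1)]
      exact ⟨mul_ne_zero hy h1, rfl⟩
    · rw [Real.circleAverage_add (circleIntegrable_const _ _ _) hi, Real.circleAverage_const,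
        circleAverage_log_norm_sub_const_eq_posLog]
      have h1 : ‖x‖ = ‖y‖ * ‖a‖ := by
        rw [ha, norm_div, norm_neg, mul_div_cancel₀ _ (norm_ne_zero_iff.2 hy)]
      have h2 : ‖a‖ ≠ 0 := fun h => hx (norm_eq_zero.1 (by rw [h1, h, mul_zero]))
      rw [h1, Real.log_mul (norm_ne_zero_iff.2 hy) h2]
      have : Real.log ‖a‖ ≤ Real.posLog ‖a‖ := le_max_right _ _
      linarith

/-- The same for `log ‖P + ζ Q‖²` with vectors `P` and `Q`, with a minorant that comes from the
scalar case by projection to the direction of `P`. -/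
lemma exists_log_shiftSq_circleAverage {n : ℕ} (h : Fin n → ℂ) {w : Fin (n + 1) → ℂ}
    (hw : 0 < shiftSq h w) (v : Fin (n + 1) → ℂ) : ∃ g : ℂ → ℝ,
    CircleIntegrable g 0 1 ∧ (∀ᵐ θ : ℝ, 0 < shiftSq h (w + circleMap 0 1 θ • v) ∧
      g (circleMap 0 1 θ) ≤ Real.log (shiftSq h (w + circleMap 0 1 θ • v))) ∧
    Real.log (shiftSq h w) ≤ Real.circleAverage g 0 1 := by
  set A : Fin n → ℂ := fun j => w j.succ + h j * w 0 with hA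
  set Q : Fin n → ℂ := fun j => v j.succ + h j * v 0 with hQ
  set s := shiftSq h w with hs
  have hx : ∑ j, A j * (starRingEnd ℂ) (A j) = (s : ℂ) := by
    rw [hs, shiftSq]
    push_cast
    exact Finset.sum_congr rfl fun j _ => by rw [Complex.mul_conj, Complex.normSq_eq_norm_sq]; simp [hA]
  have hx0 : (s : ℂ) ≠ 0 := by exact_mod_cast hw.ne'
  obtain ⟨g, hg, hge, hga⟩ := exists_log_circleAverage hx0 (∑ j, Q j * (starRingEnd ℂ) (A j))
  have hs' : ‖(s : ℂ)‖ = s := by rw [Complex.norm_real, Real.norm_of_nonneg hw.le]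
  have hg2 : CircleIntegrable ((2 : ℝ) • g) 0 1 := by
    simpa [CircleIntegrable] using IntervalIntegrable.const_mul hg 2
  refine ⟨(2 : ℝ) • g - fun _ => Real.log s, hg2.sub (circleIntegrable_const _ _ _), ?_, ?_⟩
  · filter_upwards [hge] with θ hθ
    set ζ := circleMap 0 1 θ
    have hsum : (s : ℂ) + ζ * ∑ j, Q j * (starRingEnd ℂ) (A j)
        = ∑ j, (A j + ζ * Q j) * (starRingEnd ℂ) (A j) := by
      rw [← hx, Finset.mul_sum, ← Finset.sum_add_distrib]
      exact Finset.sum_congr rfl fun j _ => by ring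
    have hq : shiftSq h (w + ζ • v) = ∑ j, ‖A j + ζ * Q j‖ ^ 2 := by
      rw [shiftSq]
      refine Finset.sum_congr rfl fun j _ => ?_
      simp only [hA, hQ, Pi.add_apply, Pi.smul_apply, smul_eq_mul]
      ring_nf
    have hcs : ‖(s : ℂ) + ζ * ∑ j, Q j * (starRingEnd ℂ) (A j)‖ ^ 2
        ≤ shiftSq h (w + ζ • v) * s := by
      rw [hsum, hq, hs, shiftSq]
      calc ‖∑ j, (A j + ζ * Q j) * (starRingEnd ℂ) (A j)‖ ^ 2
          ≤ (∑ j, ‖A j + ζ * Q j‖ * ‖A j‖) ^ 2 := by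
            gcongr
            refine norm_sum_le_of_le _ fun j _ => ?_
            rw [norm_mul, RCLike.norm_conj]
        _ ≤ _ := Finset.sum_mul_sq_le_sq_mul_sq _ _ _
    have hpos : 0 < ‖(s : ℂ) + ζ * ∑ j, Q j * (starRingEnd ℂ) (A j)‖ := norm_pos_iff.2 hθ.1
    have hq0 : 0 < shiftSq h (w + ζ • v) := by
      by_contra! hneg
      nlinarith [pow_pos hpos 2]
    refine ⟨hq0, ?_⟩
    have := Real.log_le_log (pow_pos hpos 2) hcs
    rw [Real.log_pow, Real.log_mul hq0.ne' hw.ne'] at this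
    simp only [Pi.sub_apply, Pi.smul_apply, smul_eq_mul, hθ.2]
    push_cast at this
    linarith
  · rw [Real.circleAverage_sub hg2 (circleIntegrable_const _ _ _), Real.circleAverage_const,
      Real.circleAverage_smul, smul_eq_mul]
    rw [hs'] at hga
    linarith

/-- The sub-mean value property of the homogeneous potential on circles that avoid the origin. -/
lemma IsProfile.homPot_le_circleAverage {n : ℕ} {α B D : ℝ} {χ : ℝ → ℝ} (hχ : IsProfile α B D χ)
    (hα : 0 < α) (hB : 0 < B) (h : Fin n → ℂ) {w v : Fin (n + 1) → ℂ}
    (hw : ∀ ζ : ℂ, w + ζ • v ≠ 0) :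
    homPot χ D (shiftSq h w) (‖w 0‖ ^ 2) ≤ Real.circleAverage
      (fun ζ : ℂ => homPot χ D (shiftSq h (w + ζ • v)) (‖(w + ζ • v) 0‖ ^ 2)) 0 1 := by
  have hw0 : w ≠ 0 := by simpa using hw 0
  set Φ : ℂ → ℝ := fun ζ => homPot χ D (shiftSq h (w + ζ • v)) (‖(w + ζ • v) 0‖ ^ 2) with hΦ
  have hΦc : Continuous Φ := by
    rw [continuous_iff_continuousAt]
    intro ζ
    have h1 : Continuous fun ζ : ℂ => (shiftSq h (w + ζ • v), ‖(w + ζ • v) 0‖ ^ 2) := by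
      have := continuous_shiftSq h
      fun_prop
    exact (hχ.continuousAt_homPot hα (p := (shiftSq h (w + ζ • v), ‖(w + ζ • v) 0‖ ^ 2))
      (shiftSq_pos_or h (hw ζ))).comp (f := fun ζ : ℂ => (shiftSq h (w + ζ • v), ‖(w + ζ • v) 0‖ ^ 2))
      h1.continuousAt
  have hΦi : CircleIntegrable Φ 0 1 := hΦc.continuousOn.circleIntegrable'
  obtain ⟨k₁, k₂, c, hk1, hk2, hz1, hz2, heq, hle⟩ := hχ.exists_log_le_homPot hB
    (shiftSq_nonneg h w) (sq_nonneg ‖w 0‖) (shiftSq_pos_or h hw0)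
  obtain ⟨g₁, hg1, hg1e, hg1a⟩ : ∃ g : ℂ → ℝ, CircleIntegrable g 0 1 ∧
      (∀ᵐ θ : ℝ, (0 < shiftSq h w → 0 < shiftSq h (w + circleMap 0 1 θ • v)) ∧
        k₁ * g (circleMap 0 1 θ) ≤ k₁ * Real.log (shiftSq h (w + circleMap 0 1 θ • v))) ∧
      k₁ * Real.log (shiftSq h w) ≤ k₁ * Real.circleAverage g 0 1 := by
    rcases (shiftSq_nonneg h w).eq_or_lt with h0 | h0
    · refine ⟨fun _ => 0, circleIntegrable_const _ _ _, Eventually.of_forall fun θ => ?_, ?_⟩ <;>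
        simp [hz1 h0.symm, ← h0]
    · obtain ⟨g, hg, hge, hga⟩ := exists_log_shiftSq_circleAverage h h0 v
      refine ⟨g, hg, ?_, by gcongr⟩
      filter_upwards [hge] with θ hθ
      exact ⟨fun _ => hθ.1, mul_le_mul_of_nonneg_left hθ.2 hk1⟩
  obtain ⟨g₂, hg2, hg2e, hg2a⟩ : ∃ g : ℂ → ℝ, CircleIntegrable g 0 1 ∧
      (∀ᵐ θ : ℝ, (0 < ‖w 0‖ ^ 2 → 0 < ‖(w + circleMap 0 1 θ • v) 0‖ ^ 2) ∧
        k₂ * (2 * g (circleMap 0 1 θ)) ≤ k₂ * Real.log (‖(w + circleMap 0 1 θ • v) 0‖ ^ 2)) ∧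
      k₂ * Real.log (‖w 0‖ ^ 2) ≤ k₂ * (2 * Real.circleAverage g 0 1) := by
    by_cases h0 : w 0 = 0
    · refine ⟨fun _ => 0, circleIntegrable_const _ _ _, Eventually.of_forall fun θ => ?_, ?_⟩ <;>
        simp [hz2 (by simp [h0]), h0]
    · obtain ⟨g, hg, hge, hga⟩ := exists_log_circleAverage h0 (v 0)
      refine ⟨g, hg, ?_, ?_⟩
      · filter_upwards [hge] with θ hθ
        have e : (w + circleMap 0 1 θ • v) 0 = w 0 + circleMap 0 1 θ * v 0 := rfl
        rw [e, Real.log_pow, hθ.2]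
        refine ⟨fun _ => by have := norm_pos_iff.2 hθ.1; positivity, by norm_num⟩
      · rw [Real.log_pow]; push_cast; gcongr
  have hi1 : CircleIntegrable (k₁ • g₁) 0 1 := by
    simpa [CircleIntegrable] using IntervalIntegrable.const_mul hg1 k₁
  have hi2 : CircleIntegrable ((k₂ * 2) • g₂) 0 1 := by
    simpa [CircleIntegrable] using IntervalIntegrable.const_mul hg2 (k₂ * 2)
  have hi3 : CircleIntegrable (fun _ => c) 0 1 := circleIntegrable_const _ _ _
  calc homPot χ D (shiftSq h w) (‖w 0‖ ^ 2)
      ≤ Real.circleAverage (k₁ • g₁ + (k₂ * 2) • g₂ + fun _ => c) 0 1 := by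
        rw [Real.circleAverage_add (hi1.add hi2) hi3, Real.circleAverage_add hi1 hi2,
          Real.circleAverage_smul, Real.circleAverage_smul, Real.circleAverage_const, heq]
        simp only [smul_eq_mul]
        linarith
    _ ≤ Real.circleAverage Φ 0 1 := by
        rw [Real.circleAverage_def, Real.circleAverage_def, smul_eq_mul, smul_eq_mul]
        refine mul_le_mul_of_nonneg_left ?_ (by positivity)
        refine intervalIntegral.integral_mono_ae (by positivity) ((hi1.add hi2).add hi3) hΦi ?_
        filter_upwards [hg1e, hg2e] with θ h1 h2
        have := hle _ _ (shiftSq_nonneg h (w + circleMap 0 1 θ • v))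
          (sq_nonneg ‖(w + circleMap 0 1 θ • v) 0‖) h1.1 h2.1
        change k₁ * g₁ (circleMap 0 1 θ) + k₂ * 2 * g₂ (circleMap 0 1 θ) + c ≤
          homPot χ D (shiftSq h (w + circleMap 0 1 θ • v)) (‖(w + circleMap 0 1 θ • v) 0‖ ^ 2)
        linarith [h1.2, h2.2]

/-! ### The Levi form under holomorphic maps -/

section leviForm

variable {E F : Type*} [NormedAddCommGroup E] [NormedSpace ℂ E]
  [NormedAddCommGroup F] [NormedSpace ℂ F]

/-- The sesquilinear part of type `(1,1)` of a real bilinear form. -/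
noncomputable def leviForm (Q : E →L[ℝ] E →L[ℝ] ℝ) (v w : E) : ℂ :=
  (((Q v w + Q (Complex.I • v) (Complex.I • w) : ℝ) : ℂ)
    + Complex.I * ((Q v (Complex.I • w) - Q (Complex.I • v) w : ℝ) : ℂ)) / 4

lemma leviMatrix_eq_leviForm {n : ℕ} (u : (Fin n → ℂ) → ℝ) (z : Fin n → ℂ) (j l : Fin n) :
    leviMatrix u z j l =
      leviForm (fderiv ℝ (fderiv ℝ u) z) (Pi.single j 1) (Pi.single l 1) := by
  simp [leviMatrix, leviForm, ← Pi.single_smul]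

lemma leviForm_add_left (Q : E →L[ℝ] E →L[ℝ] ℝ) (v v' w : E) :
    leviForm Q (v + v') w = leviForm Q v w + leviForm Q v' w := by
  simp only [leviForm, smul_add, map_add, add_apply]
  push_cast
  ring

lemma leviForm_add_right (Q : E →L[ℝ] E →L[ℝ] ℝ) (v w w' : E) :
    leviForm Q v (w + w') = leviForm Q v w + leviForm Q v w' := by
  simp only [leviForm, smul_add, map_add]
  push_cast
  ring

lemma leviForm_smul_left (Q : E →L[ℝ] E →L[ℝ] ℝ) (c : ℂ) (v w : E) :
    leviForm Q (c • v) w = c * leviForm Q v w := by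
  have e1 : c • v = c.re • v + c.im • (Complex.I • v) := by
    conv_lhs => rw [← Complex.re_add_im c]
    rw [add_smul, mul_smul]
    rfl
  have e2 : Complex.I • (c • v) = c.re • (Complex.I • v) - c.im • v := by
    rw [e1, smul_add, smul_comm Complex.I c.re, smul_comm Complex.I c.im, smul_smul Complex.I,
      Complex.I_mul_I, neg_one_smul, smul_neg]
    abel
  simp only [leviForm, e2]
  rw [e1]
  simp only [map_add, map_sub, map_smul, add_apply,
    sub_apply, smul_apply, smul_eq_mul]
  conv_rhs => rw [← Complex.re_add_im c]
  push_cast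
  have := Complex.I_mul_I
  linear_combination (c.im * ((Q v (Complex.I • w) : ℂ) - Q (Complex.I • v) w) / 4) * (-this)

lemma leviForm_smul_right (Q : E →L[ℝ] E →L[ℝ] ℝ) (c : ℂ) (v w : E) :
    leviForm Q v (c • w) = (starRingEnd ℂ) c * leviForm Q v w := by
  have e1 : c • w = c.re • w + c.im • (Complex.I • w) := by
    conv_lhs => rw [← Complex.re_add_im c]
    rw [add_smul, mul_smul]
    rfl
  have e2 : Complex.I • (c • w) = c.re • (Complex.I • w) - c.im • w := by
    rw [e1, smul_add, smul_comm Complex.I c.re, smul_comm Complex.I c.im, smul_smul Complex.I,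
      Complex.I_mul_I, neg_one_smul, smul_neg]
    abel
  have e3 : (starRingEnd ℂ) c = c.re - c.im * Complex.I := by
    apply Complex.ext <;> simp
  simp only [leviForm, e2]
  rw [e1, e3]
  simp only [map_add, map_sub, map_smul, smul_eq_mul]
  push_cast
  have := Complex.I_mul_I
  linear_combination (c.im * ((Q v (Complex.I • w) : ℂ) - Q (Complex.I • v) w) / 4) * (this)

lemma leviForm_sum_sum {ι : Type*} (s : Finset ι) (Q : E →L[ℝ] E →L[ℝ] ℝ) (a b : ι → ℂ)
    (e : ι → E) : leviForm Q (∑ p ∈ s, a p • e p) (∑ q ∈ s, b q • e q) =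
      ∑ p ∈ s, ∑ q ∈ s, a p * (starRingEnd ℂ) (b q) * leviForm Q (e p) (e q) := by
  have hl : ∀ w, leviForm Q (∑ p ∈ s, a p • e p) w = ∑ p ∈ s, a p * leviForm Q (e p) w := by
    intro w
    have := map_sum (AddMonoidHom.mk' (fun v => leviForm Q v w)
      (fun v v' => leviForm_add_left Q v v' w)) (fun p => a p • e p) s
    simpa only [AddMonoidHom.mk'_apply, leviForm_smul_left] using this
  rw [hl]
  refine Finset.sum_congr rfl fun p _ => ?_
  have := map_sum (AddMonoidHom.mk' (fun w => leviForm Q (e p) w)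
      (fun v v' => leviForm_add_right Q (e p) v v')) (fun q => b q • e q) s
  simp only [AddMonoidHom.mk'_apply, leviForm_smul_right] at this
  rw [this, Finset.mul_sum]
  exact Finset.sum_congr rfl fun q _ => by ring

/-- The Levi form is natural under holomorphic maps: the second derivative of the map itself is
complex bilinear and has no part of type `(1,1)`. -/
lemma leviForm_comp {g : E → F} {u : F → ℝ} {z : E} (hg : ContDiffAt ℂ 2 g z)
    (hu : ContDiffAt ℝ 2 u (g z)) (v w : E) :
    leviForm (fderiv ℝ (fderiv ℝ (u ∘ g)) z) v w =
      leviForm (fderiv ℝ (fderiv ℝ u) (g z)) (fderiv ℂ g z v) (fderiv ℂ g z w) := by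
  have hgev : ∀ᶠ y in 𝓝 z, DifferentiableAt ℂ g y := by
    filter_upwards [hg.eventually (by simp)] with y hy
    exact hy.differentiableAt (by simp)
  have huev : ∀ᶠ y in 𝓝 z, DifferentiableAt ℝ u (g y) := by
    filter_upwards [hg.continuousAt.eventually (hu.eventually (by simp))] with y hy
    exact hy.differentiableAt (by simp)
  have h1 : fderiv ℝ (u ∘ g) =ᶠ[𝓝 z] fun y =>
      (fderiv ℝ u (g y)).comp ((fderiv ℂ g y).restrictScalars ℝ) := by
    filter_upwards [hgev, huev] with y hy hy'
    exact (hy'.hasFDerivAt.comp y (hy.hasFDerivAt.restrictScalars ℝ)).fderiv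
  have hd2g : DifferentiableAt ℂ (fderiv ℂ g) z :=
    (hg.fderiv_right (m := 1) (by norm_num)).differentiableAt (by simp)
  have hd2u : DifferentiableAt ℝ (fderiv ℝ u) (g z) :=
    (hu.fderiv_right (m := 1) (by norm_num)).differentiableAt (by simp)
  have hgd : HasFDerivAt g ((fderiv ℂ g z).restrictScalars ℝ) z :=
    (hg.differentiableAt (by simp)).hasFDerivAt.restrictScalars ℝ
  have h2 : HasFDerivAt (fun y => (fderiv ℂ g y).restrictScalars ℝ)
      ((ContinuousLinearMap.restrictScalarsL ℂ E F ℝ ℝ).comp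
        ((fderiv ℂ (fderiv ℂ g) z).restrictScalars ℝ)) z :=
    (ContinuousLinearMap.restrictScalarsL ℂ E F ℝ ℝ).hasFDerivAt.comp z
      (hd2g.hasFDerivAt.restrictScalars ℝ)
  have h3 : HasFDerivAt
      (fun y => (fderiv ℝ u (g y)).comp ((fderiv ℂ g y).restrictScalars ℝ)) _ z :=
    (hd2u.hasFDerivAt.comp z hgd).clm_comp h2
  have h4 : ∀ a b, fderiv ℝ (fderiv ℝ (u ∘ g)) z a b =
      fderiv ℝ (fderiv ℝ u) (g z) (fderiv ℂ g z a) (fderiv ℂ g z b)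
        + fderiv ℝ u (g z) (fderiv ℂ (fderiv ℂ g) z a b) := by
    intro a b
    rw [h1.fderiv_eq, HasFDerivAt.fderiv h3]
    simp [add_comm]
  simp only [leviForm, h4, map_smul, smul_apply]
  rw [smul_smul, Complex.I_mul_I]
  simp only [neg_smul, one_smul, map_neg]
  push_cast
  ring

lemma leviForm_re {G : E → ℂ} {z : E} (hG : ContDiffAt ℂ 2 G z) (v w : E) :
    leviForm (fderiv ℝ (fderiv ℝ (fun y => (G y).re)) z) v w = 0 := by
  have := leviForm_comp (u := fun x : ℂ => x.re) hG Complex.reCLM.contDiff.contDiffAt v w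
  simp only [Function.comp_def] at this
  rw [this]
  have h1 : fderiv ℝ (fun x : ℂ => x.re) = fun _ => Complex.reCLM :=
    funext fun x => Complex.reCLM.hasFDerivAt.fderiv
  rw [h1]
  simp [leviForm]

/-- `log |G|` is pluriharmonic where the holomorphic function `G` does not vanish. -/
lemma leviForm_log_norm {G : E → ℂ} {z : E} (hG : ContDiffAt ℂ 2 G z) (h0 : G z ≠ 0) (v w : E) :
    leviForm (fderiv ℝ (fderiv ℝ (fun y => Real.log ‖G y‖)) z) v w = 0 := by
  have hq : ContDiffAt ℂ 2 (fun y => G y / G z) z := hG.div_const _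
  have hs : G z / G z ∈ Complex.slitPlane := by rw [div_self h0]; exact Complex.one_mem_slitPlane
  have hL : ContDiffAt ℂ 2 (fun y => Complex.log (G y / G z) + Real.log ‖G z‖) z :=
    ((Complex.contDiffAt_log hs).comp z hq).add contDiffAt_const
  have he : (fun y => Real.log ‖G y‖) =ᶠ[𝓝 z]
      fun y => (Complex.log (G y / G z) + Real.log ‖G z‖).re := by
    filter_upwards [hG.continuousAt.eventually_ne h0] with y hy
    rw [Complex.add_re, Complex.log_re, Complex.ofReal_re, norm_div,
      Real.log_div (norm_ne_zero_iff.2 hy) (norm_ne_zero_iff.2 h0)]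
    ring
  rw [he.fderiv.fderiv_eq, leviForm_re hL]

lemma leviForm_add {u u' : E → ℝ} {z : E} (hu : ContDiffAt ℝ 2 u z) (hu' : ContDiffAt ℝ 2 u' z)
    (v w : E) : leviForm (fderiv ℝ (fderiv ℝ (fun y => u y + u' y)) z) v w =
      leviForm (fderiv ℝ (fderiv ℝ u) z) v w + leviForm (fderiv ℝ (fderiv ℝ u') z) v w := by
  have h1 : fderiv ℝ (fun y => u y + u' y) =ᶠ[𝓝 z] fun y => fderiv ℝ u y + fderiv ℝ u' y := by
    filter_upwards [hu.eventually (by simp), hu'.eventually (by simp)] with y hy hy'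
    exact fderiv_fun_add (hy.differentiableAt (by simp)) (hy'.differentiableAt (by simp))
  rw [h1.fderiv_eq, fderiv_fun_add
    ((hu.fderiv_right (m := 1) (by norm_num)).differentiableAt (by simp))
    ((hu'.fderiv_right (m := 1) (by norm_num)).differentiableAt (by simp))]
  simp only [leviForm, add_apply]
  push_cast
  ring

/-- The Levi determinant is multiplied by `|det J|²` under a holomorphic map with Jacobian `J`,
and adding `log |G|` with a holomorphic `G` does not change it. -/
lemma det_leviMatrix_comp {n : ℕ} {g : (Fin n → ℂ) → Fin n → ℂ} {G : (Fin n → ℂ) → ℂ}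
    {u : (Fin n → ℂ) → ℝ} {z : Fin n → ℂ} (hg : ContDiffAt ℂ 2 g z) (hG : ContDiffAt ℂ 2 G z)
    (h0 : G z ≠ 0) (hu : ContDiffAt ℝ 2 u (g z)) {v : (Fin n → ℂ) → ℝ}
    (hv : v =ᶠ[𝓝 z] fun y => u (g y) + Real.log ‖G y‖) :
    (leviMatrix v z).det =
      ((‖(LinearMap.toMatrix' (fderiv ℂ g z : (Fin n → ℂ) →ₗ[ℂ] Fin n → ℂ)).det‖ ^ 2 : ℝ) : ℂ)
        * (leviMatrix u (g z)).det := by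
  set J := LinearMap.toMatrix' (fderiv ℂ g z : (Fin n → ℂ) →ₗ[ℂ] Fin n → ℂ) with hJ
  have hJe : ∀ j, fderiv ℂ g z (Pi.single j 1) = ∑ p, J p j • (Pi.single p 1 : Fin n → ℂ) := by
    intro j
    funext k
    simp [hJ, LinearMap.toMatrix'_apply, Finset.sum_apply, Pi.single_apply]
  have hGR : ContDiffAt ℝ 2 (fun y => Real.log ‖G y‖) z :=
    ((hG.restrict_scalars ℝ).norm ℂ h0).log (norm_ne_zero_iff.2 h0)
  have hM : leviMatrix v z = J.transpose * leviMatrix u (g z) * J.map (starRingEnd ℂ) := by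
    ext j l
    have hadd := leviForm_add (hu.comp z (hg.restrict_scalars ℝ)) hGR (Pi.single j 1)
      (Pi.single l 1)
    have hcomp := leviForm_comp hg hu (Pi.single j 1) (Pi.single l 1)
    simp only [Function.comp_def] at hadd hcomp
    rw [leviMatrix_eq_leviForm, hv.fderiv.fderiv_eq, hadd, leviForm_log_norm hG h0, add_zero,
      hcomp, hJe, hJe, leviForm_sum_sum, Matrix.mul_apply]
    simp only [Matrix.mul_apply, Finset.sum_mul, Matrix.transpose_apply, Matrix.map_apply]
    rw [Finset.sum_comm]
    refine Finset.sum_congr rfl fun p _ => Finset.sum_congr rfl fun q _ => ?_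
    rw [leviMatrix_eq_leviForm]
    ring
  have hdet : (J.map (starRingEnd ℂ)).det = (starRingEnd ℂ) J.det :=
    (RingHom.map_det (starRingEnd ℂ) J).symm
  rw [hM, Matrix.det_mul, Matrix.det_mul, Matrix.det_transpose, hdet, Complex.sq_norm,
    ← Complex.mul_conj]
  ring

end leviForm

/-! ### Levi matrices of radial functions -/

section radial

variable {n : ℕ}

lemma hermNorm_sq (z : Fin n → ℂ) : hermNorm z ^ 2 = ∑ j, ‖z j‖ ^ 2 :=
  Real.sq_sqrt (Finset.sum_nonneg fun _ _ => by positivity)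

lemma hermNorm_nonneg (z : Fin n → ℂ) : 0 ≤ hermNorm z := Real.sqrt_nonneg _

/-- The real bilinear form `2 Re ⟨v, w⟩` on `ℂⁿ`, the second derivative of `‖z‖²`. -/
noncomputable def hermForm (n : ℕ) : (Fin n → ℂ) →L[ℝ] (Fin n → ℂ) →L[ℝ] ℝ :=
  ∑ j, (2 : ℝ) • (innerSL ℝ (E := ℂ)).bilinearComp (ContinuousLinearMap.proj j)
    (ContinuousLinearMap.proj j)

lemma hermForm_apply (v w : Fin n → ℂ) :
    hermForm n v w = ∑ j, 2 * ((v j).re * (w j).re + (v j).im * (w j).im) := by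
  simp [hermForm, Complex.inner]
  refine Finset.sum_congr rfl fun j _ => ?_
  ring

lemma hasFDerivAt_hermNorm_sq (h z : Fin n → ℂ) :
    HasFDerivAt (fun z => hermNorm (z + h) ^ 2) (hermForm n (z + h)) z := by
  simp_rw [hermNorm_sq]
  have : ∀ j ∈ Finset.univ, HasFDerivAt (fun z : Fin n → ℂ => ‖(z + h) j‖ ^ 2)
      ((2 : ℝ) • (innerSL ℝ ((z + h) j)).comp (ContinuousLinearMap.proj (R := ℝ) j)) z := by
    intro j _
    have h1 : HasFDerivAt (fun z : Fin n → ℂ => (z + h) j)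
        (ContinuousLinearMap.proj (R := ℝ) (φ := fun _ : Fin n => ℂ) j) z := by
      simpa using (ContinuousLinearMap.proj (R := ℝ) (φ := fun _ : Fin n => ℂ) j).hasFDerivAt.add_const
        (x := z) (h j)
    refine h1.norm_sq.congr_fderiv ?_
    rw [← Nat.cast_smul_eq_nsmul ℝ, Nat.cast_ofNat]
  convert! HasFDerivAt.fun_sum this using 1
  ext v
  simp [hermForm]

lemma contDiff_hermNorm_sq (h : Fin n → ℂ) {k : WithTop ℕ∞} :
    ContDiff ℝ k (fun z : Fin n → ℂ => hermNorm (z + h) ^ 2) := by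
  simp_rw [hermNorm_sq]
  refine ContDiff.sum fun j _ => ContDiff.norm_sq ℝ ?_
  exact (contDiff_apply ℝ ℂ j).add contDiff_const

lemma contDiffAt_deriv {F : ℝ → ℝ} {t : ℝ} {k m : WithTop ℕ∞} (hF : ContDiffAt ℝ k F t)
    (hm : m + 1 ≤ k) : ContDiffAt ℝ m (deriv F) t := by
  have : deriv F = fun x => fderiv ℝ F x 1 := funext fun x => fderiv_apply_one_eq_deriv.symm
  rw [this]
  exact (hF.fderiv_right hm).clm_apply contDiffAt_const

/-- The Levi matrix of `F (‖z + h‖²)`. -/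
lemma leviMatrix_radial {F : ℝ → ℝ} {h z : Fin n → ℂ}
    (hF : ContDiffAt ℝ 2 F (hermNorm (z + h) ^ 2)) :
    leviMatrix (fun z => F (hermNorm (z + h) ^ 2)) z =
      ((deriv F (hermNorm (z + h) ^ 2) : ℝ) : ℂ) • (1 : Matrix (Fin n) (Fin n) ℂ) +
      ((deriv (deriv F) (hermNorm (z + h) ^ 2) : ℝ) : ℂ) •
        Matrix.vecMulVec (fun j => (starRingEnd ℂ) (z j + h j)) (fun l => z l + h l) := by
  have h1 : fderiv ℝ (fun z => F (hermNorm (z + h) ^ 2)) =ᶠ[𝓝 z]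
      fun z => deriv F (hermNorm (z + h) ^ 2) • hermForm n (z + h) := by
    filter_upwards [(contDiff_hermNorm_sq h (k := 0)).continuous.continuousAt.eventually
      (hF.eventually (by simp))] with y hy
    exact ((hy.differentiableAt (by simp)).hasDerivAt.comp_hasFDerivAt y
      (hasFDerivAt_hermNorm_sq h y)).fderiv
  have hd2 : HasDerivAt (deriv F) (deriv (deriv F) (hermNorm (z + h) ^ 2))
      (hermNorm (z + h) ^ 2) := by
    exact ((contDiffAt_deriv (m := 1) hF (by norm_num)).differentiableAt (by simp)).hasDerivAt
  have hlin : HasFDerivAt (fun z => hermForm n (z + h)) (hermForm n) z := by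
    have h2 : HasFDerivAt (fun z : Fin n → ℂ => z + h)
        (ContinuousLinearMap.id ℝ (Fin n → ℂ)) z := (hasFDerivAt_id z).add_const h
    exact (hermForm n).hasFDerivAt.comp z h2
  have h3 : ∀ v w, fderiv ℝ (fderiv ℝ (fun z => F (hermNorm (z + h) ^ 2))) z v w =
      deriv F (hermNorm (z + h) ^ 2) * hermForm n v w
        + deriv (deriv F) (hermNorm (z + h) ^ 2) * hermForm n (z + h) v * hermForm n (z + h) w := by
    intro v w
    have h5 := HasDerivAt.comp_hasFDerivAt (f := fun z => hermNorm (z + h) ^ 2) z hd2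
      (hasFDerivAt_hermNorm_sq h z)
    simp only [Function.comp_def] at h5
    have h4 := h5.fun_smul hlin
    rw [h1.fderiv_eq, h4.fderiv]
    simp only [add_apply, smul_apply, smul_eq_mul, ContinuousLinearMap.smulRight_apply]
  ext j l
  simp only [leviMatrix, h3, hermForm_apply]
  have e1 : ∀ (x : Fin n → ℂ) (k : Fin n) (c : ℂ),
      ∑ i, 2 * ((x i).re * ((Pi.single k c : Fin n → ℂ) i).re
        + (x i).im * ((Pi.single k c : Fin n → ℂ) i).im) = 2 * ((x k).re * c.re + (x k).im * c.im) := by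
    intro x k c
    rw [Finset.sum_eq_single k]
    · simp
    · intro i _ hi; simp [hi]
    · simp
  simp only [e1]
  simp only [Matrix.add_apply, Matrix.smul_apply, Matrix.one_apply, Matrix.vecMulVec_apply,
    smul_eq_mul, Pi.single_apply, Pi.add_apply]
  have hz : ∀ k, z k + h k = ((z k + h k).re : ℂ) + (z k + h k).im * Complex.I := fun k =>
    (Complex.re_add_im _).symm
  have hcz : ∀ k, (starRingEnd ℂ) (z k + h k) = ((z k + h k).re : ℂ) - (z k + h k).im * Complex.I :=
    fun k => by apply Complex.ext <;> simp [add_comm]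
  rw [hcz j]
  conv_rhs => rw [hz l]
  by_cases hjl : j = l
  · subst hjl
    simp only [if_true, Complex.one_re, Complex.one_im, Complex.I_re, Complex.I_im]
    push_cast
    have := Complex.I_mul_I
    linear_combination (((deriv (deriv F) (hermNorm (z + h) ^ 2) : ℝ) : ℂ) * ((z j + h j).im : ℂ) ^ 2) * this
  · simp only [if_neg hjl, if_neg (Ne.symm hjl), Complex.one_re, Complex.one_im, Complex.I_re,
      Complex.I_im, Complex.zero_re, Complex.zero_im]
    push_cast
    have := Complex.I_mul_I
    linear_combination (((deriv (deriv F) (hermNorm (z + h) ^ 2) : ℝ) : ℂ) * ((z j + h j).im : ℂ) * ((z l + h l).im : ℂ)) * this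

/-- The Levi determinant of `F (‖z‖²)` as a function of `t = ‖z‖²`. -/
noncomputable def radialDet (n : ℕ) (F : ℝ → ℝ) (t : ℝ) : ℝ :=
  deriv F t ^ (n - 1) * (deriv F t + t * deriv (deriv F) t)

lemma det_leviMatrix_radial (hn : 1 ≤ n) {F : ℝ → ℝ} {h z : Fin n → ℂ}
    (hF : ContDiffAt ℝ 2 F (hermNorm (z + h) ^ 2)) (h0 : deriv F (hermNorm (z + h) ^ 2) ≠ 0) :
    (leviMatrix (fun z => F (hermNorm (z + h) ^ 2)) z).det =
      ((radialDet n F (hermNorm (z + h) ^ 2) : ℝ) : ℂ) := by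
  rw [leviMatrix_radial hF]
  set t := hermNorm (z + h) ^ 2 with ht
  have hc : ((deriv F t : ℝ) : ℂ) ≠ 0 := by exact_mod_cast h0
  have e1 : ((deriv F t : ℝ) : ℂ) • (1 : Matrix (Fin n) (Fin n) ℂ) +
      ((deriv (deriv F) t : ℝ) : ℂ) •
        Matrix.vecMulVec (fun j => (starRingEnd ℂ) (z j + h j)) (fun l => z l + h l)
      = ((deriv F t : ℝ) : ℂ) • (1 + Matrix.vecMulVec
        (fun j => ((deriv (deriv F) t : ℝ) : ℂ) / ((deriv F t : ℝ) : ℂ) * (starRingEnd ℂ) (z j + h j))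
        (fun l => z l + h l)) := by
    ext j l
    simp only [Matrix.add_apply, Matrix.smul_apply, Matrix.vecMulVec_apply, smul_eq_mul]
    field_simp
  rw [e1, Matrix.det_smul, Matrix.vecMulVec_eq Unit, Matrix.det_one_add_replicateCol_mul_replicateRow]
  have e2 : (fun l => z l + h l) ⬝ᵥ (fun j => ((deriv (deriv F) t : ℝ) : ℂ) / ((deriv F t : ℝ) : ℂ)
      * (starRingEnd ℂ) (z j + h j)) = ((deriv (deriv F) t : ℝ) : ℂ) / ((deriv F t : ℝ) : ℂ) * t := by
    rw [ht, hermNorm_sq]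
    push_cast
    simp only [dotProduct, Finset.mul_sum]
    refine Finset.sum_congr rfl fun j _ => ?_
    rw [← Complex.ofReal_pow, ← Complex.normSq_eq_norm_sq, ← Complex.mul_conj]
    simp only [Pi.add_apply]
    ring
  rw [e2, Fintype.card_fin, radialDet]
  obtain ⟨m, rfl⟩ : ∃ m, n = m + 1 := ⟨n - 1, by omega⟩
  push_cast
  field_simp
  rw [pow_succ]
  ring

end radial

/-! ### Monge–Ampère densities of the radial profiles -/

lemma hasDerivAt_fsProfile {t : ℝ} (ht : 0 ≤ t) :
    HasDerivAt (fun t => Real.log (1 + t) / 2) (1 / (2 * (1 + t))) t := by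
  have := (((hasDerivAt_id t).const_add 1).log (by simp; linarith)).div_const 2
  refine this.congr_deriv ?_
  simp; ring

lemma contDiffAt_fsProfile {t : ℝ} (ht : 0 ≤ t) :
    ContDiffAt ℝ ∞ (fun t => Real.log (1 + t) / 2) t :=
  ((contDiffAt_const.add contDiffAt_id).log (by simp; linarith)).div_const 2

lemma radialDet_fsProfile {n : ℕ} (hn : 1 ≤ n) {t : ℝ} (ht : 0 ≤ t) :
    radialDet n (fun t => Real.log (1 + t) / 2) t = (1 / 2) ^ n / (1 + t) ^ (n + 1) := by
  have h1 : ∀ s, -1 < s → HasDerivAt (fun t => Real.log (1 + t) / 2) (1 / (2 * (1 + s))) s := by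
    intro s hs
    have := (((hasDerivAt_id s).const_add 1).log (by simp; linarith)).div_const 2
    refine this.congr_deriv ?_
    simp; ring
  have h2 : deriv (fun t => Real.log (1 + t) / 2) =ᶠ[𝓝 t] fun s => 1 / (2 * (1 + s)) := by
    filter_upwards [lt_mem_nhds (show -1 < t by linarith)] with s hs
    exact (h1 s hs).deriv
  have h3 : HasDerivAt (fun s : ℝ => 1 / (2 * (1 + s))) (-1 / (2 * (1 + t) ^ 2)) t := by
    have := (((hasDerivAt_id t).const_add 1).const_mul 2).inv (by simp; linarith)
    simp only [one_div]
    refine this.congr_deriv ?_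
    have : 1 + t ≠ 0 := by linarith
    simp
    field_simp
  have ht1 : 1 + t ≠ 0 := by linarith
  rw [radialDet, h2.eq_of_nhds, h2.deriv_eq, h3.deriv]
  obtain ⟨m, rfl⟩ : ∃ m, n = m + 1 := ⟨n - 1, by omega⟩
  simp only [Nat.add_sub_cancel]
  have e : 1 / (2 * (1 + t)) + t * (-1 / (2 * (1 + t) ^ 2)) = 1 / (2 * (1 + t) ^ 2) := by
    field_simp; ring
  rw [e, div_pow, div_pow, mul_pow]
  field_simp
  ring

lemma fsDensity_eq {n : ℕ} (hn : 1 ≤ n) (z : Fin n → ℂ) :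
    fsDensity z = (n.factorial : ℝ) * (2 / Real.pi) ^ n *
      ((1 / 2) ^ n / (1 + hermNorm z ^ 2) ^ (n + 1)) := by
  have h0 : (fsPotential : (Fin n → ℂ) → ℝ) =
      fun z => (fun t => Real.log (1 + t) / 2) (hermNorm (z + 0) ^ 2) := by
    funext z; simp [fsPotential]
  have ht : 0 ≤ hermNorm (z + 0) ^ 2 := by positivity
  rw [fsDensity, h0, det_leviMatrix_radial hn ((contDiffAt_fsProfile ht).of_le
    (WithTop.coe_le_coe.2 le_top)) (by rw [(hasDerivAt_fsProfile ht).deriv]; positivity),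
    Complex.ofReal_re, radialDet_fsProfile hn ht, add_zero]

lemma fsDensity_pos {n : ℕ} (hn : 1 ≤ n) (z : Fin n → ℂ) : 0 < fsDensity z := by
  rw [fsDensity_eq hn]
  have := Real.pi_pos
  positivity

lemma continuous_hermNorm {n : ℕ} : Continuous (hermNorm : (Fin n → ℂ) → ℝ) := by
  unfold hermNorm; fun_prop

lemma contDiff_fsDensity {n : ℕ} (hn : 1 ≤ n) :
    ContDiff ℝ ∞ (fsDensity : (Fin n → ℂ) → ℝ) := by
  rw [funext (fsDensity_eq hn)]
  have := contDiff_hermNorm_sq (0 : Fin n → ℂ) (k := ∞)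
  simp only [add_zero] at this
  refine contDiff_const.mul (contDiff_const.div ((contDiff_const.add this).pow _) fun z => ?_)
  positivity

namespace IsProfile

variable {α B D : ℝ} {χ : ℝ → ℝ}

lemma hasDerivAt_radialProfile (h : IsProfile α B D χ) {t : ℝ} (ht : 0 < t) :
    HasDerivAt (radialProfile χ) (deriv χ (Real.log t / 2) / (2 * t)) t := by
  have h1 : HasDerivAt (fun t => χ (Real.log t / 2)) (deriv χ (Real.log t / 2) * (t⁻¹ / 2)) t :=
    (h.differentiable _).hasDerivAt.comp t ((Real.hasDerivAt_log ht.ne').div_const 2)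
  refine (h1.congr_of_eventuallyEq ?_).congr_deriv (by field_simp)
  filter_upwards [lt_mem_nhds ht] with s hs
  rw [radialProfile, if_neg (not_le.2 hs)]

lemma hasDerivAt_mul_deriv_radialProfile (h : IsProfile α B D χ) {t : ℝ} (ht : 0 < t) :
    HasDerivAt (fun t => t * deriv (radialProfile χ) t)
      (deriv (deriv χ) (Real.log t / 2) / (4 * t)) t := by
  have hd : Differentiable ℝ (deriv χ) := by
    have := (contDiff_infty_iff_deriv.1 h.smooth).2
    exact this.differentiable (by simp)
  have h1 : HasDerivAt (fun t => deriv χ (Real.log t / 2) / 2)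
      (deriv (deriv χ) (Real.log t / 2) * (t⁻¹ / 2) / 2) t :=
    ((hd _).hasDerivAt.comp t ((Real.hasDerivAt_log ht.ne').div_const 2)).div_const 2
  refine (h1.congr_of_eventuallyEq ?_).congr_deriv (by field_simp; ring)
  filter_upwards [lt_mem_nhds ht] with s hs
  rw [(h.hasDerivAt_radialProfile hs).deriv]
  field_simp

lemma deriv_radialProfile_pos (h : IsProfile α B D χ) {t : ℝ} (ht : 0 < t) :
    0 < deriv (radialProfile χ) t := by
  rw [(h.hasDerivAt_radialProfile ht).deriv]
  have := h.pos (Real.log t / 2)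
  positivity

lemma contDiffAt_deriv_radialProfile (h : IsProfile α B D χ) {t : ℝ} (ht : 0 < t) :
    ContDiffAt ℝ ∞ (deriv (radialProfile χ)) t :=
  contDiffAt_deriv (h.contDiffAt_radialProfile ht) (by simp)

lemma radialDet_eq_deriv (h : IsProfile α B D χ) (n : ℕ) {t : ℝ} (ht : 0 < t) :
    radialDet n (radialProfile χ) t =
      deriv (radialProfile χ) t ^ (n - 1) * deriv (fun t => t * deriv (radialProfile χ) t) t := by
  rw [radialDet, deriv_fun_mul differentiableAt_fun_id
    ((h.contDiffAt_deriv_radialProfile ht).differentiableAt (by simp))]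
  simp

lemma radialDet_eq (h : IsProfile α B D χ) (n : ℕ) {t : ℝ} (ht : 0 < t) :
    radialDet n (radialProfile χ) t = (deriv χ (Real.log t / 2) / (2 * t)) ^ (n - 1) *
      (deriv (deriv χ) (Real.log t / 2) / (4 * t)) := by
  rw [h.radialDet_eq_deriv n ht, (h.hasDerivAt_radialProfile ht).deriv,
    (h.hasDerivAt_mul_deriv_radialProfile ht).deriv]

lemma radialDet_nonneg (h : IsProfile α B D χ) (n : ℕ) {t : ℝ} (ht : 0 < t) :
    0 ≤ radialDet n (radialProfile χ) t := by
  rw [h.radialDet_eq n ht]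
  have h1 := h.pos (Real.log t / 2)
  have h2 : 0 ≤ deriv (deriv χ) (Real.log t / 2) := h.mono.deriv_nonneg
  positivity

lemma contDiffAt_radialDet (h : IsProfile α B D χ) (n : ℕ) {t : ℝ} (ht : 0 < t) :
    ContDiffAt ℝ ∞ (radialDet n (radialProfile χ)) t := by
  have h1 := h.contDiffAt_deriv_radialProfile ht
  have h2 : ContDiffAt ℝ ∞ (deriv (deriv (radialProfile χ))) t := contDiffAt_deriv h1 (by simp)
  exact (h1.pow _).mul (h1.add (contDiffAt_id.mul h2))

lemma radialDet_eq_zero (h : IsProfile α B D χ) (n : ℕ) {t : ℝ} (ht : 4 < t) :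
    radialDet n (radialProfile χ) t = 0 := by
  have h1 : (fun t => t * deriv (radialProfile χ) t) =ᶠ[𝓝 t] fun _ => 1 / 2 := by
    filter_upwards [lt_mem_nhds ht] with s hs
    have : radialProfile χ =ᶠ[𝓝 s] fun t => Real.log t / 2 + D := by
      filter_upwards [lt_mem_nhds hs] with r hr
      exact h.radialProfile_eq_outer (le_of_lt hr)
    have hs0 : s ≠ 0 := by linarith
    rw [this.deriv_eq, (((Real.hasDerivAt_log hs0).div_const 2).add_const D).deriv]
    field_simp
  rw [h.radialDet_eq_deriv n (by linarith), h1.deriv_eq]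
  simp

/-- Close to the origin the density is a constant multiple of `‖z‖ ^ (-2n(1-α))`. -/
lemma radialDet_eq_rpow (h : IsProfile α B D χ) (hα : 0 < α) {n : ℕ} (hn : 1 ≤ n) {t : ℝ}
    (ht : 0 < t) (ht1 : t < 1) :
    radialDet n (radialProfile χ) t = α ^ (n + 1) * B ^ n * t ^ (-((1 - α) * n)) := by
  have e : ∀ s, 0 < s → s < 1 → radialProfile χ =ᶠ[𝓝 s] fun t => B * t ^ α := by
    intro s h0 h1
    filter_upwards [lt_mem_nhds h0, gt_mem_nhds h1] with r hr0 hr1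
    exact h.radialProfile_eq_inner hα (le_of_lt hr0) (le_of_lt hr1)
  have d : ∀ s, 0 < s → s < 1 → deriv (radialProfile χ) s = B * (α * s ^ (α - 1)) := by
    intro s h0 h1
    rw [(e s h0 h1).deriv_eq, ((Real.hasDerivAt_rpow_const (Or.inl h0.ne')).const_mul B).deriv]
  have d2 : deriv (fun t => t * deriv (radialProfile χ) t) t = B * (α * (α * t ^ (α - 1))) := by
    have : (fun t => t * deriv (radialProfile χ) t) =ᶠ[𝓝 t] fun t => B * (α * t ^ α) := by
      filter_upwards [lt_mem_nhds ht, gt_mem_nhds ht1] with r hr0 hr1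
      rw [d r hr0 hr1, Real.rpow_sub_one (ne_of_gt hr0)]
      have : r ≠ 0 := ne_of_gt hr0
      field_simp
    rw [this.deriv_eq,
      (((Real.hasDerivAt_rpow_const (Or.inl ht.ne')).const_mul α).const_mul B).deriv]
  rw [h.radialDet_eq_deriv n ht, d t ht ht1, d2]
  obtain ⟨m, rfl⟩ : ∃ m, n = m + 1 := ⟨n - 1, by omega⟩
  have : t ^ (-((1 - α) * ((m + 1 : ℕ) : ℝ))) = (t ^ (α - 1)) ^ (m + 1) := by
    rw [← Real.rpow_natCast, ← Real.rpow_mul ht.le]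
    ring_nf
  rw [this, Nat.add_sub_cancel]
  ring

end IsProfile

/-! ### Functions on projective space -/

section charts

variable {n : ℕ}

/-- The homogeneous coordinates of the point with the affine coordinates `z` in the chart `i`. -/
def chartVec (i : Fin (n + 1)) (z : Fin n → ℂ) : Fin (n + 1) → ℂ :=
  i.insertNth (α := fun _ => ℂ) 1 z

@[simp] lemma chartVec_self (i : Fin (n + 1)) (z : Fin n → ℂ) : chartVec i z i = 1 := by
  simp [chartVec]

@[simp] lemma chartVec_succAbove (i : Fin (n + 1)) (z : Fin n → ℂ) (j : Fin n) :
    chartVec i z (i.succAbove j) = z j := by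
  simp [chartVec]

lemma chartVec_ne_zero (i : Fin (n + 1)) (z : Fin n → ℂ) : chartVec i z ≠ 0 := fun h => by
  have := congrFun h i
  simp at this

lemma affineChart_eq (i : Fin (n + 1)) (z : Fin n → ℂ) :
    affineChart i z = Projectivization.mk ℂ (chartVec i z) (chartVec_ne_zero i z) := rfl

lemma contDiff_chartVec {𝕜 : Type*} [NontriviallyNormedField 𝕜] [NormedAlgebra 𝕜 ℂ]
    (i k : Fin (n + 1)) {m : WithTop ℕ∞} : ContDiff 𝕜 m (fun z => chartVec i z k) := by
  rcases Fin.eq_self_or_eq_succAbove i k with rfl | ⟨j, rfl⟩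
  · simpa using contDiff_const
  · simpa using contDiff_apply 𝕜 ℂ j

lemma continuous_chartVec (i : Fin (n + 1)) : Continuous (chartVec (n := n) i) :=
  continuous_pi fun k => (contDiff_chartVec (𝕜 := ℂ) i k (m := 0)).continuous

lemma hermNorm_chartVec_sq (i : Fin (n + 1)) (z : Fin n → ℂ) :
    hermNorm (chartVec i z) ^ 2 = 1 + hermNorm z ^ 2 := by
  rw [hermNorm_sq, hermNorm_sq, Fin.sum_univ_succAbove _ i]
  simp

lemma chartVec_add_smul (i : Fin (n + 1)) (a b : Fin n → ℂ) (ζ : ℂ) :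
    chartVec i (a + ζ • b) = chartVec i a + ζ • i.insertNth (α := fun _ => ℂ) 0 b := by
  funext k
  rcases Fin.eq_self_or_eq_succAbove i k with rfl | ⟨j, rfl⟩ <;> simp

lemma shiftSq_chartVec_zero (h z : Fin n → ℂ) : shiftSq h (chartVec 0 z) = hermNorm (z + h) ^ 2 := by
  rw [shiftSq, hermNorm_sq]
  refine Finset.sum_congr rfl fun j _ => ?_
  have h1 : chartVec 0 z j.succ = z j := by
    rw [← Fin.succAbove_zero]; exact chartVec_succAbove 0 z j
  rw [h1, chartVec_self]
  simp

lemma hermNorm_sq_pos {m : ℕ} {w : Fin m → ℂ} (hw : w ≠ 0) : 0 < hermNorm w ^ 2 := by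
  rw [hermNorm_sq]
  refine lt_of_le_of_ne (Finset.sum_nonneg fun _ _ => by positivity) fun h => hw ?_
  have := (Finset.sum_eq_zero_iff_of_nonneg fun _ _ => by positivity).1 h.symm
  funext k
  simpa using this k (Finset.mem_univ k)

lemma hermNorm_smul_sq {m : ℕ} (t : ℂ) (w : Fin m → ℂ) :
    hermNorm (t • w) ^ 2 = ‖t‖ ^ 2 * hermNorm w ^ 2 := by
  simp [hermNorm_sq, Finset.mul_sum, mul_pow]

lemma shiftSq_smul (h : Fin n → ℂ) (t : ℂ) (w : Fin (n + 1) → ℂ) :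
    shiftSq h (t • w) = ‖t‖ ^ 2 * shiftSq h w := by
  simp only [shiftSq, Finset.mul_sum, Pi.smul_apply, smul_eq_mul, ← mul_pow, ← norm_mul]
  refine Finset.sum_congr rfl fun j _ => ?_
  ring_nf

/-- The function `‖w' + w₀ h‖² / ‖w‖²` of the point `[w₀ : w']`. -/
noncomputable def cpShift (h : Fin n → ℂ) : CP n → ℝ :=
  Projectivization.lift (fun w => shiftSq h w.1 / hermNorm w.1 ^ 2) (by
    rintro ⟨a, ha⟩ ⟨b, hb⟩ t (rfl : a = t • b)
    have ht : t ≠ 0 := fun h0 => ha (by simp [h0])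
    have h1 : ‖t‖ ^ 2 ≠ 0 := by positivity
    simp only [shiftSq_smul, hermNorm_smul_sq]
    rw [mul_div_mul_left _ _ h1])

/-- The function `|w₀|² / ‖w‖²` of the point `[w₀ : w']`. -/
noncomputable def cpHeight : CP n → ℝ :=
  Projectivization.lift (fun w => ‖w.1 0‖ ^ 2 / hermNorm w.1 ^ 2) (by
    rintro ⟨a, ha⟩ ⟨b, hb⟩ t (rfl : a = t • b)
    have ht : t ≠ 0 := fun h0 => ha (by simp [h0])
    have h1 : ‖t‖ ^ 2 ≠ 0 := by positivity
    simp only [Pi.smul_apply, smul_eq_mul, norm_mul, mul_pow, hermNorm_smul_sq]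
    rw [mul_div_mul_left _ _ h1])

lemma cpShift_mk (h : Fin n → ℂ) {w : Fin (n + 1) → ℂ} (hw : w ≠ 0) :
    cpShift h (Projectivization.mk ℂ w hw) = shiftSq h w / hermNorm w ^ 2 := rfl

lemma cpHeight_mk {w : Fin (n + 1) → ℂ} (hw : w ≠ 0) :
    cpHeight (Projectivization.mk ℂ w hw) = ‖w 0‖ ^ 2 / hermNorm w ^ 2 := rfl

lemma continuous_cp {Y : Type*} [TopologicalSpace Y] {f : CP n → Y} :
    Continuous f ↔ Continuous fun w : {w : Fin (n + 1) → ℂ // w ≠ 0} => f (Projectivization.mk' ℂ w) :=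
  continuous_coinduced_dom

lemma continuous_cpShift (h : Fin n → ℂ) : Continuous (cpShift h) :=
  continuous_cp.2 (((continuous_shiftSq h).comp continuous_subtype_val).div
    ((continuous_hermNorm.comp continuous_subtype_val).pow 2)
    fun w => (hermNorm_sq_pos w.2).ne')

lemma continuous_cpHeight : Continuous (cpHeight (n := n)) :=
  continuous_cp.2 ((((continuous_apply 0).comp continuous_subtype_val).norm.pow 2).div
    ((continuous_hermNorm.comp continuous_subtype_val).pow 2)
    fun w => (hermNorm_sq_pos w.2).ne')

lemma cpShift_nonneg (h : Fin n → ℂ) (x : CP n) : 0 ≤ cpShift h x := by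
  induction x using Projectivization.ind with
  | h w hw => exact div_nonneg (shiftSq_nonneg h w) (by positivity)

lemma cpHeight_nonneg (x : CP n) : 0 ≤ cpHeight x := by
  induction x using Projectivization.ind with
  | h w hw => rw [cpHeight_mk]; positivity

lemma cpShift_pos_or (h : Fin n → ℂ) (x : CP n) : 0 < cpShift h x ∨ 0 < cpHeight x := by
  induction x using Projectivization.ind with
  | h w hw =>
    have h1 := hermNorm_sq_pos hw
    rw [cpShift_mk, cpHeight_mk]
    exact (shiftSq_pos_or h hw).imp (fun h2 => div_pos h2 h1) (fun h2 => div_pos h2 h1)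

lemma continuous_affineChart (i : Fin (n + 1)) : Continuous (affineChart (n := n) i) :=
  (continuous_coinduced_rng (f := Projectivization.mk' ℂ (V := Fin (n + 1) → ℂ))).comp
    ((continuous_chartVec i).subtype_mk (chartVec_ne_zero i))

instance : CompactSpace (CP n) := by
  have hr : Set.range (fun w : Metric.sphere (0 : Fin (n + 1) → ℂ) 1 =>
      (Projectivization.mk ℂ w.1 (fun h => by have := w.2; simp [h] at this) : CP n)) = Set.univ := by
    refine Set.eq_univ_of_forall fun x => ?_
    induction x using Projectivization.ind with
    | h w hw =>
      have hw' : ‖w‖ ≠ 0 := norm_ne_zero_iff.2 hw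
      refine ⟨⟨((‖w‖⁻¹ : ℝ) : ℂ) • w, by simp [norm_smul, hw']⟩, ?_⟩
      rw [Projectivization.mk_eq_mk_iff']
      exact ⟨_, rfl⟩
  have hc : Continuous (fun w : Metric.sphere (0 : Fin (n + 1) → ℂ) 1 =>
      (Projectivization.mk ℂ w.1 (fun h => by have := w.2; simp [h] at this) : CP n)) :=
    (continuous_coinduced_rng (f := Projectivization.mk' ℂ (V := Fin (n + 1) → ℂ))).comp
      (continuous_subtype_val.subtype_mk _)
  exact ⟨hr ▸ isCompact_range hc⟩

/-- The point `[w]` with `w₀ ≠ 0` lies in the chart `0`. -/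
lemma mk_eq_affineChart_zero {w : Fin (n + 1) → ℂ} (hw : w ≠ 0) (h0 : w 0 ≠ 0) :
    Projectivization.mk ℂ w hw = affineChart 0 (fun j => w j.succ / w 0) := by
  rw [affineChart_eq, Projectivization.mk_eq_mk_iff']
  refine ⟨w 0, ?_⟩
  funext k
  refine Fin.cases ?_ (fun j => ?_) k
  · simp
  · have : chartVec 0 (fun j => w j.succ / w 0) j.succ = w j.succ / w 0 := by
      rw [← Fin.succAbove_zero]; exact chartVec_succAbove 0 _ j
    simp only [Pi.smul_apply, this, smul_eq_mul]
    field_simp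

/-! ### The translated potentials and their densities -/

/-- The translated model potential on `ℙⁿ`. -/
noncomputable def cpPotential (χ : ℝ → ℝ) (D : ℝ) (h : Fin n → ℂ) (x : CP n) : ℝ :=
  homPot χ D (cpShift h x) (cpHeight x)

/-- The density of its Monge–Ampère measure with respect to `ωⁿ`. -/
noncomputable def cpDensity (χ : ℝ → ℝ) (h : Fin n → ℂ) (x : CP n) : ℝ :=
  2 ^ n * (radialDet n (radialProfile χ) (cpShift h x / cpHeight x) / cpHeight x ^ (n + 1))

lemma cpPotential_affineChart (χ : ℝ → ℝ) (D : ℝ) (h : Fin n → ℂ) (i : Fin (n + 1))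
    (z : Fin n → ℂ) : cpPotential χ D h (affineChart i z) + fsPotential z =
      homPot χ D (shiftSq h (chartVec i z)) (‖chartVec i z 0‖ ^ 2) := by
  have hN : 0 < 1 + hermNorm z ^ 2 := by positivity
  rw [cpPotential, affineChart_eq, cpShift_mk, cpHeight_mk, hermNorm_chartVec_sq, div_eq_inv_mul,
    div_eq_inv_mul, homPot_mul (inv_pos.2 hN) (shiftSq_pos_or h (chartVec_ne_zero i z)),
    Real.log_inv, fsPotential]
  ring

variable {α B D : ℝ} {χ : ℝ → ℝ}

lemma IsProfile.continuous_cpPotential (hχ : IsProfile α B D χ) (hα : 0 < α) (h : Fin n → ℂ) :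
    Continuous (cpPotential χ D h) := by
  rw [continuous_iff_continuousAt]
  intro x
  exact (hχ.continuousAt_homPot hα (p := (cpShift h x, cpHeight x)) (cpShift_pos_or h x)).comp
    (f := fun x => (cpShift h x, cpHeight x))
    ((continuous_cpShift h).prodMk continuous_cpHeight).continuousAt

lemma IsProfile.isBoundedOmegaPSH (hχ : IsProfile α B D χ) (hα : 0 < α) (hB : 0 < B)
    (h : Fin n → ℂ) (c : ℝ) : IsBoundedOmegaPSH (fun x => cpPotential χ D h x + c) := by
  have hc : Continuous (fun x => cpPotential χ D h x + c) :=
    (hχ.continuous_cpPotential hα h).add continuous_const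
  refine ⟨?_, fun i => ?_⟩
  · obtain ⟨M, hM⟩ := (isCompact_range hc.abs).bddAbove
    exact ⟨M, fun x => hM ⟨x, rfl⟩⟩
  · have hu : Continuous fun z => cpPotential χ D h (affineChart i z) + c + fsPotential z := by
      refine (hc.comp (continuous_affineChart i)).add ?_
      have : Continuous fun z : Fin n → ℂ => 1 + hermNorm z ^ 2 :=
        continuous_const.add (continuous_hermNorm.pow 2)
      exact (this.log fun z => by positivity).div_const 2
    have hci : ∀ a b : Fin n → ℂ, CircleIntegrable (fun ζ : ℂ =>
        cpPotential χ D h (affineChart i (a + ζ • b)) + c + fsPotential (a + ζ • b)) 0 1 :=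
      fun a b => (hu.comp (by fun_prop : Continuous fun ζ : ℂ => a + ζ • b)).continuousOn.circleIntegrable'
    refine ⟨hu.upperSemicontinuous, hci, fun a b => ?_⟩
    have e : ∀ z, cpPotential χ D h (affineChart i z) + c + fsPotential z =
        homPot χ D (shiftSq h (chartVec i z)) (‖chartVec i z 0‖ ^ 2) + c := fun z => by
      rw [← cpPotential_affineChart]; ring
    simp only [e] at hci ⊢
    have hmean := hχ.homPot_le_circleAverage hα hB h (w := chartVec i a)
      (v := i.insertNth (α := fun _ => ℂ) 0 b)
      (fun ζ => by rw [← chartVec_add_smul]; exact chartVec_ne_zero i _)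
    simp only [← chartVec_add_smul] at hmean
    have hci' : CircleIntegrable (fun ζ : ℂ => homPot χ D (shiftSq h (chartVec i (a + ζ • b)))
        (‖chartVec i (a + ζ • b) 0‖ ^ 2)) 0 1 := by
      have := (hci a b).sub (circleIntegrable_const c 0 1)
      refine this.congr (fun ζ _ => ?_)
      simp
    rw [Real.circleAverage_fun_add hci' (circleIntegrable_const c 0 1), Real.circleAverage_const]
    linarith

lemma IsProfile.measurable_cpDensity (hχ : IsProfile α B D χ) (h : Fin n → ℂ) :
    Measurable (cpDensity χ h) := by
  have h1 : Measurable (radialProfile χ) := by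
    unfold radialProfile
    refine Measurable.ite measurableSet_Iic measurable_const ?_
    exact hχ.smooth.continuous.measurable.comp (Real.measurable_log.div_const 2)
  have h2 : Measurable (radialDet n (radialProfile χ)) :=
    ((measurable_deriv _).pow_const _).mul
      ((measurable_deriv _).add (measurable_id.mul (measurable_deriv _)))
  have h3 := (continuous_cpShift h).measurable
  have h4 := (continuous_cpHeight (n := n)).measurable
  unfold cpDensity
  exact ((h2.comp (h3.div h4)).div (h4.pow_const _)).const_mul _

lemma IsProfile.cpDensity_nonneg (hχ : IsProfile α B D χ) (hB : 0 < B) (h : Fin n → ℂ)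
    (x : CP n) : 0 ≤ cpDensity χ h x := by
  have h1 : ∀ t, 0 ≤ t → 0 ≤ radialDet n (radialProfile χ) t := by
    intro t ht
    rcases ht.eq_or_lt with rfl | ht
    · have := (hχ.radialProfile_mono hB).deriv_nonneg (x := 0)
      rw [radialDet, zero_mul, add_zero]
      positivity
    · exact hχ.radialDet_nonneg n ht
  have h2 := cpHeight_nonneg x
  have h3 := h1 _ (div_nonneg (cpShift_nonneg h x) h2)
  unfold cpDensity
  positivity

/-- The affine coordinates, in the chart `0`, of the point with coordinates `z` in the chart `i`. -/
noncomputable def toChartZero (i : Fin (n + 1)) (z : Fin n → ℂ) : Fin n → ℂ :=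
  fun j => chartVec i z j.succ / chartVec i z 0

lemma shiftSq_div (h : Fin n → ℂ) {i : Fin (n + 1)} {z : Fin n → ℂ} (hz : chartVec i z 0 ≠ 0) :
    shiftSq h (chartVec i z) / ‖chartVec i z 0‖ ^ 2 = hermNorm (toChartZero i z + h) ^ 2 := by
  rw [hermNorm_sq, shiftSq, Finset.sum_div]
  refine Finset.sum_congr rfl fun j _ => ?_
  rw [← div_pow, ← norm_div]
  congr 2
  simp only [toChartZero, Pi.add_apply]
  field_simp

lemma one_add_hermNorm_toChartZero {i : Fin (n + 1)} {z : Fin n → ℂ} (hz : chartVec i z 0 ≠ 0) :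
    (1 + hermNorm z ^ 2) = ‖chartVec i z 0‖ ^ 2 * (1 + hermNorm (toChartZero i z) ^ 2) := by
  rw [← hermNorm_chartVec_sq i, hermNorm_sq, hermNorm_sq, Fin.sum_univ_succ, mul_add, mul_one,
    Finset.mul_sum]
  congr 1
  refine Finset.sum_congr rfl fun j _ => ?_
  rw [toChartZero, ← mul_pow, ← norm_mul]
  congr 2
  field_simp

/-- In every chart, the Levi determinant of the potential is the density with respect to `ωⁿ`
times the Levi determinant of the Fubini–Study potential. Both determinants change by the same
Jacobian factor when one passes to the chart `0`. -/
lemma IsProfile.det_leviMatrix_homPot (hχ : IsProfile α B D χ) (hn : 1 ≤ n) (h : Fin n → ℂ)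
    (i : Fin (n + 1)) {z : Fin n → ℂ} (hz : chartVec i z 0 ≠ 0)
    (hs : 0 < shiftSq h (chartVec i z)) :
    (n.factorial : ℂ) * ((2 / Real.pi : ℝ) : ℂ) ^ n * (leviMatrix (fun z =>
      homPot χ D (shiftSq h (chartVec i z)) (‖chartVec i z 0‖ ^ 2)) z).det =
      ((cpDensity χ h (affineChart i z) * fsDensity z : ℝ) : ℂ) := by
  have hg : ContDiffAt ℂ 2 (toChartZero i) z := by
    rw [contDiffAt_pi]
    exact fun j => (contDiff_chartVec i j.succ).contDiffAt.div (contDiff_chartVec i 0).contDiffAt hz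
  have hG : ContDiffAt ℂ 2 (fun z => chartVec i z 0) z := (contDiff_chartVec i 0).contDiffAt
  have hev : ∀ᶠ y in 𝓝 z, chartVec i y 0 ≠ 0 := hG.continuousAt.eventually_ne hz
  have ht : 0 < hermNorm (toChartZero i z + h) ^ 2 := by
    rw [← shiftSq_div h hz]
    have := norm_pos_iff.2 hz
    positivity
  have hF := (hχ.contDiffAt_radialProfile ht).of_le
    (WithTop.coe_le_coe.2 le_top : (2 : WithTop ℕ∞) ≤ ∞)
  have d1 := det_leviMatrix_comp (v := fun z =>
      homPot χ D (shiftSq h (chartVec i z)) (‖chartVec i z 0‖ ^ 2)) hg hG hz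
    (u := fun ζ => radialProfile χ (hermNorm (ζ + h) ^ 2))
    (hF.comp (f := fun ζ => hermNorm (ζ + h) ^ 2) _ (contDiff_hermNorm_sq h).contDiffAt) (by
      filter_upwards [hev] with y hy
      have hy' := norm_pos_iff.2 hy
      rw [homPot, if_pos (by positivity), shiftSq_div h hy, Real.log_pow]
      push_cast; ring)
  rw [det_leviMatrix_radial hn hF (hχ.deriv_radialProfile_pos ht).ne'] at d1
  have ht0 : 0 ≤ hermNorm (toChartZero i z + 0) ^ 2 := by positivity
  have hF0 := (contDiffAt_fsProfile ht0).of_le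
    (WithTop.coe_le_coe.2 le_top : (2 : WithTop ℕ∞) ≤ ∞)
  have d2 := det_leviMatrix_comp (v := fsPotential) hg hG hz
    (u := fun ζ => (fun t => Real.log (1 + t) / 2) (hermNorm (ζ + 0) ^ 2))
    (hF0.comp (f := fun ζ => hermNorm (ζ + 0) ^ 2) _
      (contDiff_hermNorm_sq 0).contDiffAt) (by
      filter_upwards [hev] with y hy
      have hy' := norm_pos_iff.2 hy
      rw [fsPotential, one_add_hermNorm_toChartZero hy, Real.log_mul (by positivity)
        (by positivity), Real.log_pow, add_zero]
      push_cast; ring)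
  rw [det_leviMatrix_radial hn hF0 (by rw [(hasDerivAt_fsProfile ht0).deriv]; positivity),
    radialDet_fsProfile hn ht0, add_zero, ← Complex.ofReal_mul] at d2
  have hw := norm_pos_iff.2 hz
  have hN : 0 < 1 + hermNorm (toChartZero i z) ^ 2 := by positivity
  have e1 : cpShift h (affineChart i z) / cpHeight (affineChart i z)
      = hermNorm (toChartZero i z + h) ^ 2 := by
    rw [affineChart_eq, cpShift_mk, cpHeight_mk, div_div_div_cancel_right₀
      (hermNorm_sq_pos (chartVec_ne_zero i z)).ne', shiftSq_div h hz]
  have e2 : cpHeight (affineChart i z) = 1 / (1 + hermNorm (toChartZero i z) ^ 2) := by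
    rw [affineChart_eq, cpHeight_mk, hermNorm_chartVec_sq, one_add_hermNorm_toChartZero hz]
    field_simp
  rw [d1, fsDensity, d2, cpDensity, e1, e2, Complex.ofReal_re]
  push_cast
  have hN' : (1 + (hermNorm (toChartZero i z) : ℂ) ^ 2) ≠ 0 := by exact_mod_cast hN.ne'
  rw [one_div_pow, one_div_pow]
  field_simp

end charts

/-! ### Second derivatives -/

section secondDerivative

variable {E : Type*} [NormedAddCommGroup E]

lemma norm_leviForm_le [NormedSpace ℂ E] (Q : E →L[ℝ] E →L[ℝ] ℝ) (v w : E) :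
    ‖leviForm Q v w‖ ≤ ‖Q‖ * ‖v‖ * ‖w‖ := by
  have hI : ∀ x : E, ‖Complex.I • x‖ = ‖x‖ := fun x => by simp [norm_smul]
  have h1 : ∀ x y : E, ‖Q x y‖ ≤ ‖Q‖ * ‖x‖ * ‖y‖ := fun x y => Q.le_opNorm₂ x y
  have a1 := h1 v w
  have a2 := h1 (Complex.I • v) (Complex.I • w)
  have a3 := h1 v (Complex.I • w)
  have a4 := h1 (Complex.I • v) w
  rw [hI] at a2 a3 a4
  rw [hI] at a2
  have b1 := norm_add_le (Q v w) (Q (Complex.I • v) (Complex.I • w))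
  have b2 := norm_sub_le (Q v (Complex.I • w)) (Q (Complex.I • v) w)
  rw [leviForm, norm_div]
  have b3 := norm_add_le (((Q v w + Q (Complex.I • v) (Complex.I • w) : ℝ) : ℂ))
    (Complex.I * ((Q v (Complex.I • w) - Q (Complex.I • v) w : ℝ) : ℂ))
  rw [norm_mul, Complex.norm_I, one_mul, Complex.norm_real, Complex.norm_real] at b3
  rw [show ‖(4 : ℂ)‖ = 4 by norm_num, div_le_iff₀ (by norm_num)]
  linarith

lemma continuous_leviForm [NormedSpace ℂ E] (v w : E) :
    Continuous fun Q : E →L[ℝ] E →L[ℝ] ℝ => leviForm Q v w := by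
  unfold leviForm
  fun_prop

lemma leviMatrix_add_const {n : ℕ} (u : (Fin n → ℂ) → ℝ) (c : ℝ) (z : Fin n → ℂ) :
    leviMatrix (fun y => u y + c) z = leviMatrix u z := by
  have : fderiv ℝ (fun y => u y + c) = fderiv ℝ u := funext fun y => fderiv_add_const c
  ext j l
  simp only [leviMatrix]
  rw [this]

variable [NormedSpace ℝ E]

/-- Second derivatives in `z` of a function that is jointly smooth in a parameter and `z` are jointly
continuous. -/
lemma continuousAt_fderiv_fderiv {U : ℝ → E → ℝ} {p : ℝ × E}
    (hU : ContDiffAt ℝ ∞ (Function.uncurry U) p) :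
    ContinuousAt (fun p : ℝ × E => fderiv ℝ (fderiv ℝ (U p.1)) p.2) p := by
  have h1 : ContDiffAt ℝ 1 (fun p : ℝ × E => fderiv ℝ (U p.1) p.2) p := by
    refine ContDiffAt.fderiv (f := fun p : ℝ × E => U p.1) (g := Prod.snd) (n := 2) ?_
      contDiffAt_snd (by norm_num)
    have : ContDiffAt ℝ 2 (Function.uncurry U) ((fun q : (ℝ × E) × E => (q.1.1, q.2)) (p, p.2)) :=
      hU.of_le (WithTop.coe_le_coe.2 le_top : (2 : WithTop ℕ∞) ≤ ∞)
    exact this.comp (f := fun q : (ℝ × E) × E => (q.1.1, q.2)) (p, p.2) (by fun_prop)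
  have h2 : ContDiffAt ℝ 0 (fun p : ℝ × E => fderiv ℝ (fderiv ℝ (U p.1)) p.2) p := by
    refine ContDiffAt.fderiv (f := fun p : ℝ × E => fderiv ℝ (U p.1)) (g := Prod.snd) (n := 1) ?_
      contDiffAt_snd (by norm_num)
    exact h1.comp (f := fun q : (ℝ × E) × E => (q.1.1, q.2)) (p, p.2) (by fun_prop)
  exact h2.continuousAt

lemma norm_fderiv_fderiv_comp_le {F : ℝ → ℝ} {τ : E → ℝ} {z : E} (hF : ContDiffAt ℝ 2 F (τ z))
    (hτ : ContDiffAt ℝ 2 τ z) :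
    ‖fderiv ℝ (fderiv ℝ (fun y => F (τ y))) z‖ ≤ |deriv F (τ z)| * ‖fderiv ℝ (fderiv ℝ τ) z‖ +
      |deriv (deriv F) (τ z)| * ‖fderiv ℝ τ z‖ ^ 2 := by
  have h1 : fderiv ℝ (fun y => F (τ y)) =ᶠ[𝓝 z] fun y => deriv F (τ y) • fderiv ℝ τ y := by
    filter_upwards [hτ.continuousAt.eventually (hF.eventually (by simp)),
      hτ.eventually (by simp)] with y hy hy'
    exact ((hy.differentiableAt (by simp)).hasDerivAt.comp_hasFDerivAt y
      (hy'.differentiableAt (by simp)).hasFDerivAt).fderiv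
  have hd : HasDerivAt (deriv F) (deriv (deriv F) (τ z)) (τ z) :=
    ((contDiffAt_deriv (m := 1) hF (by norm_num)).differentiableAt (by simp)).hasDerivAt
  have h2 := HasDerivAt.comp_hasFDerivAt (f := τ) z hd
    (hτ.differentiableAt (by simp)).hasFDerivAt
  have h3 : HasFDerivAt (fderiv ℝ τ) (fderiv ℝ (fderiv ℝ τ) z) z :=
    ((hτ.fderiv_right (m := 1) (by norm_num)).differentiableAt (by simp)).hasFDerivAt
  simp only [Function.comp_def] at h2
  rw [h1.fderiv_eq, (h2.fun_smul h3).fderiv]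
  have e1 : ‖deriv F (τ z) • fderiv ℝ (fderiv ℝ τ) z‖ ≤
      |deriv F (τ z)| * ‖fderiv ℝ (fderiv ℝ τ) z‖ :=
    ContinuousLinearMap.opNorm_smul_le _ _
  have e2 : ‖(deriv (deriv F) (τ z) • fderiv ℝ τ z).smulRight (fderiv ℝ τ z)‖ =
      |deriv (deriv F) (τ z)| * ‖fderiv ℝ τ z‖ ^ 2 := by
    rw [ContinuousLinearMap.norm_smulRight_apply, norm_smul, Real.norm_eq_abs, sq, mul_assoc]
  calc _ ≤ _ := ContinuousLinearMap.opNorm_add_le _ _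
    _ ≤ _ := add_le_add e1 e2.le

end secondDerivative

/-! ### Integrability of powers of the norm -/

section integrability

variable {n : ℕ}

lemma finrank_real_complex_pi : Module.finrank ℝ (Fin n → ℂ) = 2 * n := by
  rw [Module.finrank_pi_fintype]; simp [Complex.finrank_real_complex, mul_comm]

/-- Negative powers of the norm below the real dimension `2n` are locally integrable. -/
lemma integrableOn_ball_norm_rpow (hn : 1 ≤ n) {β r : ℝ} (hβ : β < 2 * n) :
    IntegrableOn (fun z : Fin n → ℂ => ‖z‖ ^ (-β)) (Metric.ball 0 r) := by
  have : Nonempty (Fin n) := ⟨⟨0, hn⟩⟩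
  have := (integrableOn_fun_norm_addHaar (volume : Measure (Fin n → ℂ))
    (f := fun t : ℝ => t ^ (-β)) (r := r)).2 ?_
  · exact this
  · rw [finrank_real_complex_pi]
    rcases le_or_gt r 0 with hr | hr
    · simp [Set.Ioo_eq_empty (not_lt.2 hr)]
    · have h1 : IntegrableOn (fun y : ℝ => y ^ ((2 * n - 1 : ℕ) - β : ℝ)) (Set.Ioo 0 r) :=
        (intervalIntegral.integrableOn_Ioo_rpow_iff hr).2 (by
          rw [Nat.cast_sub (by omega)]; push_cast; linarith)
      refine h1.congr_fun (fun y hy => ?_) measurableSet_Ioo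
      simp only [smul_eq_mul]
      rw [Real.rpow_sub hy.1, Real.rpow_natCast, Real.rpow_neg hy.1.le, div_eq_mul_inv]

lemma locallyIntegrable_norm_sub_rpow (hn : 1 ≤ n) {β : ℝ} (hβ : β < 2 * n) (p : Fin n → ℂ) :
    LocallyIntegrable (fun z : Fin n → ℂ => ‖z - p‖ ^ (-β)) := by
  rw [locallyIntegrable_iff]
  intro K hK
  obtain ⟨r, hr⟩ := hK.isBounded.subset_ball p
  refine IntegrableOn.mono_set ?_ hr
  have h := integrableOn_ball_norm_rpow hn (r := r) hβ
  have hmp : MeasurePreserving (fun z : Fin n → ℂ => z - p) := measurePreserving_sub_right volume p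
  have h2 := (hmp.integrableOn_comp_preimage (MeasurableEquiv.subRight p).measurableEmbedding
    (f := fun z : Fin n → ℂ => ‖z‖ ^ (-β)) (s := Metric.ball 0 r)).2 h
  convert! h2 using 1
  ext z
  simp [dist_eq_norm]

end integrability

/-! ### The Monge–Ampère measure in the charts -/

section chartMongeAmpere

variable {n : ℕ} {α B D : ℝ} {χ : ℝ → ℝ}

lemma norm_apply_le_hermNorm (z : Fin n → ℂ) (j : Fin n) : ‖z j‖ ≤ hermNorm z := by
  refine Real.le_sqrt_of_sq_le ?_
  exact Finset.single_le_sum (f := fun j => ‖z j‖ ^ 2) (fun _ _ => by positivity) (Finset.mem_univ j)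

lemma norm_le_hermNorm (z : Fin n → ℂ) : ‖z‖ ≤ hermNorm z :=
  (pi_norm_le_iff_of_nonneg (hermNorm_nonneg z)).2 (norm_apply_le_hermNorm z)

lemma norm_hermForm_apply_le (v : Fin n → ℂ) : ‖hermForm n v‖ ≤ 4 * n * hermNorm v := by
  refine ContinuousLinearMap.opNorm_le_bound _ (by have := hermNorm_nonneg v; positivity)
    fun w => ?_
  rw [hermForm_apply]
  refine (norm_sum_le _ _).trans ?_
  have : ∀ j ∈ Finset.univ, ‖2 * ((v j).re * (w j).re + (v j).im * (w j).im)‖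
      ≤ 4 * hermNorm v * ‖w‖ := by
    intro j _
    have h1 := norm_apply_le_hermNorm v j
    have h2 := norm_le_pi_norm w j
    have h3 : |(v j).re * (w j).re| ≤ hermNorm v * ‖w‖ := by
      rw [abs_mul]
      exact mul_le_mul ((Complex.abs_re_le_norm _).trans h1) ((Complex.abs_re_le_norm _).trans h2)
        (abs_nonneg _) (hermNorm_nonneg v)
    have h4 : |(v j).im * (w j).im| ≤ hermNorm v * ‖w‖ := by
      rw [abs_mul]
      exact mul_le_mul ((Complex.abs_im_le_norm _).trans h1) ((Complex.abs_im_le_norm _).trans h2)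
        (abs_nonneg _) (hermNorm_nonneg v)
    rw [Real.norm_eq_abs, abs_mul, abs_two]
    have := abs_add_le ((v j).re * (w j).re) ((v j).im * (w j).im)
    linarith
  refine (Finset.sum_le_sum this).trans (le_of_eq ?_)
  simp
  ring

lemma contDiff_shiftSq_chartVec (h : Fin n → ℂ) (i : Fin (n + 1)) {k : WithTop ℕ∞} :
    ContDiff ℝ k (fun z => shiftSq h (chartVec i z)) := by
  unfold shiftSq
  refine ContDiff.sum fun j _ => ContDiff.norm_sq ℝ ?_
  exact (contDiff_chartVec i j.succ).add (contDiff_const.mul (contDiff_chartVec i 0))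

lemma contDiff_norm_chartVec_sq (i : Fin (n + 1)) {k : WithTop ℕ∞} :
    ContDiff ℝ k (fun z : Fin n → ℂ => ‖chartVec i z 0‖ ^ 2) :=
  (contDiff_chartVec i 0).norm_sq ℝ

lemma contDiffAt_toChartZero {i : Fin (n + 1)} {z : Fin n → ℂ} (hz : chartVec i z 0 ≠ 0)
    {k : WithTop ℕ∞} : ContDiffAt ℝ k (toChartZero i) z := by
  have : ContDiffAt ℂ k (toChartZero i) z := by
    rw [contDiffAt_pi]
    exact fun j => (contDiff_chartVec i j.succ).contDiffAt.div (contDiff_chartVec i 0).contDiffAt hz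
  exact this.restrict_scalars ℝ

/-- The squared gradient of `‖w' + w₀ h‖² / |w₀|²` is at most a multiple of the function itself. -/
lemma norm_fderiv_shiftSq_div_sq_le (h : Fin n → ℂ) {i : Fin (n + 1)} {z : Fin n → ℂ}
    (hz : chartVec i z 0 ≠ 0) :
    ‖fderiv ℝ (fun z => shiftSq h (chartVec i z) / ‖chartVec i z 0‖ ^ 2) z‖ ^ 2 ≤
      (4 * n * ‖fderiv ℝ (toChartZero i) z‖) ^ 2 *
        (shiftSq h (chartVec i z) / ‖chartVec i z 0‖ ^ 2) := by
  have hev : ∀ᶠ y in 𝓝 z, chartVec i y 0 ≠ 0 :=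
    (contDiff_chartVec (𝕜 := ℝ) i 0 (m := 0)).continuous.continuousAt.eventually_ne hz
  have h1 : (fun z => shiftSq h (chartVec i z) / ‖chartVec i z 0‖ ^ 2) =ᶠ[𝓝 z]
      fun y => hermNorm (toChartZero i y + h) ^ 2 := by
    filter_upwards [hev] with y hy using shiftSq_div h hy
  have h2 : HasFDerivAt (toChartZero i) (fderiv ℝ (toChartZero i) z) z :=
    ((contDiffAt_toChartZero hz (k := 1)).differentiableAt (by simp)).hasFDerivAt
  have h3 := (hasFDerivAt_hermNorm_sq h (toChartZero i z)).comp z h2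
  simp only [Function.comp_def] at h3
  rw [h1.fderiv_eq, h3.fderiv, shiftSq_div h hz]
  have h4 := (ContinuousLinearMap.opNorm_comp_le (hermForm n (toChartZero i z + h))
    (fderiv ℝ (toChartZero i) z)).trans
    (mul_le_mul_of_nonneg_right (norm_hermForm_apply_le _) (norm_nonneg _))
  refine (pow_le_pow_left₀ (norm_nonneg _) h4 2).trans (le_of_eq ?_)
  ring

/-- In the chart `i` the function `shiftSq h` vanishes at most at one point, namely at `[1 : -h]`, and
not faster than the squared distance. In the charts that do not contain this point it is at
least `1`. -/
lemma shiftSq_chartVec_lower_bound (h : Fin n → ℂ) (i : Fin (n + 1)) :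
    (∀ z, 1 ≤ shiftSq h (chartVec i z)) ∨
      ∃ (p : Fin n → ℂ) (C : ℝ), 0 < C ∧ ∀ z, ‖z - p‖ ≤ C * Real.sqrt (shiftSq h (chartVec i z)) := by
  have hle : ∀ z m, ‖chartVec i z m - chartVec 0 (-h) m * chartVec i z 0‖
      ≤ Real.sqrt (shiftSq h (chartVec i z)) := by
    intro z m
    refine Fin.cases ?_ (fun j => ?_) m
    · simp
    · have : chartVec 0 (-h) j.succ = -h j := by
        rw [← Fin.succAbove_zero]; exact chartVec_succAbove 0 _ j
      rw [this]
      refine Real.le_sqrt_of_sq_le ?_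
      have h1 := Finset.single_le_sum (f := fun j : Fin n =>
        ‖chartVec i z j.succ + h j * chartVec i z 0‖ ^ 2) (fun _ _ => by positivity)
        (Finset.mem_univ j)
      refine le_trans (le_of_eq ?_) h1
      congr 2
      ring
  set q := chartVec 0 (-h) with hq
  by_cases hqi : q i = 0
  · left
    intro z
    have := hle z i
    rw [hqi, chartVec_self, zero_mul, sub_zero, norm_one] at this
    rwa [← Real.one_le_sqrt]
  · right
    have hqi' := norm_pos_iff.2 hqi
    refine ⟨fun k => q (i.succAbove k) / q i, 1 + ‖q‖ / ‖q i‖, by positivity, fun z => ?_⟩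
    set s := Real.sqrt (shiftSq h (chartVec i z))
    have hs : 0 ≤ s := Real.sqrt_nonneg _
    refine (pi_norm_le_iff_of_nonneg (by positivity)).2 fun k => ?_
    have h0 := hle z i
    have hk := hle z (i.succAbove k)
    rw [chartVec_self] at h0
    rw [chartVec_succAbove] at hk
    have e : z k - q (i.succAbove k) / q i = (z k - q (i.succAbove k) * chartVec i z 0)
        - q (i.succAbove k) / q i * (1 - q i * chartVec i z 0) := by
      field_simp
      ring
    simp only [Pi.sub_apply]
    rw [e]
    refine (norm_sub_le _ _).trans ?_
    rw [norm_mul, norm_div, add_mul, one_mul]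
    refine add_le_add hk (mul_le_mul ?_ h0 (norm_nonneg _) (by positivity))
    exact div_le_div_of_nonneg_right (norm_le_pi_norm q _) hqi'.le

lemma ae_chartVec_ne_zero (i : Fin (n + 1)) : ∀ᵐ z : Fin n → ℂ, chartVec i z 0 ≠ 0 := by
  rcases Fin.eq_self_or_eq_succAbove i 0 with h0 | ⟨j, hj⟩
  · rw [← h0]
    exact Eventually.of_forall fun z => by simp
  · have := Measure.ae_eval_ne (μ := fun _ : Fin n => (volume : Measure ℂ)) j 0
    rw [hj]
    filter_upwards [this] with z hz
    simpa using hz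

lemma ae_shiftSq_pos (hn : 1 ≤ n) (h : Fin n → ℂ) (i : Fin (n + 1)) :
    ∀ᵐ z : Fin n → ℂ, 0 < shiftSq h (chartVec i z) := by
  rcases shiftSq_chartVec_lower_bound h i with h1 | ⟨p, C, -, h1⟩
  · exact Eventually.of_forall fun z => by linarith [h1 z]
  · have : Nonempty (Fin n) := ⟨⟨0, hn⟩⟩
    filter_upwards [Measure.ae_ne volume p] with z hz
    refine lt_of_le_of_ne (shiftSq_nonneg _ _) fun h0 => hz ?_
    have := h1 z
    rw [← h0, Real.sqrt_zero, mul_zero] at this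
    exact sub_eq_zero.1 (norm_le_zero_iff.1 this)

lemma locallyIntegrable_shiftSq_rpow (hn : 1 ≤ n) (h : Fin n → ℂ) (i : Fin (n + 1)) {γ : ℝ}
    (hγ : 0 ≤ γ) (hγn : γ < n) :
    LocallyIntegrable (fun z : Fin n → ℂ => shiftSq h (chartVec i z) ^ (-γ)) := by
  have hm : AEStronglyMeasurable (fun z : Fin n → ℂ => shiftSq h (chartVec i z) ^ (-γ)) volume :=
    ((contDiff_shiftSq_chartVec h i (k := 0)).continuous.measurable.pow_const
      (-γ)).aestronglyMeasurable
  rcases shiftSq_chartVec_lower_bound h i with h1 | ⟨p, C, hC, h1⟩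
  · refine (locallyIntegrable_const (1 : ℝ)).mono hm (Eventually.of_forall fun z => ?_)
    rw [Real.norm_of_nonneg (Real.rpow_nonneg (shiftSq_nonneg _ _) _), norm_one]
    exact Real.rpow_le_one_of_one_le_of_nonpos (h1 z) (by linarith)
  · have h2 := (locallyIntegrable_norm_sub_rpow hn (β := 2 * γ) (by linarith) p).smul
      (C ^ (2 * γ))
    refine h2.mono hm ?_
    have : Nonempty (Fin n) := ⟨⟨0, hn⟩⟩
    filter_upwards [ae_shiftSq_pos hn h i, Measure.ae_ne volume p] with z hz hzp
    have hpos : 0 < ‖z - p‖ := norm_pos_iff.2 (sub_ne_zero.2 hzp)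
    have h3 := h1 z
    rw [Real.norm_of_nonneg (Real.rpow_nonneg hz.le _), Pi.smul_apply, smul_eq_mul,
      Real.norm_of_nonneg (by positivity)]
    have h4 : ‖z - p‖ ^ (2 * γ) ≤ C ^ (2 * γ) * shiftSq h (chartVec i z) ^ γ := by
      refine (Real.rpow_le_rpow hpos.le h3 (by positivity)).trans (le_of_eq ?_)
      rw [Real.mul_rpow hC.le (Real.sqrt_nonneg _), Real.rpow_mul (Real.sqrt_nonneg _) 2 γ,
        Real.rpow_two, Real.sq_sqrt hz.le]
    rw [Real.rpow_neg hz.le, Real.rpow_neg hpos.le]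
    rw [← div_eq_mul_inv, ← one_div, div_le_div_iff₀ (by positivity) (by positivity)]
    linarith

/-- The regularization `Φ(a + ε b, b)` of the potential `Φ(a, b)` in the chart `i`, where
`a = ‖w' + w₀ h‖²` and `b = |w₀|²`. -/
noncomputable def chartPot (χ : ℝ → ℝ) (D : ℝ) (h : Fin n → ℂ) (i : Fin (n + 1)) (ε : ℝ)
    (z : Fin n → ℂ) : ℝ :=
  homPot χ D (shiftSq h (chartVec i z) + ε * ‖chartVec i z 0‖ ^ 2) (‖chartVec i z 0‖ ^ 2)

lemma IsProfile.contDiffAt_chartPot (hχ : IsProfile α B D χ) (h : Fin n → ℂ) (i : Fin (n + 1))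
    {p : ℝ × (Fin n → ℂ)}
    (hp : 0 < shiftSq h (chartVec i p.2) + p.1 * ‖chartVec i p.2 0‖ ^ 2) :
    ContDiffAt ℝ ∞ (Function.uncurry (chartPot χ D h i)) p := by
  have e2 : ContDiff ℝ ∞ fun p : ℝ × (Fin n → ℂ) => ‖chartVec i p.2 0‖ ^ 2 :=
    (contDiff_norm_chartVec_sq i).comp contDiff_snd
  have e1 : ContDiff ℝ ∞ fun p : ℝ × (Fin n → ℂ) => shiftSq h (chartVec i p.2) :=
    (contDiff_shiftSq_chartVec h i).comp contDiff_snd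
  exact (hχ.contDiffAt_homPot (p := (shiftSq h (chartVec i p.2) + p.1 * ‖chartVec i p.2 0‖ ^ 2,
    ‖chartVec i p.2 0‖ ^ 2)) hp).comp (f := fun p : ℝ × (Fin n → ℂ) =>
      (shiftSq h (chartVec i p.2) + p.1 * ‖chartVec i p.2 0‖ ^ 2, ‖chartVec i p.2 0‖ ^ 2)) p
    ((e1.add (contDiff_fst.mul e2)).prodMk e2).contDiffAt

lemma shiftSq_chartVec_pos_or (h : Fin n → ℂ) (i : Fin (n + 1)) (z : Fin n → ℂ) :
    0 < shiftSq h (chartVec i z) ∨ 0 < ‖chartVec i z 0‖ ^ 2 :=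
  shiftSq_pos_or h (chartVec_ne_zero i z)

lemma IsProfile.continuousAt_chartPot (hχ : IsProfile α B D χ) (hα : 0 < α) (h : Fin n → ℂ)
    (i : Fin (n + 1)) {p : ℝ × (Fin n → ℂ)} (hp : 0 ≤ p.1) :
    ContinuousAt (Function.uncurry (chartPot χ D h i)) p := by
  have e2 : Continuous fun p : ℝ × (Fin n → ℂ) => ‖chartVec i p.2 0‖ ^ 2 :=
    (contDiff_norm_chartVec_sq i (k := 0)).continuous.comp continuous_snd
  have e1 : Continuous fun p : ℝ × (Fin n → ℂ) => shiftSq h (chartVec i p.2) :=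
    (contDiff_shiftSq_chartVec h i (k := 0)).continuous.comp continuous_snd
  refine (hχ.continuousAt_homPot hα (p := (shiftSq h (chartVec i p.2) +
    p.1 * ‖chartVec i p.2 0‖ ^ 2, ‖chartVec i p.2 0‖ ^ 2)) ?_).comp (f := fun p : ℝ × (Fin n → ℂ) =>
      (shiftSq h (chartVec i p.2) + p.1 * ‖chartVec i p.2 0‖ ^ 2, ‖chartVec i p.2 0‖ ^ 2))
    ((e1.add (continuous_fst.mul e2)).prodMk e2).continuousAt
  exact (shiftSq_chartVec_pos_or h i p.2).imp (fun h1 => by positivity) id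

/-- Away from the zero of the potential, the second derivatives of the regularizations are bounded,
by continuity and compactness. -/
lemma IsProfile.exists_bound_chartPot_far (hχ : IsProfile α B D χ) (h : Fin n → ℂ)
    (i : Fin (n + 1)) {K : Set (Fin n → ℂ)} (hK : IsCompact K) :
    ∃ M : ℝ, ∀ ε ∈ Set.Icc (0 : ℝ) 1, ∀ z ∈ K,
      ‖chartVec i z 0‖ ^ 2 / 2 ≤ shiftSq h (chartVec i z) + ε * ‖chartVec i z 0‖ ^ 2 →
      ‖fderiv ℝ (fderiv ℝ (chartPot χ D h i ε)) z‖ ≤ M := by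
  have e2 : Continuous fun p : ℝ × (Fin n → ℂ) => ‖chartVec i p.2 0‖ ^ 2 :=
    (contDiff_norm_chartVec_sq i (k := 0)).continuous.comp continuous_snd
  have e1 : Continuous fun p : ℝ × (Fin n → ℂ) => shiftSq h (chartVec i p.2) :=
    (contDiff_shiftSq_chartVec h i (k := 0)).continuous.comp continuous_snd
  have hS : IsCompact ((Set.Icc (0 : ℝ) 1 ×ˢ K) ∩ {p : ℝ × (Fin n → ℂ) |
      ‖chartVec i p.2 0‖ ^ 2 / 2 ≤ shiftSq h (chartVec i p.2) + p.1 * ‖chartVec i p.2 0‖ ^ 2}) :=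
    (isCompact_Icc.prod hK).inter_right
      (isClosed_le (e2.div_const 2) (e1.add (continuous_fst.mul e2)))
  obtain ⟨M, hM⟩ := hS.exists_bound_of_continuousOn (f := fun p : ℝ × (Fin n → ℂ) =>
      fderiv ℝ (fderiv ℝ (chartPot χ D h i p.1)) p.2) (by
    rintro p ⟨⟨hp1, -⟩, hp2⟩
    refine (continuousAt_fderiv_fderiv (hχ.contDiffAt_chartPot h i ?_)).continuousWithinAt
    rcases shiftSq_chartVec_pos_or h i p.2 with h1 | h1
    · have := hp1.1
      positivity
    · exact lt_of_lt_of_le (by positivity) hp2)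
  exact ⟨M, fun ε hε z hz hle => hM (ε, z) ⟨⟨hε, hz⟩, hle⟩⟩

/-- Near the zero of the potential, the second derivatives of the regularizations are dominated by
`a ^ (α - 1)`: there the potential is `B (a / b + ε) ^ α` up to a smooth function. -/
lemma IsProfile.exists_bound_chartPot_near (hχ : IsProfile α B D χ) (hα : 0 < α) (hα1 : α < 1)
    (hB : 0 < B) (h : Fin n → ℂ) (i : Fin (n + 1)) {K : Set (Fin n → ℂ)} (hK : IsCompact K) :
    ∃ M : ℝ, ∀ ε ∈ Set.Icc (0 : ℝ) 1, ∀ z ∈ K, 0 < shiftSq h (chartVec i z) →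
      shiftSq h (chartVec i z) + ε * ‖chartVec i z 0‖ ^ 2 < ‖chartVec i z 0‖ ^ 2 / 2 →
      ‖fderiv ℝ (fderiv ℝ (chartPot χ D h i ε)) z‖ ≤ M * shiftSq h (chartVec i z) ^ (α - 1) := by
  have c1 := contDiff_shiftSq_chartVec h i (k := 2)
  have c2 := contDiff_norm_chartVec_sq (n := n) i (k := 2)
  have hK' : IsCompact (K ∩ {z | shiftSq h (chartVec i z) ≤ ‖chartVec i z 0‖ ^ 2 / 2}) :=
    hK.inter_right (isClosed_le c1.continuous (c2.continuous.div_const 2))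
  set K' := K ∩ {z | shiftSq h (chartVec i z) ≤ ‖chartVec i z 0‖ ^ 2 / 2}
  have hb : ∀ z ∈ K', 0 < ‖chartVec i z 0‖ ^ 2 := by
    rintro z ⟨-, hz⟩
    rcases shiftSq_chartVec_pos_or h i z with h1 | h1
    · have : shiftSq h (chartVec i z) ≤ ‖chartVec i z 0‖ ^ 2 / 2 := hz
      linarith
    · exact h1
  have hb' : ∀ z ∈ K', chartVec i z 0 ≠ 0 := fun z hz h0 => by
    have := hb z hz
    simp [h0] at this
  set τ : (Fin n → ℂ) → ℝ := fun z => shiftSq h (chartVec i z) / ‖chartVec i z 0‖ ^ 2 with hτ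
  have cτ : ∀ z ∈ K', ContDiffAt ℝ 2 τ z := fun z hz =>
    c1.contDiffAt.div c2.contDiffAt (hb z hz).ne'
  set L : (Fin n → ℂ) → ℝ := fun z => Real.log (‖chartVec i z 0‖ ^ 2) / 2 with hL
  have cL : ∀ z ∈ K', ContDiffAt ℝ 2 L z := fun z hz =>
    (c2.contDiffAt.log (hb z hz).ne').div_const 2
  have hcd : ∀ f : (Fin n → ℂ) → ℝ, (∀ z ∈ K', ContDiffAt ℝ 2 f z) →
      ∃ M : ℝ, ∀ z ∈ K', ‖fderiv ℝ (fderiv ℝ f) z‖ ≤ M := fun f hf =>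
    hK'.exists_bound_of_continuousOn fun z hz =>
      (((hf z hz).fderiv_right (m := 1) (by norm_num)).fderiv_right (m := 0)
        (by norm_num)).continuousAt.continuousWithinAt
  obtain ⟨M1, hM1⟩ := hcd τ cτ
  obtain ⟨M2, hM2⟩ := hcd L cL
  obtain ⟨M3, hM3⟩ := hK'.exists_bound_of_continuousOn (f := fun z => fderiv ℝ (toChartZero i) z)
    fun z hz => ((contDiffAt_toChartZero (k := 1) (hb' z hz)).fderiv_right (m := 0)
      (by norm_num)).continuousAt.continuousWithinAt
  obtain ⟨M4, hM4⟩ := hK'.exists_bound_of_continuousOn (f := fun z => ‖chartVec i z 0‖ ^ 2)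
    c2.continuous.continuousOn
  -- `M1`, `M2`, `M3`, `M4` bound the second derivatives of `τ = a / b` and of `½ log b`, the first
  -- derivative of the affine coordinates of the chart `0`, and `b`
  refine ⟨(B * α * M1 + B * α * (1 - α) * (4 * n * M3) ^ 2 + M2) * M4 ^ (1 - α),
    fun ε hε z hzK ha hlt => ?_⟩
  have hz : z ∈ K' := ⟨hzK, by
    have := mul_nonneg hε.1 (sq_nonneg ‖chartVec i z 0‖)
    show shiftSq h (chartVec i z) ≤ ‖chartVec i z 0‖ ^ 2 / 2
    linarith⟩
  have hbz := hb z hz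
  have hτz : 0 < τ z := div_pos ha hbz
  have hτ1 : τ z ≤ 1 := (div_le_one hbz).2 (by
    have : shiftSq h (chartVec i z) ≤ ‖chartVec i z 0‖ ^ 2 / 2 := hz.2
    linarith)
  have hev : chartPot χ D h i ε =ᶠ[𝓝 z] fun y => B * (τ y + ε) ^ α + L y := by
    have o1 : ∀ᶠ y in 𝓝 z, 0 < ‖chartVec i y 0‖ ^ 2 :=
      c2.continuous.continuousAt.eventually (lt_mem_nhds hbz)
    have o2 : ∀ᶠ y in 𝓝 z, shiftSq h (chartVec i y) + ε * ‖chartVec i y 0‖ ^ 2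
        < ‖chartVec i y 0‖ ^ 2 :=
      (c1.continuous.add (continuous_const.mul c2.continuous)).continuousAt.eventually_lt
        c2.continuous.continuousAt (hlt.trans (by linarith))
    filter_upwards [o1, o2] with y h1 h2
    have h3 := mul_nonneg hε.1 h1.le
    rw [chartPot, hχ.homPot_eq_inner hα (add_nonneg (shiftSq_nonneg _ _) h3) h1 h2.le, hτ, hL]
    simp only
    rw [add_div, mul_div_cancel_right₀ _ h1.ne']
  have hF : ∀ t : ℝ, 0 < t → ContDiffAt ℝ 2 (fun t : ℝ => B * (t + ε) ^ α) t := fun t ht =>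
    contDiffAt_const.mul ((contDiffAt_id.add contDiffAt_const).rpow_const_of_ne (by
      have := hε.1; simp only [id]; positivity))
  have hd1 : ∀ t : ℝ, 0 < t → HasDerivAt (fun t : ℝ => B * (t + ε) ^ α)
      (B * α * (t + ε) ^ (α - 1)) t := fun t ht => by
    have h0 : t + ε ≠ 0 := by have := hε.1; positivity
    have := (((hasDerivAt_id t).add_const ε).rpow_const (p := α) (Or.inl h0)).const_mul B
    convert! this using 1
    simp only [id]
    ring
  have hd2 : ∀ t : ℝ, 0 < t → HasDerivAt (deriv fun t : ℝ => B * (t + ε) ^ α)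
      (B * α * ((α - 1) * (t + ε) ^ (α - 2))) t := fun t ht => by
    have h0 : t + ε ≠ 0 := by have := hε.1; positivity
    have h1 := (((hasDerivAt_id t).add_const ε).rpow_const (p := α - 1) (Or.inl h0)).const_mul
      (B * α)
    have h2 : HasDerivAt (fun t : ℝ => B * α * (t + ε) ^ (α - 1))
        (B * α * ((α - 1) * (t + ε) ^ (α - 2))) t := by
      convert! h1 using 1
      simp only [id]
      ring_nf
    refine h2.congr_of_eventuallyEq ?_
    filter_upwards [lt_mem_nhds ht] with s hs using (hd1 s hs).deriv
  have hτε : τ z ≤ τ z + ε := by linarith [hε.1]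
  have b1 : |deriv (fun t : ℝ => B * (t + ε) ^ α) (τ z)| ≤ B * α * τ z ^ (α - 1) := by
    rw [(hd1 _ hτz).deriv, abs_of_nonneg (by have := hε.1; positivity)]
    gcongr ?_ * ?_
    exact Real.rpow_le_rpow_of_nonpos hτz hτε (by linarith)
  have b2 : |deriv (deriv fun t : ℝ => B * (t + ε) ^ α) (τ z)|
      ≤ B * α * (1 - α) * τ z ^ (α - 2) := by
    rw [(hd2 _ hτz).deriv, ← mul_assoc, abs_mul, abs_mul, abs_of_nonneg (by positivity),
      abs_of_nonneg (a := (τ z + ε) ^ (α - 2)) (by have := hε.1; positivity),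
      abs_of_nonpos (by linarith), neg_sub]
    have : 0 ≤ 1 - α := by linarith
    gcongr ?_ * ?_
    exact Real.rpow_le_rpow_of_nonpos hτz hτε (by linarith)
  have b3 := norm_fderiv_fderiv_comp_le (hF _ hτz) (cτ z hz)
  have b4 : ‖fderiv ℝ τ z‖ ^ 2 ≤ (4 * n * M3) ^ 2 * τ z := by
    refine (norm_fderiv_shiftSq_div_sq_le h (hb' z hz)).trans ?_
    have := hM3 z hz
    gcongr
  have hsum : fderiv ℝ (fderiv ℝ (chartPot χ D h i ε)) z =
      fderiv ℝ (fderiv ℝ fun y => B * (τ y + ε) ^ α) z + fderiv ℝ (fderiv ℝ L) z := by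
    have d1 : ContDiffAt ℝ 2 (fun y => B * (τ y + ε) ^ α) z := (hF _ hτz).comp z (cτ z hz)
    have d2 := cL z hz
    have e1 : fderiv ℝ (chartPot χ D h i ε) =ᶠ[𝓝 z]
        fun y => fderiv ℝ (fun y => B * (τ y + ε) ^ α) y + fderiv ℝ L y := by
      refine hev.fderiv.trans ?_
      filter_upwards [d1.eventually (by simp), d2.eventually (by simp)] with y h1 h2
      exact fderiv_fun_add (h1.differentiableAt (by simp)) (h2.differentiableAt (by simp))
    rw [e1.fderiv_eq]
    exact fderiv_fun_add ((d1.fderiv_right (m := 1) (by norm_num)).differentiableAt (by simp))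
      ((d2.fderiv_right (m := 1) (by norm_num)).differentiableAt (by simp))
  have hM10 : 0 ≤ M1 := (ContinuousLinearMap.opNorm_nonneg _).trans (hM1 z hz)
  have hM20 : 0 ≤ M2 := (ContinuousLinearMap.opNorm_nonneg _).trans (hM2 z hz)
  have hα1' : 0 ≤ 1 - α := by linarith
  have hone : 1 ≤ τ z ^ (α - 1) :=
    Real.one_le_rpow_of_pos_of_le_one_of_nonpos hτz hτ1 (by linarith)
  have hpow : τ z ^ (α - 2) * τ z = τ z ^ (α - 1) := by
    rw [← Real.rpow_add_one hτz.ne']; congr 1; ring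
  calc ‖fderiv ℝ (fderiv ℝ (chartPot χ D h i ε)) z‖
      ≤ ‖fderiv ℝ (fderiv ℝ fun y => B * (τ y + ε) ^ α) z‖ + ‖fderiv ℝ (fderiv ℝ L) z‖ := by
        rw [hsum]; exact ContinuousLinearMap.opNorm_add_le _ _
    _ ≤ (B * α * τ z ^ (α - 1) * M1 + B * α * (1 - α) * τ z ^ (α - 2) *
          ((4 * n * M3) ^ 2 * τ z)) + M2 := by
        refine add_le_add (b3.trans (add_le_add ?_ ?_)) (hM2 z hz)
        · exact mul_le_mul b1 (hM1 z hz) (ContinuousLinearMap.opNorm_nonneg _) (by positivity)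
        · exact mul_le_mul b2 b4 (by positivity) (by positivity)
    _ = B * α * M1 * τ z ^ (α - 1) + B * α * (1 - α) * (4 * n * M3) ^ 2 *
          (τ z ^ (α - 2) * τ z) + M2 * 1 := by ring
    _ ≤ B * α * M1 * τ z ^ (α - 1) + B * α * (1 - α) * (4 * n * M3) ^ 2 * τ z ^ (α - 1)
          + M2 * τ z ^ (α - 1) := by
        rw [hpow]
        gcongr
    _ = (B * α * M1 + B * α * (1 - α) * (4 * n * M3) ^ 2 + M2) * τ z ^ (α - 1) := by ring
    _ ≤ (B * α * M1 + B * α * (1 - α) * (4 * n * M3) ^ 2 + M2) *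
          (M4 ^ (1 - α) * shiftSq h (chartVec i z) ^ (α - 1)) := by
        refine mul_le_mul_of_nonneg_left ?_ (by positivity)
        have h4 := (le_abs_self _).trans (hM4 z hz)
        have e : τ z ^ (α - 1) = (‖chartVec i z 0‖ ^ 2) ^ (1 - α) *
            shiftSq h (chartVec i z) ^ (α - 1) := by
          rw [hτ]
          simp only
          rw [Real.div_rpow ha.le hbz.le, div_eq_inv_mul, ← Real.rpow_neg hbz.le, neg_sub]
        rw [e]
        gcongr
    _ = _ := by ring

/-- The Monge–Ampère equation of the translated potentials, by regularization in every chart. -/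
lemma IsProfile.solvesMongeAmpere (hχ : IsProfile α B D χ) (hα : 0 < α) (hα1 : α < 1)
    (hB : 0 < B) (hn : 1 ≤ n) (h : Fin n → ℂ) (c : ℝ) :
    SolvesMongeAmpere (fun x => cpPotential χ D h x + c) (cpDensity χ h) := by
  intro i
  set ε : ℕ → ℝ := fun k => 1 / ((k : ℝ) + 1) with hε
  have hε0 : ∀ k, 0 < ε k := fun k => by positivity
  have hε1 : ∀ k, ε k ∈ Set.Icc (0 : ℝ) 1 := fun k =>
    ⟨(hε0 k).le, (div_le_one (by positivity)).2 (by have : (0:ℝ) ≤ k := k.cast_nonneg; linarith)⟩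
  have hlim : Tendsto ε atTop (𝓝 0) := tendsto_one_div_add_atTop_nhds_zero_nat
  have hlim2 : ∀ z : Fin n → ℂ, Tendsto (fun k => (ε k, z)) atTop (𝓝 (0, z)) := fun z =>
    hlim.prodMk_nhds tendsto_const_nhds
  have hpos : ∀ k z, 0 < shiftSq h (chartVec i z) + ε k * ‖chartVec i z 0‖ ^ 2 := fun k z => by
    have h0 := hε0 k
    have h1 := shiftSq_nonneg h (chartVec i z)
    rcases shiftSq_chartVec_pos_or h i z with h2 | h2 <;> positivity
  have hu : ∀ z, cpPotential χ D h (affineChart i z) + c + fsPotential z =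
      chartPot χ D h i 0 z + c := fun z => by
    rw [chartPot, zero_mul, add_zero, ← cpPotential_affineChart]; ring
  simp only [hu]
  refine isBedfordTaylor_of_tendsto (v := fun k z => chartPot χ D h i (ε k) z + c)
    (A := fun z => leviMatrix (chartPot χ D h i 0) z)
    (G := fun z => shiftSq h (chartVec i z) ^ (α - 1)) (fun k => ?_) (fun z => ?_) (fun K hK => ?_)
    ?_ (fun K hK => ?_) (fun q hq => ?_) ?_ ?_
  · refine ContDiff.add ?_ contDiff_const
    rw [contDiff_iff_contDiffAt]
    intro z
    exact (hχ.contDiffAt_chartPot h i (p := (ε k, z)) (hpos k z)).comp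
      (f := fun z => (ε k, z)) z (by fun_prop)
  · exact ((hχ.continuousAt_chartPot hα h i (p := (0, z)) le_rfl).tendsto.comp (hlim2 z)).add_const c
  · obtain ⟨M, hM⟩ := (isCompact_Icc.prod hK).exists_bound_of_continuousOn
      (s := Set.Icc (0 : ℝ) 1 ×ˢ K) (f := fun p => Function.uncurry (chartPot χ D h i) p + c)
      fun p hp => ((hχ.continuousAt_chartPot hα h i hp.1.1).add
        continuousAt_const).continuousWithinAt
    exact ⟨M, fun k z hz => hM (ε k, z) ⟨hε1 k, hz⟩⟩
  · filter_upwards [ae_shiftSq_pos hn h i] with z hz j l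
    simp only [leviMatrix_eq_leviForm]
    have h1 := (continuousAt_fderiv_fderiv (hχ.contDiffAt_chartPot h i (p := (0, z))
      (by simpa using hz))).tendsto.comp (hlim2 z)
    refine (((continuous_leviForm (Pi.single j 1) (Pi.single l 1)).tendsto _).comp h1).congr
      fun k => ?_
    rw [← leviMatrix_eq_leviForm, leviMatrix_add_const, leviMatrix_eq_leviForm]
    rfl
  · obtain ⟨M1, hM1⟩ := hχ.exists_bound_chartPot_far h i hK
    obtain ⟨M2, hM2⟩ := hχ.exists_bound_chartPot_near hα hα1 hB h i hK
    obtain ⟨M3, hM3⟩ := hK.exists_bound_of_continuousOn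
      (f := fun z => shiftSq h (chartVec i z) ^ (1 - α))
      ((contDiff_shiftSq_chartVec h i (k := 0)).continuous.rpow_const
        fun _ => Or.inr (by linarith)).continuousOn
    refine ⟨|M1| * M3 + |M2|, fun k => ?_⟩
    filter_upwards [ae_shiftSq_pos hn h i] with z hz hzK j l
    rw [leviMatrix_add_const, leviMatrix_eq_leviForm]
    have e1 : ∀ k : Fin n, ‖(Pi.single k 1 : Fin n → ℂ)‖ = 1 := fun k => by
      rw [Pi.norm_single, norm_one]
    have h1 := norm_leviForm_le (fderiv ℝ (fderiv ℝ (chartPot χ D h i (ε k))) z)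
      (Pi.single j 1) (Pi.single l 1)
    rw [e1, e1, mul_one, mul_one] at h1
    refine h1.trans ?_
    have hG : 0 < shiftSq h (chartVec i z) ^ (α - 1) := Real.rpow_pos_of_pos hz _
    have hM3' : 1 ≤ M3 * shiftSq h (chartVec i z) ^ (α - 1) := by
      have h2 := mul_le_mul_of_nonneg_right ((le_abs_self _).trans (hM3 z hzK)) hG.le
      rwa [← Real.rpow_add hz, show 1 - α + (α - 1) = 0 by ring, Real.rpow_zero] at h2
    rw [add_mul]
    -- the regions `a + ε b ≥ b / 2` and `a + ε b < b / 2`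
    rcases le_or_gt (‖chartVec i z 0‖ ^ 2 / 2)
      (shiftSq h (chartVec i z) + ε k * ‖chartVec i z 0‖ ^ 2) with h2 | h2
    · have h3 := (hM1 (ε k) (hε1 k) z hzK h2).trans (le_abs_self _)
      have h4 := mul_le_mul_of_nonneg_left hM3' (abs_nonneg M1)
      have h5 := mul_nonneg (abs_nonneg M2) hG.le
      linarith
    · have h3 := hM2 (ε k) (hε1 k) z hzK hz h2
      have h4 := mul_le_mul_of_nonneg_right (le_abs_self M2) hG.le
      have h5 := mul_le_mul_of_nonneg_left hM3' (abs_nonneg M1)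
      have h6 := abs_nonneg M1
      linarith
  · have hq' : (q : ℝ) ≤ n := by exact_mod_cast hq
    have hn' : (1 : ℝ) ≤ n := by exact_mod_cast hn
    have hγ : (1 - α) * q < n := by
      have : (1 - α) * q ≤ (1 - α) * n := mul_le_mul_of_nonneg_left hq' (by linarith)
      nlinarith
    have := locallyIntegrable_shiftSq_rpow hn h i (γ := (1 - α) * q)
      (mul_nonneg (by linarith) q.cast_nonneg) hγ
    convert! this using 2 with z
    rw [← Real.rpow_natCast, ← Real.rpow_mul (shiftSq_nonneg _ _)]
    congr 1
    ring
  · filter_upwards [ae_shiftSq_pos hn h i, ae_chartVec_ne_zero i] with z hz hz0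
    have := hχ.det_leviMatrix_homPot hn h i hz0 hz
    have e : chartPot χ D h i 0 = fun z =>
        homPot χ D (shiftSq h (chartVec i z)) (‖chartVec i z 0‖ ^ 2) := by
      funext z; rw [chartPot, zero_mul, add_zero]
    rw [e]
    exact this
  · exact Eventually.of_forall fun z =>
      mul_nonneg (hχ.cpDensity_nonneg hB h _) (fsDensity_pos hn z).le

end chartMongeAmpere

/-! ### Integrals of radial functions on `ℂⁿ` -/

section radialIntegrals

variable {n : ℕ}

lemma hermNorm_eq_norm_toLp (z : Fin n → ℂ) : hermNorm z = ‖WithLp.toLp 2 z‖ := by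
  rw [hermNorm, EuclideanSpace.norm_eq]

lemma hermNorm_add_le (z w : Fin n → ℂ) : hermNorm (z + w) ≤ hermNorm z + hermNorm w := by
  simp only [hermNorm_eq_norm_toLp, WithLp.toLp_add]
  exact norm_add_le _ _

lemma hermNorm_neg (z : Fin n → ℂ) : hermNorm (-z) = hermNorm z := by
  simp [hermNorm]

lemma hermNorm_zero : hermNorm (0 : Fin n → ℂ) = 0 := by
  simp [hermNorm]

/-- Powers of the norm on a ball, with the scaling of their integrals. -/
lemma exists_integral_norm_rpow_near (hn : 1 ≤ n) {β : ℝ} (hβ : β < 2 * n) : ∃ C : ℝ, 0 ≤ C ∧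
    ∀ r : ℝ, 0 < r →
      Integrable (fun z : Fin n → ℂ => (Set.Iio r).indicator (fun t : ℝ => t ^ (-β)) ‖z‖) ∧
      ∫ z : Fin n → ℂ, (Set.Iio r).indicator (fun t : ℝ => t ^ (-β)) ‖z‖ = C * r ^ (2 * n - β) := by
  have : Nonempty (Fin n) := ⟨⟨0, hn⟩⟩
  have hn1 : 1 ≤ 2 * n := by omega
  have e : ∀ r : ℝ, ∀ y ∈ Set.Ioi (0 : ℝ), y ^ (2 * n - 1) •
      (Set.Iio r).indicator (fun t : ℝ => t ^ (-β)) y =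
      (Set.Iio r).indicator (fun t : ℝ => t ^ (2 * n - 1 - β)) y := by
    intro r y hy
    by_cases hyr : y ∈ Set.Iio r
    · rw [Set.indicator_of_mem hyr, Set.indicator_of_mem hyr, smul_eq_mul, ← Real.rpow_natCast,
        ← Real.rpow_add hy, Nat.cast_sub hn1]
      push_cast
      rfl
    · simp [hyr]
  have hint : ∀ r : ℝ, 0 < r → IntegrableOn (fun y : ℝ => y ^ (2 * n - 1 - β)) (Set.Ioo 0 r) :=
    fun r hr => (intervalIntegral.integrableOn_Ioo_rpow_iff hr).2 (by linarith)
  refine ⟨(2 * n) * (volume : Measure (Fin n → ℂ)).real (Metric.ball 0 1) * (1 / (2 * n - β)),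
    ?_, fun r hr => ⟨?_, ?_⟩⟩
  · have : 0 ≤ 1 / (2 * n - β) := one_div_nonneg.2 (by linarith)
    positivity
  · rw [integrable_fun_norm_addHaar volume
      (f := fun t => (Set.Iio r).indicator (fun t : ℝ => t ^ (-β)) t), finrank_real_complex_pi]
    rw [integrableOn_congr_fun (e r) measurableSet_Ioi, IntegrableOn,
      integrable_indicator_iff measurableSet_Iio, IntegrableOn,
      Measure.restrict_restrict measurableSet_Iio, Set.inter_comm, Set.Ioi_inter_Iio]
    exact hint r hr
  · rw [integral_fun_norm_addHaar volume
      (fun t => (Set.Iio r).indicator (fun t : ℝ => t ^ (-β)) t), finrank_real_complex_pi,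
      setIntegral_congr_fun measurableSet_Ioi (e r), setIntegral_indicator measurableSet_Iio,
      Set.Ioi_inter_Iio, ← integral_Ioc_eq_integral_Ioo, ← intervalIntegral.integral_of_le hr.le,
      integral_rpow (Or.inl (by linarith)), Real.zero_rpow (by linarith)]
    simp only [nsmul_eq_mul, smul_eq_mul]
    rw [show (2 * n - 1 - β + 1 : ℝ) = 2 * n - β by ring]
    push_cast
    ring

/-- Powers of the norm outside a ball, with the scaling of their integrals. -/
lemma exists_integral_norm_rpow_far (hn : 1 ≤ n) {β : ℝ} (hβ : 2 * n < β) : ∃ C : ℝ, 0 ≤ C ∧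
    ∀ r : ℝ, 0 < r →
      Integrable (fun z : Fin n → ℂ => (Set.Ioi r).indicator (fun t : ℝ => t ^ (-β)) ‖z‖) ∧
      ∫ z : Fin n → ℂ, (Set.Ioi r).indicator (fun t : ℝ => t ^ (-β)) ‖z‖ = C * r ^ (2 * n - β) := by
  have : Nonempty (Fin n) := ⟨⟨0, hn⟩⟩
  have hn1 : 1 ≤ 2 * n := by omega
  have e : ∀ r : ℝ, ∀ y ∈ Set.Ioi (0 : ℝ), y ^ (2 * n - 1) •
      (Set.Ioi r).indicator (fun t : ℝ => t ^ (-β)) y =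
      (Set.Ioi r).indicator (fun t : ℝ => t ^ (2 * n - 1 - β)) y := by
    intro r y hy
    by_cases hyr : y ∈ Set.Ioi r
    · rw [Set.indicator_of_mem hyr, Set.indicator_of_mem hyr, smul_eq_mul, ← Real.rpow_natCast,
        ← Real.rpow_add hy, Nat.cast_sub hn1]
      push_cast
      rfl
    · simp [hyr]
  refine ⟨(2 * n) * (volume : Measure (Fin n → ℂ)).real (Metric.ball 0 1) * (1 / (β - 2 * n)),
    ?_, fun r hr => ⟨?_, ?_⟩⟩
  · have : 0 ≤ 1 / (β - 2 * n) := one_div_nonneg.2 (by linarith)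
    positivity
  · rw [integrable_fun_norm_addHaar volume
      (f := fun t => (Set.Ioi r).indicator (fun t : ℝ => t ^ (-β)) t), finrank_real_complex_pi]
    rw [integrableOn_congr_fun (e r) measurableSet_Ioi, IntegrableOn,
      integrable_indicator_iff measurableSet_Ioi, IntegrableOn,
      Measure.restrict_restrict measurableSet_Ioi, Set.Ioi_inter_Ioi, sup_of_le_left hr.le]
    exact integrableOn_Ioi_rpow_of_lt (by linarith) hr
  · rw [integral_fun_norm_addHaar volume
      (fun t => (Set.Ioi r).indicator (fun t : ℝ => t ^ (-β)) t), finrank_real_complex_pi,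
      setIntegral_congr_fun measurableSet_Ioi (e r), setIntegral_indicator measurableSet_Ioi,
      Set.Ioi_inter_Ioi, sup_of_le_right hr.le, integral_Ioi_rpow_of_lt (by linarith) hr]
    simp only [nsmul_eq_mul, smul_eq_mul]
    rw [show (2 * n - 1 - β + 1 : ℝ) = 2 * n - β by ring,
      show (β - 2 * n : ℝ) = -(2 * n - β) by ring, one_div, inv_neg]
    push_cast
    ring

/-- Integration in polar coordinates for the Euclidean norm. -/
lemma exists_integral_hermNorm (hn : 1 ≤ n) : ∃ c : ℝ, ∀ f : ℝ → ℝ,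
    ∫ z : Fin n → ℂ, f (hermNorm z) = c * ∫ y in Set.Ioi (0 : ℝ), y ^ (2 * n - 1) * f y := by
  have : Nonempty (Fin n) := ⟨⟨0, hn⟩⟩
  set e : (Fin n → ℂ) ≃L[ℝ] EuclideanSpace ℂ (Fin n) :=
    (PiLp.continuousLinearEquiv 2 ℝ (fun _ : Fin n => ℂ)).symm with he
  have hμ : (volume.map e : Measure (EuclideanSpace ℂ (Fin n))).IsAddHaarMeasure :=
    e.isAddHaarMeasure_map _
  have hd : Module.finrank ℝ (EuclideanSpace ℂ (Fin n)) = 2 * n := by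
    rw [← finrank_real_complex_pi]
    exact e.toLinearEquiv.finrank_eq.symm
  refine ⟨(2 * n : ℕ) * (volume.map e : Measure (EuclideanSpace ℂ (Fin n))).real (Metric.ball 0 1),
    fun f => ?_⟩
  have h1 := integral_fun_norm_addHaar (volume.map e : Measure (EuclideanSpace ℂ (Fin n))) f
  have h2 : ∫ x, f ‖x‖ ∂(volume.map e : Measure (EuclideanSpace ℂ (Fin n))) =
      ∫ z : Fin n → ℂ, f (hermNorm z) := by
    refine (e.toHomeomorph.measurableEmbedding.integral_map _).trans ?_
    simp only [hermNorm_eq_norm_toLp]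
    rfl
  rw [← h2, h1, hd]
  simp only [nsmul_eq_mul, smul_eq_mul, mul_assoc]

/-- The integral of the Levi determinant of `F (‖z‖²)` depends only on the limit of `t F'(t)` at
infinity: in polar coordinates the integrand is the derivative of `(r² F'(r²))ⁿ / 2n`. -/
lemma exists_integral_radialDet (hn : 1 ≤ n) : ∃ c : ℝ, ∀ (F : ℝ → ℝ) (l : ℝ),
    (∀ t, 0 < t → ContDiffAt ℝ 2 F t) → (∀ t, 0 < t → 0 ≤ radialDet n F t) →
    Tendsto (fun t => t * deriv F t) (𝓝[>] 0) (𝓝 0) →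
    Tendsto (fun t => t * deriv F t) atTop (𝓝 l) →
    ∫ z : Fin n → ℂ, radialDet n F (hermNorm z ^ 2) = c * l ^ n := by
  obtain ⟨c, hc⟩ := exists_integral_hermNorm hn
  refine ⟨c / (2 * n), fun F l hF hpos h0 hinf => ?_⟩
  rw [hc fun r => radialDet n F (r ^ 2)]
  have hn0 : (n : ℝ) ≠ 0 := by exact_mod_cast (by omega : n ≠ 0)
  have key : ∫ y in Set.Ioi (0 : ℝ), y ^ (2 * n - 1) * radialDet n F (y ^ 2) =
      l ^ n / (2 * n) - (0 ^ 2 * deriv F (0 ^ 2)) ^ n / (2 * n) := by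
    refine integral_Ioi_of_hasDerivAt_of_nonneg (a := (0 : ℝ))
      (g := fun y => (y ^ 2 * deriv F (y ^ 2)) ^ n / (2 * n)) ?_ (fun y hy => ?_) (fun y hy => ?_) ?_
    · rw [← continuousWithinAt_Ioi_iff_Ici]
      have h1 : Tendsto (fun y : ℝ => y ^ 2) (𝓝[>] 0) (𝓝[>] 0) := by
        refine tendsto_nhdsWithin_iff.2 ⟨?_, ?_⟩
        · have : Tendsto (fun y : ℝ => y ^ 2) (𝓝 0) (𝓝 (0 ^ 2)) := (continuous_pow 2).tendsto 0
          rw [zero_pow two_ne_zero] at this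
          exact this.mono_left nhdsWithin_le_nhds
        · filter_upwards [self_mem_nhdsWithin] with y (hy : 0 < y)
          exact pow_pos hy 2
      have h2 := ((h0.comp h1).pow n).div_const (2 * n : ℝ)
      rw [ContinuousWithinAt, zero_pow two_ne_zero, zero_mul]
      exact h2
    · have hy' : (0 : ℝ) < y ^ 2 := pow_pos hy 2
      have d1 : HasDerivAt (deriv F) (deriv (deriv F) (y ^ 2)) (y ^ 2) :=
        ((contDiffAt_deriv (m := 1) (hF _ hy') (by norm_num)).differentiableAt (by simp)).hasDerivAt
      have d2 : HasDerivAt (fun t => t * deriv F t)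
          (1 * deriv F (y ^ 2) + y ^ 2 * deriv (deriv F) (y ^ 2)) (y ^ 2) :=
        (hasDerivAt_id (y ^ 2)).mul d1
      have d3 : HasDerivAt (fun y : ℝ => y ^ 2) (2 * y) y := by
        simpa using hasDerivAt_pow 2 y
      have d4 := (((HasDerivAt.comp (h := fun y : ℝ => y ^ 2) y d2 d3).pow n).div_const (2 * n : ℝ))
      refine d4.congr_deriv ?_
      simp only [Function.comp_apply, radialDet]
      obtain ⟨m, rfl⟩ : ∃ m, n = m + 1 := ⟨n - 1, by omega⟩
      simp only [Nat.add_sub_cancel, show 2 * (m + 1) - 1 = 2 * m + 1 by omega]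
      field_simp
      ring
    · have := hpos (y ^ 2) (pow_pos hy 2)
      have hy' : (0 : ℝ) < y := hy
      positivity
    · have h1 : Tendsto (fun y : ℝ => y ^ 2) atTop atTop := tendsto_pow_atTop two_ne_zero
      exact ((hinf.comp h1).pow n).div_const _
  rw [key, zero_pow two_ne_zero, zero_mul, zero_pow (by omega)]
  field_simp
  ring

end radialIntegrals

/-! ### Size, total mass and `L¹` continuity of the densities -/

section densities

variable {n : ℕ} {α B D : ℝ} {χ : ℝ → ℝ}

lemma cpShift_affineChart_zero (h z : Fin n → ℂ) :
    cpShift h (affineChart 0 z) = hermNorm (z + h) ^ 2 / (1 + hermNorm z ^ 2) := by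
  rw [affineChart_eq, cpShift_mk, shiftSq_chartVec_zero, hermNorm_chartVec_sq]

lemma cpHeight_affineChart_zero (z : Fin n → ℂ) :
    cpHeight (affineChart 0 z) = 1 / (1 + hermNorm z ^ 2) := by
  rw [affineChart_eq, cpHeight_mk, hermNorm_chartVec_sq, chartVec_self, norm_one, one_pow]

lemma cpDensity_affineChart_zero (χ : ℝ → ℝ) (h z : Fin n → ℂ) :
    cpDensity χ h (affineChart 0 z) = 2 ^ n *
      (radialDet n (radialProfile χ) (hermNorm (z + h) ^ 2) * (1 + hermNorm z ^ 2) ^ (n + 1)) := by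
  have hN : (1 + hermNorm z ^ 2) ≠ 0 := by positivity
  rw [cpDensity, cpShift_affineChart_zero, cpHeight_affineChart_zero,
    show hermNorm (z + h) ^ 2 / (1 + hermNorm z ^ 2) / (1 / (1 + hermNorm z ^ 2))
      = hermNorm (z + h) ^ 2 by field_simp, one_div_pow]
  field_simp

lemma fsDensity_mul_cpDensity (hn : 1 ≤ n) (χ : ℝ → ℝ) (h z : Fin n → ℂ) :
    fsDensity z * cpDensity χ h (affineChart 0 z) = (n.factorial : ℝ) * (2 / Real.pi) ^ n *
      radialDet n (radialProfile χ) (hermNorm (z + h) ^ 2) := by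
  have hN : (1 + hermNorm z ^ 2) ≠ 0 := by positivity
  rw [cpDensity_affineChart_zero, fsDensity_eq hn, one_div_pow]
  field_simp

lemma continuous_fsDensity (hn : 1 ≤ n) : Continuous (fsDensity : (Fin n → ℂ) → ℝ) :=
  (contDiff_fsDensity hn).continuous

lemma integral_fsVolume (hn : 1 ≤ n) {f : CP n → ℝ} (hf : Measurable f) :
    ∫ x, f x ∂(fsVolume n) = ∫ z, fsDensity z * f (affineChart 0 z) := by
  rw [fsVolume, integral_map (continuous_affineChart 0).measurable.aemeasurable
    hf.aestronglyMeasurable, integral_withDensity_eq_integral_toReal_smul₀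
    (continuous_fsDensity hn).measurable.ennreal_ofReal.aemeasurable
    (Eventually.of_forall fun z => ENNReal.ofReal_lt_top)]
  simp only [ENNReal.toReal_ofReal (fsDensity_pos hn _).le, smul_eq_mul]

/-- A function on `(0, ∞)` that is a multiple of `t ^ (-γ)` near `0` and vanishes for large `t` is
at most a multiple of `t ^ (-γ)`. -/
lemma exists_abs_le_rpow {φ : ℝ → ℝ} {c γ : ℝ} (hc : ContinuousOn φ (Set.Ioi 0))
    (h0 : ∀ t, 0 < t → t < 1 → φ t = c * t ^ (-γ)) (hinf : ∀ t, 4 < t → φ t = 0) :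
    ∃ C : ℝ, 0 ≤ C ∧ ∀ t, 0 < t → |φ t| ≤ C * t ^ (-γ) := by
  have hcont : ContinuousOn (fun t => φ t * t ^ γ) (Set.Icc (1 / 2) 5) := by
    refine (hc.mono fun t ht => ?_).mul (continuousOn_id.rpow_const fun t ht => Or.inl ?_)
    · exact lt_of_lt_of_le (by norm_num) ht.1
    · exact (lt_of_lt_of_le (by norm_num) ht.1 : (0 : ℝ) < t).ne'
  obtain ⟨M, hM⟩ := isCompact_Icc.exists_bound_of_continuousOn hcont
  refine ⟨max |c| M, le_max_of_le_left (abs_nonneg c), fun t ht => ?_⟩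
  have hp : 0 < t ^ (-γ) := Real.rpow_pos_of_pos ht _
  rcases lt_or_ge t 1 with h1 | h1
  · rw [h0 t ht h1, abs_mul, abs_of_pos hp]
    exact mul_le_mul_of_nonneg_right (le_max_left _ _) hp.le
  · rcases le_or_gt t 5 with h5 | h5
    · have h2 := hM t ⟨by linarith, h5⟩
      rw [norm_mul, Real.norm_eq_abs, Real.norm_of_nonneg (Real.rpow_nonneg ht.le _)] at h2
      rw [Real.rpow_neg ht.le, ← div_eq_mul_inv, le_div_iff₀ (Real.rpow_pos_of_pos ht _)]
      exact h2.trans (le_max_right _ _)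
    · rw [hinf t (by linarith), abs_zero]
      exact mul_nonneg (le_max_of_le_left (abs_nonneg c)) hp.le

lemma IsProfile.exists_radialDet_le (hχ : IsProfile α B D χ) (hα : 0 < α) (hn : 1 ≤ n) :
    ∃ C : ℝ, 0 ≤ C ∧ ∀ t, 0 < t →
      |radialDet n (radialProfile χ) t| ≤ C * t ^ (-((1 - α) * n)) :=
  exists_abs_le_rpow
    (fun _ ht => (hχ.contDiffAt_radialDet n ht).continuousAt.continuousWithinAt)
    (fun _ ht ht1 => hχ.radialDet_eq_rpow hα hn ht ht1) (fun _ ht => hχ.radialDet_eq_zero n ht)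

lemma IsProfile.exists_deriv_radialDet_le (hχ : IsProfile α B D χ) (hα : 0 < α) (hn : 1 ≤ n) :
    ∃ C : ℝ, 0 ≤ C ∧ ∀ t, 0 < t →
      |deriv (radialDet n (radialProfile χ)) t| ≤ C * t ^ (-((1 - α) * n + 1)) := by
  refine exists_abs_le_rpow (c := α ^ (n + 1) * B ^ n * -((1 - α) * n))
    (fun t ht => (contDiffAt_deriv (hχ.contDiffAt_radialDet n ht) (m := 0)
      (by simp)).continuousAt.continuousWithinAt) (fun t ht ht1 => ?_) (fun t ht => ?_)
  · have : radialDet n (radialProfile χ) =ᶠ[𝓝 t]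
        fun t => α ^ (n + 1) * B ^ n * t ^ (-((1 - α) * n)) := by
      filter_upwards [lt_mem_nhds ht, gt_mem_nhds ht1] with s h0 h1
        using hχ.radialDet_eq_rpow hα hn h0 h1
    rw [this.deriv_eq,
      ((Real.hasDerivAt_rpow_const (Or.inl ht.ne')).const_mul (α ^ (n + 1) * B ^ n)).deriv]
    rw [show -((1 - α) * n + 1) = -((1 - α) * n) - 1 by ring]
    ring
  · have : radialDet n (radialProfile χ) =ᶠ[𝓝 t] fun _ => 0 := by
      filter_upwards [lt_mem_nhds ht] with s hs using hχ.radialDet_eq_zero n hs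
    rw [this.deriv_eq, deriv_const]

lemma hermNorm_pos {z : Fin n → ℂ} (hz : z ≠ 0) : 0 < hermNorm z :=
  lt_of_lt_of_le (norm_pos_iff.2 hz) (norm_le_hermNorm z)

lemma hermNorm_sq_rpow_le {z : Fin n → ℂ} (hz : z ≠ 0) {γ : ℝ} (hγ : 0 ≤ γ) :
    (hermNorm z ^ 2) ^ (-γ) ≤ ‖z‖ ^ (-(2 * γ)) := by
  rw [← Real.rpow_natCast, ← Real.rpow_mul (hermNorm_nonneg z)]
  refine (le_of_eq ?_).trans (Real.rpow_le_rpow_of_nonpos (norm_pos_iff.2 hz) (norm_le_hermNorm z)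
    (by linarith : -(2 * γ) ≤ 0))
  congr 1
  push_cast
  ring

/-- The density as a function on `ℂⁿ`, and its gradient, are dominated by powers of `‖z‖`. -/
lemma IsProfile.exists_radialDet_hermNorm_le (hχ : IsProfile α B D χ) (hα : 0 < α) (hα1 : α < 1)
    (hn : 1 ≤ n) : ∃ C : ℝ, 0 ≤ C ∧ ∀ z : Fin n → ℂ, z ≠ 0 →
      |radialDet n (radialProfile χ) (hermNorm z ^ 2)| ≤ C * ‖z‖ ^ (-(2 * ((1 - α) * n))) ∧
      DifferentiableAt ℝ (fun z => radialDet n (radialProfile χ) (hermNorm z ^ 2)) z ∧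
      ‖fderiv ℝ (fun z => radialDet n (radialProfile χ) (hermNorm z ^ 2)) z‖ ≤
        C * ‖z‖ ^ (-(2 * ((1 - α) * n) + 1)) := by
  obtain ⟨C₁, hC₁, h1⟩ := hχ.exists_radialDet_le hα hn
  obtain ⟨C₂, hC₂, h2⟩ := hχ.exists_deriv_radialDet_le hα hn
  have hγ : 0 ≤ (1 - α) * n := mul_nonneg (by linarith) n.cast_nonneg
  refine ⟨max C₁ (4 * n * C₂), le_max_of_le_left hC₁, fun z hz => ?_⟩
  have hpos := hermNorm_pos hz
  have hz' := norm_pos_iff.2 hz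
  have ht : 0 < hermNorm z ^ 2 := by positivity
  have hd : HasFDerivAt (fun z => radialDet n (radialProfile χ) (hermNorm z ^ 2))
      (deriv (radialDet n (radialProfile χ)) (hermNorm z ^ 2) • hermForm n z) z := by
    have e1 := hasFDerivAt_hermNorm_sq 0 z
    simp only [add_zero] at e1
    exact ((hχ.contDiffAt_radialDet n ht).differentiableAt (by simp)).hasDerivAt.comp_hasFDerivAt
      z e1
  refine ⟨?_, hd.differentiableAt, ?_⟩
  · refine (h1 _ ht).trans ?_
    exact mul_le_mul (le_max_left _ _) (hermNorm_sq_rpow_le hz hγ) (by positivity)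
      (le_max_of_le_left hC₁)
  · rw [hd.fderiv, norm_smul, Real.norm_eq_abs]
    refine (mul_le_mul (h2 _ ht) (norm_hermForm_apply_le z) (norm_nonneg _)
      (by positivity)).trans ?_
    have e2 : (hermNorm z ^ 2) ^ (-((1 - α) * n + 1)) * hermNorm z
        = hermNorm z ^ (-(2 * ((1 - α) * n) + 1)) := by
      rw [← Real.rpow_natCast, ← Real.rpow_mul hpos.le, ← Real.rpow_add_one hpos.ne']
      congr 1
      push_cast
      ring
    have e3 : hermNorm z ^ (-(2 * ((1 - α) * n) + 1)) ≤ ‖z‖ ^ (-(2 * ((1 - α) * n) + 1)) :=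
      Real.rpow_le_rpow_of_nonpos hz' (norm_le_hermNorm z) (by linarith)
    calc C₂ * (hermNorm z ^ 2) ^ (-((1 - α) * n + 1)) * (4 * n * hermNorm z)
        = 4 * n * C₂ * ((hermNorm z ^ 2) ^ (-((1 - α) * n + 1)) * hermNorm z) := by ring
      _ ≤ 4 * n * C₂ * ‖z‖ ^ (-(2 * ((1 - α) * n) + 1)) := by
        rw [e2]
        gcongr
      _ ≤ _ := by
        gcongr
        exact le_max_right _ _

/-- The densities of the translated potentials have bounded `L^p` norms if `p (1 - α) < 1`. -/
lemma IsProfile.exists_eLpNorm_cpDensity_le (hχ : IsProfile α B D χ) (hα : 0 < α) (hα1 : α < 1)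
    (hn : 1 ≤ n) {p : ℝ} (hp : 1 < p) (hpα : p * (1 - α) < 1) (R : ℝ) :
    ∃ c₀ : ℝ, ∀ h : Fin n → ℂ, hermNorm h ≤ R →
      eLpNorm (cpDensity χ h) (ENNReal.ofReal p) (fsVolume n) ≤ ENNReal.ofReal c₀ := by
  have hn0 : (0 : ℝ) < n := by exact_mod_cast hn
  have : Nonempty (Fin n) := ⟨⟨0, hn⟩⟩
  obtain ⟨C, hC, hb⟩ := hχ.exists_radialDet_hermNorm_le hα hα1 hn
  set β : ℝ := 2 * ((1 - α) * n)
  set G : (Fin n → ℂ) → ℝ := fun z => (Set.Iio 3).indicator (fun t : ℝ => t ^ (-β)) ‖z‖ with hG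
  have hGm : Measurable G :=
    ((measurable_id.pow_const (-β)).indicator measurableSet_Iio).comp measurable_norm
  have hp0 : ENNReal.ofReal p ≠ 0 := by simpa using by linarith
  have hGp : eLpNorm G (ENNReal.ofReal p) volume < ⊤ := by
    have h1 : MemLp G (ENNReal.ofReal p) volume := by
      rw [← integrable_norm_rpow_iff hGm.aestronglyMeasurable hp0 ENNReal.ofReal_ne_top,
        ENNReal.toReal_ofReal (by linarith)]
      obtain ⟨_, -, h2⟩ := exists_integral_norm_rpow_near hn (β := β * p) (by
        have : β * p = 2 * n * (p * (1 - α)) := by simp only [β]; ring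
        rw [this]
        exact mul_lt_of_lt_one_right (by positivity) hpα)
      refine (h2 3 (by norm_num)).1.congr (Eventually.of_forall fun z => ?_)
      simp only [hG]
      by_cases hz : ‖z‖ ∈ Set.Iio (3 : ℝ)
      · rw [Set.indicator_of_mem hz, Set.indicator_of_mem hz, Real.norm_of_nonneg (by positivity),
          ← Real.rpow_mul (norm_nonneg z), neg_mul]
      · rw [Set.indicator_of_notMem hz, Set.indicator_of_notMem hz, norm_zero,
          Real.zero_rpow (by linarith)]
    exact h1.2
  -- `κ` bounds the density of `ωⁿ`, and `M * G (z + h)` the density of the translated potential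
  set κ : ℝ := (n.factorial : ℝ) * (2 / Real.pi) ^ n * (1 / 2) ^ n
  set M : ℝ := 2 ^ n * (C * (1 + (2 + R) ^ 2) ^ (n + 1))
  have hμ : (volume : Measure (Fin n → ℂ)).withDensity (fun z => ENNReal.ofReal (fsDensity z))
      ≤ ENNReal.ofReal κ • volume := by
    rw [← withDensity_const]
    refine withDensity_mono (Eventually.of_forall fun z => ENNReal.ofReal_le_ofReal ?_)
    rw [fsDensity_eq hn, ← mul_div_assoc]
    have := Real.pi_pos
    exact div_le_self (by positivity) (one_le_pow₀ (by nlinarith [sq_nonneg (hermNorm z)]))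
  refine ⟨(ENNReal.ofReal κ ^ (1 / ENNReal.ofReal p).toReal •
    (ENNReal.ofReal M * eLpNorm G (ENNReal.ofReal p) volume)).toReal, fun h hh => ?_⟩
  rw [ENNReal.ofReal_toReal]
  swap
  · refine ENNReal.mul_ne_top (ENNReal.rpow_ne_top_of_nonneg ENNReal.toReal_nonneg
      ENNReal.ofReal_ne_top) (ENNReal.mul_ne_top ENNReal.ofReal_ne_top hGp.ne)
  rw [fsVolume, eLpNorm_map_measure (hχ.measurable_cpDensity h).aestronglyMeasurable
    (continuous_affineChart 0).measurable.aemeasurable]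
  refine (eLpNorm_mono_measure _ hμ).trans ?_
  rw [eLpNorm_smul_measure_of_ne_top ENNReal.ofReal_ne_top]
  refine smul_le_smul_of_nonneg_left ?_ zero_le
  have htr : eLpNorm G (ENNReal.ofReal p) volume =
      eLpNorm (fun z => G (z + h)) (ENNReal.ofReal p) volume := by
    conv_lhs => rw [← map_add_right_eq_self (volume : Measure (Fin n → ℂ)) h]
    exact eLpNorm_map_measure hGm.aestronglyMeasurable (measurable_add_const h).aemeasurable
  rw [htr]
  refine eLpNorm_le_mul_eLpNorm_of_ae_le_mul ?_ _
  filter_upwards [Measure.ae_ne volume (-h)] with z hz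
  have hz' : z + h ≠ 0 := fun h0 => hz (eq_neg_of_add_eq_zero_left h0)
  have hGn : 0 ≤ G (z + h) := by
    by_cases hz3 : ‖z + h‖ ∈ Set.Iio (3 : ℝ)
    · simp only [hG, Set.indicator_of_mem hz3]; positivity
    · simp only [hG, Set.indicator_of_notMem hz3]; exact le_rfl
  have hR0 : 0 ≤ R := (hermNorm_nonneg h).trans hh
  have hM0 : 0 ≤ M := by positivity
  rw [Function.comp_apply, Real.norm_of_nonneg hGn, cpDensity_affineChart_zero, norm_mul,
    Real.norm_of_nonneg (by positivity), norm_mul, Real.norm_eq_abs,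
    Real.norm_of_nonneg (by positivity)]
  rcases le_or_gt (hermNorm (z + h)) 2 with h2 | h2
  · have h3 : ‖z + h‖ ∈ Set.Iio (3 : ℝ) :=
      lt_of_le_of_lt ((norm_le_hermNorm _).trans h2) (by norm_num)
    have h4 : hermNorm z ≤ 2 + R := by
      have := hermNorm_add_le (z + h) (-h)
      rw [add_neg_cancel_right, hermNorm_neg] at this
      linarith
    have h5 := hermNorm_nonneg z
    have h6 := (hb _ hz').1
    calc _ ≤ 2 ^ n * (C * ‖z + h‖ ^ (-β) * (1 + (2 + R) ^ 2) ^ (n + 1)) := by gcongr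
      _ = M * G (z + h) := by
        rw [hG]
        simp only
        rw [Set.indicator_of_mem h3]
        ring
  · rw [hχ.radialDet_eq_zero n (by nlinarith), abs_zero, zero_mul, mul_zero]
    positivity

lemma IsProfile.memLp_cpDensity (hχ : IsProfile α B D χ) (hα : 0 < α) (hα1 : α < 1)
    (hn : 1 ≤ n) {p : ℝ} (hp : 1 < p) (hpα : p * (1 - α) < 1) (h : Fin n → ℂ) :
    MemLp (cpDensity χ h) (ENNReal.ofReal p) (fsVolume n) := by
  obtain ⟨c₀, hc₀⟩ := hχ.exists_eLpNorm_cpDensity_le hα hα1 hn hp hpα (hermNorm h)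
  exact ⟨(hχ.measurable_cpDensity h).aestronglyMeasurable,
    (hc₀ h le_rfl).trans_lt ENNReal.ofReal_lt_top⟩

/-- The Monge–Ampère measures of the translated potentials have the total mass of `ωⁿ`. -/
lemma IsProfile.integral_cpDensity (hχ : IsProfile α B D χ) (hα : 0 < α) (hn : 1 ≤ n)
    (h : Fin n → ℂ) : ∫ x, cpDensity χ h x ∂(fsVolume n) = (fsVolume n).real Set.univ := by
  obtain ⟨c, hc⟩ := exists_integral_radialDet hn
  have e1 : (fsVolume n).real Set.univ = ∫ z : Fin n → ℂ, fsDensity z := by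
    have := integral_fsVolume hn (f := fun _ => (1 : ℝ)) measurable_const
    simpa using this
  have e2 : ∀ z : Fin n → ℂ, fsDensity z = (n.factorial : ℝ) * (2 / Real.pi) ^ n *
      radialDet n (fun t => Real.log (1 + t) / 2) (hermNorm z ^ 2) := fun z => by
    rw [fsDensity_eq hn, radialDet_fsProfile hn (by positivity)]
  rw [e1, integral_fsVolume hn (hχ.measurable_cpDensity h)]
  simp only [fsDensity_mul_cpDensity hn]
  simp only [e2]
  rw [integral_const_mul, integral_const_mul,
    integral_add_right_eq_self (fun z => radialDet n (radialProfile χ) (hermNorm z ^ 2)) h,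
    hc (radialProfile χ) (1 / 2), hc (fun t => Real.log (1 + t) / 2) (1 / 2)]
  · exact fun t ht => (contDiffAt_fsProfile ht.le).of_le (WithTop.coe_le_coe.2 le_top)
  · intro t ht
    rw [radialDet_fsProfile hn ht.le]
    positivity
  · have h1 : Tendsto (fun t : ℝ => t * (1 / (2 * (1 + t)))) (𝓝 0) (𝓝 (0 * (1 / (2 * (1 + 0))))) := by
      refine ContinuousAt.tendsto (f := fun t : ℝ => t * (1 / (2 * (1 + t)))) ?_
      fun_prop (disch := norm_num)
    rw [zero_mul] at h1
    refine (h1.mono_left nhdsWithin_le_nhds).congr' ?_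
    filter_upwards [self_mem_nhdsWithin] with t (ht : 0 < t)
    rw [(hasDerivAt_fsProfile ht.le).deriv]
  · have h1 : Tendsto (fun t : ℝ => 1 / 2 - 1 / 2 * (1 + t)⁻¹) atTop (𝓝 (1 / 2 - 1 / 2 * 0)) :=
      ((tendsto_inv_atTop_zero.comp (tendsto_atTop_add_const_left atTop 1
        tendsto_id)).const_mul _).const_sub _
    rw [mul_zero, sub_zero] at h1
    refine h1.congr' ?_
    filter_upwards [eventually_gt_atTop 0] with t ht
    rw [(hasDerivAt_fsProfile ht.le).deriv]
    field_simp
    ring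
  · exact fun t ht => (hχ.contDiffAt_radialProfile ht).of_le (WithTop.coe_le_coe.2 le_top)
  · exact fun t ht => hχ.radialDet_nonneg n ht
  · have h1 : Tendsto (fun t : ℝ => B * (α * t ^ α)) (𝓝 0) (𝓝 (B * (α * 0 ^ α))) :=
      (((Real.continuousAt_rpow_const 0 α (Or.inr hα.le)).tendsto.const_mul α).const_mul B)
    rw [Real.zero_rpow hα.ne', mul_zero, mul_zero] at h1
    refine (h1.mono_left nhdsWithin_le_nhds).congr' ?_
    filter_upwards [Ioo_mem_nhdsGT (zero_lt_one' ℝ)] with t ht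
    have : radialProfile χ =ᶠ[𝓝 t] fun t => B * t ^ α := by
      filter_upwards [Ioo_mem_nhds ht.1 ht.2] with r hr
      exact hχ.radialProfile_eq_inner hα hr.1.le hr.2.le
    rw [this.deriv_eq, ((Real.hasDerivAt_rpow_const (Or.inl ht.1.ne')).const_mul B).deriv,
      Real.rpow_sub_one ht.1.ne']
    have := ht.1.ne'
    field_simp
  · refine tendsto_const_nhds.congr' ?_
    filter_upwards [eventually_gt_atTop 4] with t ht
    have : radialProfile χ =ᶠ[𝓝 t] fun t => Real.log t / 2 + D := by
      filter_upwards [lt_mem_nhds ht] with r hr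
      exact hχ.radialProfile_eq_outer (le_of_lt hr)
    have ht0 : t ≠ 0 := by linarith
    rw [this.deriv_eq, (((Real.hasDerivAt_log ht0).div_const 2).add_const D).deriv]
    field_simp

/-- The `L¹` modulus of continuity of the densities under translations. Within distance `2‖h‖` of
the singularity both densities are integrated separately; outside, their difference is at most
`‖h‖` times the gradient. -/
lemma IsProfile.exists_integral_radialDet_sub_le (hχ : IsProfile α B D χ) (hα : 0 < α)
    (hn : 1 ≤ n) (hαn : 2 * n * α < 1) : ∃ C : ℝ, ∀ h : Fin n → ℂ,
      ∫ z : Fin n → ℂ, |radialDet n (radialProfile χ) (hermNorm z ^ 2) -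
        radialDet n (radialProfile χ) (hermNorm (z + h) ^ 2)| ≤ C * hermNorm h ^ (2 * n * α) := by
  have hn1 : (1 : ℝ) ≤ n := by exact_mod_cast hn
  have hα1 : α < 1 := by nlinarith
  have : Nonempty (Fin n) := ⟨⟨0, hn⟩⟩
  obtain ⟨C, hC, hb⟩ := hχ.exists_radialDet_hermNorm_le hα hα1 hn
  set g : (Fin n → ℂ) → ℝ := fun z => radialDet n (radialProfile χ) (hermNorm z ^ 2) with hg
  set β : ℝ := 2 * ((1 - α) * n) with hβ
  have hβ0 : 0 ≤ β := by have : 0 ≤ 1 - α := by linarith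
                         positivity
  have hβn : 2 * n - β = 2 * n * α := by rw [hβ]; ring
  have hαpos : 0 < 2 * n * α := by positivity
  obtain ⟨C₁, hC₁, hI⟩ := exists_integral_norm_rpow_near hn (β := β) (by linarith)
  obtain ⟨C₂, hC₂, hJ⟩ := exists_integral_norm_rpow_far hn (β := β + 1) (by linarith)
  set I : ℝ → (Fin n → ℂ) → ℝ := fun r z => (Set.Iio r).indicator (fun t : ℝ => t ^ (-β)) ‖z‖
  set J : ℝ → (Fin n → ℂ) → ℝ := fun r z =>
    (Set.Ioi r).indicator (fun t : ℝ => t ^ (-(β + 1))) ‖z‖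
  have hI0 : ∀ r z, 0 ≤ I r z := fun r z => by
    by_cases hz : ‖z‖ ∈ Set.Iio r
    · simp only [I, Set.indicator_of_mem hz]; positivity
    · simp only [I, Set.indicator_of_notMem hz]; exact le_rfl
  have hJ0 : ∀ r z, 0 ≤ J r z := fun r z => by
    by_cases hz : ‖z‖ ∈ Set.Ioi r
    · simp only [J, Set.indicator_of_mem hz]; positivity
    · simp only [J, Set.indicator_of_notMem hz]; exact le_rfl
  set Ctot : ℝ := C * (2 * C₁ * 4 ^ (2 * n * α)) +
    C * 2 ^ (β + 1) * (C₂ * 2 ^ (2 * n * α - 1)) with hCtot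
  have hCtot0 : 0 ≤ Ctot := by positivity
  refine ⟨Ctot, fun h => ?_⟩
  by_cases h0 : h = 0
  · subst h0
    simp [hermNorm_zero, Real.zero_rpow hαpos.ne']
  have hs : 0 < ‖h‖ := norm_pos_iff.2 h0
  set s := ‖h‖ with hs_def
  have hpt : ∀ᵐ z : Fin n → ℂ, |g z - g (z + h)| ≤
      C * (I (4 * s) z + I (4 * s) (z + h)) + C * 2 ^ (β + 1) * s * J (2 * s) z := by
    filter_upwards [Measure.ae_ne volume 0, Measure.ae_ne volume (-h)] with z hz hz'
    have hzh : z + h ≠ 0 := fun h0 => hz' (eq_neg_of_add_eq_zero_left h0)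
    rcases le_or_gt ‖z‖ (2 * s) with h1 | h1
    · have m1 : ‖z‖ ∈ Set.Iio (4 * s) := lt_of_le_of_lt h1 (by linarith)
      have m2 : ‖z + h‖ ∈ Set.Iio (4 * s) := lt_of_le_of_lt (norm_add_le z h) (by
        rw [← hs_def]; linarith)
      have e1 : I (4 * s) z = ‖z‖ ^ (-β) := Set.indicator_of_mem m1 _
      have e2 : I (4 * s) (z + h) = ‖z + h‖ ^ (-β) := Set.indicator_of_mem m2 _
      have := abs_sub (g z) (g (z + h))
      have b1 := (hb z hz).1
      have b2 := (hb _ hzh).1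
      have b3 : 0 ≤ C * 2 ^ (β + 1) * s * J (2 * s) z :=
        mul_nonneg (by positivity) (hJ0 _ _)
      rw [e1, e2, mul_add]
      have b4 : |g z - g (z + h)| ≤ |g z| + |g (z + h)| := by
        simpa [Real.norm_eq_abs] using norm_sub_le (g z) (g (z + h))
      linarith
    · have hzpos : 0 < ‖z‖ := by linarith
      have e1 : J (2 * s) z = ‖z‖ ^ (-(β + 1)) := Set.indicator_of_mem (s := Set.Ioi (2 * s)) h1 _
      have hy : ∀ y ∈ Metric.closedBall z s, y ≠ 0 ∧ ‖z‖ / 2 ≤ ‖y‖ := by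
        intro y hy
        rw [Metric.mem_closedBall, dist_eq_norm] at hy
        have h2 : ‖z‖ / 2 ≤ ‖y‖ := by
          have := norm_sub_norm_le z y
          rw [norm_sub_rev] at this
          linarith
        exact ⟨norm_pos_iff.1 (lt_of_lt_of_le (by positivity) h2), h2⟩
      have h3 := (convex_closedBall z s).norm_image_sub_le_of_norm_fderiv_le (𝕜 := ℝ) (f := g)
        (C := C * (2 ^ (β + 1) * ‖z‖ ^ (-(β + 1)))) (x := z + h) (y := z)
        (fun y hy' => (hb y (hy y hy').1).2.1) (fun y hy' => by
          refine (hb y (hy y hy').1).2.2.trans ?_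
          refine mul_le_mul_of_nonneg_left ?_ hC
          refine (Real.rpow_le_rpow_of_nonpos (by positivity) (hy y hy').2
            (by linarith)).trans (le_of_eq ?_)
          rw [Real.div_rpow hzpos.le (by norm_num), Real.rpow_neg (by norm_num : (0:ℝ) ≤ 2),
            div_inv_eq_mul, mul_comm]) (by simp [hs_def])
        (Metric.mem_closedBall_self hs.le)
      rw [Real.norm_eq_abs, sub_add_cancel_left, norm_neg, ← hs_def] at h3
      rw [e1]
      have b1 := mul_nonneg hC (add_nonneg (hI0 (4 * s) z) (hI0 (4 * s) (z + h)))
      linarith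
  have hi1 := (hI (4 * s) (by linarith)).1
  have hi2 : Integrable fun z => I (4 * s) (z + h) := hi1.comp_add_right h
  have hi3 := (hJ (2 * s) (by linarith)).1
  have hint := ((hi1.add hi2).const_mul C).add (hi3.const_mul (C * 2 ^ (β + 1) * s))
  have hle := integral_mono_of_nonneg (Eventually.of_forall fun z => abs_nonneg (g z - g (z + h)))
    hint hpt
  refine hle.trans ?_
  have v1 := (hI (4 * s) (by linarith)).2
  have v2 : ∫ z, I (4 * s) (z + h) = _ := (integral_add_right_eq_self (I (4 * s)) h).trans v1
  have v3 := (hJ (2 * s) (by linarith)).2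
  have e : ∫ z, (C * (I (4 * s) z + I (4 * s) (z + h)) + C * 2 ^ (β + 1) * s * J (2 * s) z) =
      Ctot * s ^ (2 * n * α) := by
    have w1 : Integrable fun z => C * (I (4 * s) z + I (4 * s) (z + h)) :=
      (hi1.add hi2).const_mul C
    have w2 : Integrable fun z => C * 2 ^ (β + 1) * s * J (2 * s) z :=
      hi3.const_mul (C * 2 ^ (β + 1) * s)
    rw [integral_add w1 w2, integral_const_mul, integral_const_mul, integral_add hi1 hi2, v2, v3, v1,
      hβn, show 2 * n - (β + 1) = 2 * n * α - 1 by rw [← hβn]; ring,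
      Real.mul_rpow (by norm_num) hs.le, Real.mul_rpow (by norm_num) hs.le,
      Real.rpow_sub_one hs.ne', hCtot]
    field_simp
    ring
  refine (le_of_eq e).trans ?_
  exact mul_le_mul_of_nonneg_left (Real.rpow_le_rpow hs.le (norm_le_hermNorm h) hαpos.le) hCtot0

lemma IsProfile.exists_integral_cpDensity_sub_le (hχ : IsProfile α B D χ) (hα : 0 < α)
    (hn : 1 ≤ n) (hαn : 2 * n * α < 1) : ∃ C : ℝ, ∀ h : Fin n → ℂ,
      ∫ x, |cpDensity χ 0 x - cpDensity χ h x| ∂(fsVolume n) ≤ C * hermNorm h ^ (2 * n * α) := by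
  obtain ⟨C, hC⟩ := hχ.exists_integral_radialDet_sub_le hα hn hαn
  have hκ : 0 ≤ (n.factorial : ℝ) * (2 / Real.pi) ^ n := by
    have := Real.pi_pos
    positivity
  refine ⟨(n.factorial : ℝ) * (2 / Real.pi) ^ n * C, fun h => ?_⟩
  rw [integral_fsVolume hn
    (by simpa using ((hχ.measurable_cpDensity 0).sub (hχ.measurable_cpDensity h)).norm)]
  have e : ∀ z : Fin n → ℂ, fsDensity z *
      |cpDensity χ 0 (affineChart 0 z) - cpDensity χ h (affineChart 0 z)| =
      (n.factorial : ℝ) * (2 / Real.pi) ^ n * |radialDet n (radialProfile χ) (hermNorm z ^ 2) -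
        radialDet n (radialProfile χ) (hermNorm (z + h) ^ 2)| := by
    intro z
    conv_lhs => rw [← abs_of_pos (fsDensity_pos hn z)]
    rw [← abs_mul, mul_sub,
      fsDensity_mul_cpDensity hn, fsDensity_mul_cpDensity hn, add_zero, ← mul_sub, abs_mul,
      abs_of_nonneg hκ]
  simp only [e]
  rw [integral_const_mul, mul_assoc _ C]
  exact mul_le_mul_of_nonneg_left (hC h) hκ

lemma IsProfile.contDiffOn_cpDensity (hχ : IsProfile α B D χ) (h : Fin n → ℂ) :
    ContDiffOn ℝ ∞ (fun z => cpDensity χ h (affineChart 0 z)) {-h}ᶜ := by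
  intro z hz
  have hz' : z + h ≠ 0 := fun h0 => hz (eq_neg_of_add_eq_zero_left h0)
  refine ContDiffAt.contDiffWithinAt ?_
  simp only [cpDensity_affineChart_zero]
  have h1 : ContDiffAt ℝ ∞ (fun z => radialDet n (radialProfile χ) (hermNorm (z + h) ^ 2)) z :=
    (hχ.contDiffAt_radialDet n (hermNorm_sq_pos hz')).comp
      (f := fun z => hermNorm (z + h) ^ 2) z (contDiff_hermNorm_sq h).contDiffAt
  have h2 : ContDiff ℝ ∞ fun z : Fin n → ℂ => hermNorm z ^ 2 := by
    simpa using contDiff_hermNorm_sq (0 : Fin n → ℂ) (k := ∞)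
  exact contDiffAt_const.mul (h1.mul ((contDiff_const.add h2).pow (n + 1)).contDiffAt)

end densities

/-! ### Comparison of the translated potentials -/

section comparison

variable {n : ℕ} {α B D : ℝ} {χ : ℝ → ℝ}

lemma cpPotential_affineChart_zero (χ : ℝ → ℝ) (D : ℝ) (h z : Fin n → ℂ) :
    cpPotential χ D h (affineChart 0 z) =
      radialProfile χ (hermNorm (z + h) ^ 2) - fsPotential z := by
  have := cpPotential_affineChart χ D h 0 z
  rw [shiftSq_chartVec_zero, chartVec_self, norm_one, one_pow, homPot, if_pos one_pos, div_one,
    Real.log_one, zero_div, add_zero] at this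
  linarith

lemma IsProfile.radialProfile_sq_eq_inner (hχ : IsProfile α B D χ) (hα : 0 < α) {r : ℝ}
    (h0 : 0 ≤ r) (h1 : r ≤ 1) : radialProfile χ (r ^ 2) = B * r ^ (2 * α) := by
  rw [hχ.radialProfile_eq_inner hα (by positivity) (pow_le_one₀ h0 h1), Real.rpow_mul h0,
    Real.rpow_two]

lemma IsProfile.isModelPotential (hχ : IsProfile α B D χ) (hα : 0 < α) (hB : 0 < B) :
    IsModelPotential α B D (fun z : Fin n → ℂ => radialProfile χ (hermNorm z ^ 2)) where
  continuous := (hχ.continuous_radialProfile hα).comp (continuous_hermNorm.pow 2)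
  psh := by
    have := (hχ.isBoundedOmegaPSH hα hB (0 : Fin n → ℂ) 0).psh 0
    simpa [cpPotential_affineChart_zero] using this
  radial z w h := by rw [h]
  smooth z hz := by
    have h1 : ContDiff ℝ ∞ fun z : Fin n → ℂ => hermNorm z ^ 2 := by
      simpa using contDiff_hermNorm_sq (0 : Fin n → ℂ) (k := ∞)
    exact ((hχ.contDiffAt_radialProfile (hermNorm_sq_pos hz)).comp
      (f := fun z => hermNorm z ^ 2) z h1.contDiffAt).contDiffWithinAt
  eq_inner z hz := hχ.radialProfile_sq_eq_inner hα (hermNorm_nonneg z) (by linarith)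
  eq_outer z hz := by
    rw [hχ.radialProfile_eq_outer (by nlinarith), Real.log_pow]
    push_cast
    ring

lemma abs_hermNorm_add_sub_le (z h : Fin n → ℂ) : |hermNorm (z + h) - hermNorm z| ≤ hermNorm h := by
  have h1 := hermNorm_add_le z h
  have h2 := hermNorm_add_le (z + h) (-h)
  rw [add_neg_cancel_right, hermNorm_neg] at h2
  exact abs_le.2 ⟨by linarith, by linarith⟩

lemma IsProfile.tendstoUniformly_cpPotential (hχ : IsProfile α B D χ) (hα : 0 < α) (hB : 0 < B) :
    TendstoUniformly (cpPotential (n := n) χ D) (cpPotential χ D 0) (𝓝 0) := by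
  rw [Metric.tendstoUniformly_iff]
  intro ε hε
  obtain ⟨δ, hδ, hF⟩ := hχ.uniformContinuous_radial hα hB hε
  have hev : ∀ᶠ h : Fin n → ℂ in 𝓝 0, hermNorm h < δ :=
    continuous_hermNorm.continuousAt.eventually (gt_mem_nhds (by rwa [hermNorm_zero]))
  filter_upwards [hev] with h hh x
  induction x using Projectivization.ind with
  | h w hw =>
    by_cases h0 : w 0 = 0
    · have : shiftSq h w = shiftSq 0 w := by simp [shiftSq, h0]
      simp only [cpPotential, cpShift_mk, this, dist_self]
      exact hε
    · rw [mk_eq_affineChart_zero hw h0, Real.dist_eq, cpPotential_affineChart_zero,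
        cpPotential_affineChart_zero, add_zero, sub_sub_sub_cancel_right]
      refine hF _ _ (hermNorm_nonneg _) (hermNorm_nonneg _) ?_
      rw [abs_sub_comm]
      exact (abs_hermNorm_add_sub_le _ h).trans_lt hh

lemma IsProfile.cpPotential_sub_at_origin (hχ : IsProfile α B D χ) (hα : 0 < α) {h : Fin n → ℂ}
    (hh : hermNorm h ≤ 1) :
    cpPotential χ D h (affineChart 0 0) - cpPotential (n := n) χ D 0 (affineChart 0 0) =
      B * hermNorm h ^ (2 * α) := by
  rw [cpPotential_affineChart_zero, cpPotential_affineChart_zero, zero_add, zero_add,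
    hχ.radialProfile_sq_eq_inner hα (hermNorm_nonneg h) hh, hermNorm_zero,
    hχ.radialProfile_sq_eq_inner hα le_rfl zero_le_one, Real.zero_rpow (by linarith)]
  ring

lemma IsProfile.cpPotential_sub_at_neg (hχ : IsProfile α B D χ) (hα : 0 < α) {h : Fin n → ℂ}
    (hh : hermNorm h ≤ 1) :
    cpPotential χ D 0 (affineChart 0 (-h)) - cpPotential χ D h (affineChart 0 (-h)) =
      B * hermNorm h ^ (2 * α) := by
  rw [cpPotential_affineChart_zero, cpPotential_affineChart_zero, neg_add_cancel, add_zero,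
    hermNorm_neg, hχ.radialProfile_sq_eq_inner hα (hermNorm_nonneg h) hh, hermNorm_zero,
    hχ.radialProfile_sq_eq_inner hα le_rfl zero_le_one, Real.zero_rpow (by linarith)]
  ring

lemma bddAbove_range_of_continuous {f : CP n → ℝ} (hf : Continuous f) :
    BddAbove (Set.range f) := (isCompact_range hf).bddAbove

instance : Nonempty (CP n) := ⟨affineChart 0 0⟩

lemma IsProfile.le_iSup_abs_cpPotential_sub (hχ : IsProfile α B D χ) (hα : 0 < α)
    {h : Fin n → ℂ} (hh : hermNorm h ≤ 1) :
    B * hermNorm h ^ (2 * α) ≤ ⨆ x, |cpPotential χ D h x - cpPotential χ D 0 x| := by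
  rw [← hχ.cpPotential_sub_at_origin hα hh]
  refine (le_abs_self _).trans (le_ciSup (f := fun x =>
    |cpPotential χ D h x - cpPotential χ D 0 x|) (bddAbove_range_of_continuous ?_) _)
  exact ((hχ.continuous_cpPotential hα h).sub (hχ.continuous_cpPotential hα 0)).abs

/-- After adding a constant to one of the potentials, so that `sup (φ - ψ) = sup (ψ - φ)`, they
still differ by `B ‖h‖ ^ 2α`: without the constant, `φ - ψ` has this value at `0`, and `ψ - φ` has
it at `-h`. -/
lemma IsProfile.exists_normalized_cpPotential (hχ : IsProfile α B D χ) (hα : 0 < α)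
    {h : Fin n → ℂ} (hh : hermNorm h ≤ 1) : ∃ c : ℝ,
    (⨆ x, (cpPotential χ D h x + c - (cpPotential χ D 0 x + 0))) =
      (⨆ x, (cpPotential χ D 0 x + 0 - (cpPotential χ D h x + c))) ∧
    B * hermNorm h ^ (2 * α) ≤ ⨆ x, |cpPotential χ D h x + c - (cpPotential χ D 0 x + 0)| := by
  have hc1 := hχ.continuous_cpPotential hα h
  have hc0 := hχ.continuous_cpPotential hα (0 : Fin n → ℂ)
  have b1 := bddAbove_range_of_continuous (hc1.fun_sub hc0)
  have b2 := bddAbove_range_of_continuous (hc0.fun_sub hc1)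
  set S := ⨆ x, (cpPotential χ D h x - cpPotential χ D 0 x) with hS
  set T := ⨆ x, (cpPotential χ D 0 x - cpPotential χ D h x) with hT
  have hS' : B * hermNorm h ^ (2 * α) ≤ S := by
    rw [← hχ.cpPotential_sub_at_origin hα hh]
    exact le_ciSup (f := fun x => cpPotential χ D h x - cpPotential χ D 0 x) b1 _
  have hT' : B * hermNorm h ^ (2 * α) ≤ T := by
    rw [← hχ.cpPotential_sub_at_neg hα hh]
    exact le_ciSup (f := fun x => cpPotential χ D 0 x - cpPotential χ D h x) b2 _
  -- this constant makes both suprema equal to `(S + T) / 2`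
  set c := (T - S) / 2 with hc
  have e1 : (⨆ x, (cpPotential χ D h x + c - (cpPotential χ D 0 x + 0))) = S + c := by
    rw [hS, ciSup_add b1]
    congr 1
    funext x
    ring
  have e2 : (⨆ x, (cpPotential χ D 0 x + 0 - (cpPotential χ D h x + c))) = T + -c := by
    rw [hT, ciSup_add b2]
    congr 1
    funext x
    ring
  refine ⟨c, by rw [e1, e2, hc]; ring, ?_⟩
  have b3 : BddAbove (Set.range fun x =>
      |cpPotential χ D h x + c - (cpPotential χ D 0 x + 0)|) :=
    bddAbove_range_of_continuous
      ((hc1.add continuous_const).sub (hc0.add continuous_const)).abs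
  have h3 : S + c ≤ ⨆ x, |cpPotential χ D h x + c - (cpPotential χ D 0 x + 0)| := by
    rw [← e1]
    exact ciSup_mono b3 fun x => le_abs_self _
  rw [hc] at h3 ⊢
  linarith

lemma IsProfile.isAdmissibleDensity (hχ : IsProfile α B D χ) (hα : 0 < α) (hα1 : α < 1)
    (hB : 0 < B) (hn : 1 ≤ n) {p c₀ : ℝ} (hp : 1 < p) (hpα : p * (1 - α) < 1) {h : Fin n → ℂ}
    (hc₀ : eLpNorm (cpDensity χ h) (ENNReal.ofReal p) (fsVolume n) ≤ ENNReal.ofReal c₀) :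
    IsAdmissibleDensity p c₀ (cpDensity χ h) :=
  ⟨hχ.measurable_cpDensity h, hχ.cpDensity_nonneg hB h, hχ.memLp_cpDensity hα hα1 hn hp hpα h,
    hc₀, hχ.integral_cpDensity hα hn h⟩

lemma exists_hermNorm_eq (hn : 1 ≤ n) {r : ℝ} (hr : 0 ≤ r) : ∃ h : Fin n → ℂ, hermNorm h = r := by
  refine ⟨Pi.single ⟨0, hn⟩ (r : ℂ), ?_⟩
  rw [hermNorm, Finset.sum_eq_single ⟨0, hn⟩]
  · simp [Real.sqrt_sq hr]
  · intro j _ hj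
    simp [hj]
  · simp

/-- The translated potentials contradict a stability estimate with an exponent better than
`1 / n`: as `r = ‖h‖` tends to `0`, the potentials differ by at least `B r ^ 2α`, the densities by at
most a multiple of `r ^ 2nα`. -/
lemma IsProfile.not_stabilityEstimate (hχ : IsProfile α B D χ) (hα : 0 < α) (hB : 0 < B)
    (hn : 1 ≤ n) (hαn : 2 * n * α < 1) {p c₀ : ℝ} (hp : 1 < p) (hpα : p * (1 - α) < 1)
    (hc₀ : ∀ h : Fin n → ℂ, hermNorm h ≤ 1 →
      eLpNorm (cpDensity χ h) (ENNReal.ofReal p) (fsVolume n) ≤ ENNReal.ofReal c₀)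
    {m : ℝ} (hm : 0 < m) (hmn : m < n) (C : ℝ) : ¬ StabilityEstimate n p c₀ m C := by
  intro hst
  have hn1 : (1 : ℝ) ≤ n := by exact_mod_cast hn
  have hα1 : α < 1 := by nlinarith
  obtain ⟨C₁, hC₁⟩ := hχ.exists_integral_cpDensity_sub_le hα hn hαn
  set K : ℝ := |C| * |C₁| ^ (1 / m)
  have key : ∀ r ∈ Set.Ioo (0 : ℝ) 1, B ≤ K * r ^ (2 * α * (n / m - 1)) := by
    intro r hr
    obtain ⟨h, hh⟩ := exists_hermNorm_eq hn hr.1.le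
    have hh1 : hermNorm h ≤ 1 := hh.le.trans hr.2.le
    obtain ⟨c, hc1, hc2⟩ := hχ.exists_normalized_cpPotential hα hh1
    have h1 := hst _ _ _ _ (hχ.isBoundedOmegaPSH hα hB h c) (hχ.isBoundedOmegaPSH hα hB 0 0)
      (hχ.isAdmissibleDensity hα hα1 hB hn hp hpα (hc₀ h hh1))
      (hχ.isAdmissibleDensity hα hα1 hB hn hp hpα (hc₀ 0 (by rw [hermNorm_zero]; norm_num)))
      (hχ.solvesMongeAmpere hα hα1 hB hn h c) (hχ.solvesMongeAmpere hα hα1 hB hn 0 0) hc1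
    have h2 := hC₁ h
    simp only [abs_sub_comm (cpDensity χ 0 _)] at h2
    rw [hh] at h2 hc2
    have h3 : (∫ x, |cpDensity χ h x - cpDensity χ 0 x| ∂(fsVolume n)) ^ (1 / m) ≤
        |C₁| ^ (1 / m) * (r ^ (2 * n * α)) ^ (1 / m) := by
      have hr0 : 0 ≤ r ^ (2 * n * α) := Real.rpow_nonneg hr.1.le _
      rw [← Real.mul_rpow (abs_nonneg _) hr0]
      refine Real.rpow_le_rpow (integral_nonneg fun x => abs_nonneg _) (h2.trans ?_)
        (by positivity)
      exact mul_le_mul_of_nonneg_right (le_abs_self _) hr0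
    have h4 : B * r ^ (2 * α) ≤ K * (r ^ (2 * n * α)) ^ (1 / m) := by
      refine hc2.trans (h1.trans ?_)
      have h5 : (0 : ℝ) ≤ (∫ x, |cpDensity χ h x - cpDensity χ 0 x| ∂(fsVolume n)) ^ (1 / m) :=
        Real.rpow_nonneg (integral_nonneg fun x => abs_nonneg _) _
      calc _ ≤ |C| * (∫ x, |cpDensity χ h x - cpDensity χ 0 x| ∂(fsVolume n)) ^ (1 / m) :=
            mul_le_mul_of_nonneg_right (le_abs_self C) h5
        _ ≤ |C| * (|C₁| ^ (1 / m) * (r ^ (2 * n * α)) ^ (1 / m)) :=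
            mul_le_mul_of_nonneg_left h3 (abs_nonneg C)
        _ = _ := by rw [← mul_assoc]
    have e : (r ^ (2 * n * α)) ^ (1 / m) = r ^ (2 * α * (n / m - 1)) * r ^ (2 * α) := by
      rw [← Real.rpow_mul hr.1.le, ← Real.rpow_add hr.1]
      congr 1
      field_simp
      ring
    rw [e, ← mul_assoc] at h4
    exact le_of_mul_le_mul_right h4 (Real.rpow_pos_of_pos hr.1 _)
  have hexp : 0 < 2 * α * (n / m - 1) := by
    have : 1 < n / m := (one_lt_div hm).2 hmn
    have : 0 < n / m - 1 := by linarith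
    positivity
  have hlim : Tendsto (fun r : ℝ => K * r ^ (2 * α * (n / m - 1))) (𝓝[>] 0)
      (𝓝 (K * 0 ^ (2 * α * (n / m - 1)))) :=
    ((Real.continuousAt_rpow_const 0 _ (Or.inr hexp.le)).tendsto.mono_left
      nhdsWithin_le_nhds).const_mul K
  rw [Real.zero_rpow hexp.ne', mul_zero] at hlim
  refine absurd (ge_of_tendsto hlim ?_) (not_le.2 hB)
  filter_upwards [Ioo_mem_nhdsGT (zero_lt_one' ℝ)] with r hr using key r hr

end comparison

theorem mainTheorem3 (n : ℕ) (hn : 1 ≤ n) :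
    (∀ α : ℝ, 0 < α → α < 1 →
      (∃ B D : ℝ, AdmissibleConstants α B D) ∧
      ∀ B D : ℝ, AdmissibleConstants α B D →
        ∃ (ρ : (Fin n → ℂ) → ℝ) (ρbar f : (Fin n → ℂ) → CP n → ℝ),
          IsModelPotential α B D ρ ∧
          -- `ρbar h` is the continuous extension of `ρ (z + h) - ½ log(1 + ‖z‖²)` to `ℙⁿ`
          (∀ h, Continuous (ρbar h)) ∧
          (∀ h z, ρbar h (affineChart 0 z) = ρ (z + h) - fsPotential z) ∧
          (∀ h, IsBoundedOmegaPSH (ρbar h)) ∧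
          TendstoUniformly ρbar (ρbar 0) (𝓝 0) ∧
          (∀ h, hermNorm h ≤ 3 / 4 →
            B * hermNorm h ^ (2 * α) ≤ ⨆ x, |ρbar h x - ρbar 0 x|) ∧
          -- the Monge–Ampère measure of `ρbar h` is `f h ωⁿ`
          (∀ h, Measurable (f h) ∧ (∀ x, 0 ≤ f h x) ∧ SolvesMongeAmpere (ρbar h) (f h)) ∧
          (∀ h, ContDiffOn ℝ ∞ (fun z => f h (affineChart 0 z)) {-h}ᶜ) ∧
          (∀ p : ℝ, 1 < p → p * (1 - α) < 1 →
            (∀ h, MemLp (f h) (ENNReal.ofReal p) (fsVolume n)) ∧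
            ∃ c₀ : ℝ, ∀ h, hermNorm h ≤ 1 →
              eLpNorm (f h) (ENNReal.ofReal p) (fsVolume n) ≤ ENNReal.ofReal c₀) ∧
          (α < 1 / (2 * n) →
            ∃ C δ : ℝ, 0 < δ ∧ ∀ h, hermNorm h ≤ δ →
              ∫ x, |f 0 x - f h x| ∂(fsVolume n) ≤ C * hermNorm h ^ (2 * n * α))) ∧
    (∀ p : ℝ, 1 < p → p * (2 * n - 1) < 2 * n →
      ∃ c₀ : ℝ, 0 < c₀ ∧ ∀ m : ℝ, 0 < m → m < n →
        ¬ ∃ C : ℝ, StabilityEstimate n p c₀ m C) := by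
  have hn1 : (1 : ℝ) ≤ n := by exact_mod_cast hn
  refine ⟨fun α hα hα1 => ⟨exists_admissibleConstants α, fun B D h => ?_⟩, fun p hp hpn => ?_⟩
  · obtain ⟨χ, hχ⟩ := exists_isProfile hα h
    have hB : 0 < B := h.1.trans h.2.1
    refine ⟨fun z => radialProfile χ (hermNorm z ^ 2), cpPotential χ D, cpDensity χ,
      hχ.isModelPotential hα hB, hχ.continuous_cpPotential hα,
      cpPotential_affineChart_zero χ D, fun h => ?_, hχ.tendstoUniformly_cpPotential hα hB,
      fun h hh => hχ.le_iSup_abs_cpPotential_sub hα (by linarith),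
      fun h => ⟨hχ.measurable_cpDensity h, hχ.cpDensity_nonneg hB h, ?_⟩,
      hχ.contDiffOn_cpDensity, fun p hp hpα => ⟨hχ.memLp_cpDensity hα hα1 hn hp hpα,
        hχ.exists_eLpNorm_cpDensity_le hα hα1 hn hp hpα 1⟩, fun hαn => ?_⟩
    · simpa using hχ.isBoundedOmegaPSH hα hB h 0
    · simpa using hχ.solvesMongeAmpere hα hα1 hB hn h 0
    · rw [lt_div_iff₀ (by positivity)] at hαn
      obtain ⟨C, hC⟩ := hχ.exists_integral_cpDensity_sub_le hα hn (by linarith)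
      exact ⟨C, 1, one_pos, fun h _ => hC h⟩
  · -- both `p (1 - α) < 1` and `2nα < 1` hold for `α` strictly between `1 - 1/p` and `1/(2n)`
    have hp0 : 0 < p := by linarith
    have hlt : 1 - 1 / p < 1 / (2 * n) := by
      rw [sub_lt_iff_lt_add, ← sub_lt_iff_lt_add', one_sub_div (by positivity),
        div_lt_div_iff₀ (by positivity) hp0]
      linarith
    obtain ⟨α, hα', hαn⟩ := exists_between hlt
    have hα : 0 < α := lt_trans (by rw [sub_pos, div_lt_one hp0]; exact hp) hα'
    have hpα : p * (1 - α) < 1 := by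
      have : 1 - α < 1 / p := by linarith
      rwa [lt_div_iff₀ hp0, mul_comm] at this
    rw [lt_div_iff₀ (by positivity)] at hαn
    obtain ⟨B, D, h⟩ := exists_admissibleConstants α
    obtain ⟨χ, hχ⟩ := exists_isProfile hα h
    have hB : 0 < B := h.1.trans h.2.1
    obtain ⟨c₀, hc₀⟩ := hχ.exists_eLpNorm_cpDensity_le hα (by nlinarith) hn hp hpα 1
    refine ⟨max c₀ 1, by positivity, fun m hm hmn => ?_⟩
    rintro ⟨C, hC⟩
    exact hχ.not_stabilityEstimate hα hB hn (by linarith) hp hpα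
      (fun h hh => (hc₀ h hh).trans (ENNReal.ofReal_le_ofReal (le_max_left _ _))) hm hmn C hC
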